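/- **Setting.** Let $\mathcal V=(\mathcal V_0,\otimes,I)$ be a symmetric monoidal closed category whose underlying ordinary category $\mathcal V_0$ is complete and cocomplete; write $[X,Y]$ for its internal hom. Categories, functors and natural transformations enriched over $\mathcal V$ are called $\mathcal V$-categories, $\mathcal V$-functors, $\mathcal V$-natural transformations, and $[\mathcal A,\mathcal K]$ is the $\mathcal V$-category of $\mathcal V$-functors $\mathcal A\to\mathcal K$ ($\mathcal A$ small). A weight is a $\mathcal V$-functor $F:\mathcal A^{\rm op}\to\mathcal V$ with $\mathcal A$ a small $\mathcal V$-category. The limit $\{F,S\}$ of $S:\mathcal A^{\rm op}\to\mathcal K$ and the colimit $F*R$ of $R:\mathcal A\to\mathcal K$ weighted by $F$ are defined by $\mathcal V$-natural isomorphisms $\mathcal K(X,\{F,S\})\cong[\mathcal A^{\rm op},\mathcal V](F,\mathcal K(X,S))$ and $\mathcal K(F*R,X)\cong[\mathcal A^{\rm op},\mathcal V](F,\mathcal K(R,X))$. For an object $G$ of $\mathcal V$, the $G$-power of an object is its limit weighted by $G$, regarded as a weight on the unit $\mathcal V$-category. For a small ordinary category $\mathcal D$, the conical limit (colimit) in $\mathcal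 K$ of $S:\mathcal D\to\mathcal K_0$ is the limit (colimit) of the corresponding $\mathcal V$-functor on the free $\mathcal V$-category $\mathcal F\mathcal D$, weighted by the constant weight at $I$. Let $\Phi$ be a class of weights. A $\mathcal V$-category is $\Phi$-complete if it has all limits with weights in $\Phi$; a $\mathcal V$-functor is $\Phi$-continuous if its domain is $\Phi$-complete and it preserves all limits with weights in $\Phi$. A weight $G:\mathcal B^{\rm op}\to\mathcal V$ is $\Phi$-flat if for every $F:\mathcal A^{\rm op}\to\mathcal V$ in $\Phi$ and every $\mathcal V$-functor $S:\mathcal A^{\rm op}\otimes\mathcal B\to\mathcal V$ the canonical comparison $G*\{F,S\}\to\{F,G*S\}$ is invertible. A class $\Phi$ is saturated if it contains the representables and if, whenever $F:\mathcal D^{\rm op}\to\mathcal V$ is in $\Phi$ and $S:\mathcal D\to[\mathcal A^{\rm op},\mathcal V]$ takes values in $\Phi$, the colimit $F*S$ is in $\Phi$; the saturation of a class is the smallest saturated class that contains it. **Doctrines.** A doctrine is a small collection $\mathbb D$ of small categories. A small category $\mathcal C$ is $\mathbb D$-filtered if $\mathcal C$-colimits commute in $\mathbf{Set}$ with $\mathcal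 D$-limits for every $\mathcal D\in\mathbb D$. The doctrine $\mathbb D$ is sound if a small category $\mathcal C$ is $\mathbb D$-filtered whenever, for all $\mathcal D\in\mathbb D$ and all $S:\mathcal D^{\rm op}\to\mathcal C$, the category of cocones under $S$ is connected. An ordinary category is locally $\mathbb D$-presentable if it is equivalent to the category of functors $\mathcal A\to\mathbf{Set}$ preserving $\mathbb D$-limits, for some small category $\mathcal A$ with $\mathbb D$-limits; an object $X$ of it is $\mathbb D$-presentable if the functor represented by $X$ preserves $\mathbb D$-filtered colimits. $\mathcal V$ is locally $\mathbb D$-presentable as a $\otimes$-category if $\mathcal V_0$ is locally $\mathbb D$-presentable and the tensor product of any two $\mathbb D$-presentable objects of $\mathcal V_0$ is $\mathbb D$-presentable. Let $\mathcal V_{\mathbb D}$ consist of the objects $G$ for which $[G,-]:\mathcal V\to\mathcal V$ preserves $\mathbb D$-filtered colimits. **Theorem.** Let $\mathbb D$ be a sound doctrine, let $\mathcal V$ be locally $\mathbb D$-presentable as a $\otimes$-category, and let $\Phi$ be the saturation of the class of weights for conical $\mathcal D$-limits ($\mathcal D\in\mathbb D$) and for $G$-powers ($G\in\mathcal V_{\mathbb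 D}$). For every small $\Phi$-complete $\mathcal V$-category $\mathcal T$ and every $\mathcal V$-functor $F:\mathcal T\to\mathcal V$, the following are equivalent: 1. $F$ is a (conical) $\mathbb D$-filtered colimit in $[\mathcal T,\mathcal V]$ of representables; 2. $F$ is $\Phi$-flat; 3. $F$ is $\Phi$-continuous. Moreover Axiom A holds: for every small $\Phi$-complete $\mathcal V$-category $\mathcal A$ and every $\Phi$-continuous $F:\mathcal A\to\mathcal V$, the $\mathcal V$-functor $F*-:[\mathcal A^{\rm op},\mathcal V]\to\mathcal V$ is $\Phi$-continuous. -/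

import Mathlib

open CategoryTheory MonoidalCategory Limits Opposite
open scoped CategoryTheory.MonoidalClosed
universe w u u₁ u₂ u₃
set_option linter.unusedSectionVars false

noncomputable section
namespace EnrichedTheory
variable {V : Type u} [Category.{w} V] [MonoidalCategory V]

/-- The hom-object `C(X, Y)` of a `V`-category. -/
abbrev hom (V : Type u) [Category.{w} V] [MonoidalCategory V] {C : Type u₁} [EnrichedCategory V C]
    (X Y : C) : V :=
  EnrichedCategory.Hom X Y

/-- The composite of the generalized elements `f` of `K(a, b)` and `g` of `K(b, c)`. -/
def mulc {K : Type u₁} [EnrichedCategory V K] {a b c : K} {X Y : V}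
    (f : X ⟶ hom V a b) (g : Y ⟶ hom V b c) : X ⊗ Y ⟶ hom V a c :=
  (f ⊗ₘ g) ≫ eComp V a b c

section
variable {K : Type u₁} [EnrichedCategory V K] {a b c d : K} {X X' Y Y' Z : V}

lemma comp_mulc (u : X' ⟶ X) (v : Y' ⟶ Y) (f : X ⟶ hom V a b) (g : Y ⟶ hom V b c) :
    mulc (u ≫ f) (v ≫ g) = (u ⊗ₘ v) ≫ mulc f g := by
  simp [mulc, MonoidalCategory.tensorHom_comp_tensorHom_assoc]

lemma comp_mulc_left (u : X' ⟶ X) (f : X ⟶ hom V a b) (g : Y ⟶ hom V b c) :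
    mulc (u ≫ f) g = (u ▷ Y) ≫ mulc f g := by
  simpa using comp_mulc u (𝟙 _) f g

lemma comp_mulc_right (v : Y' ⟶ Y) (f : X ⟶ hom V a b) (g : Y ⟶ hom V b c) :
    mulc f (v ≫ g) = (X ◁ v) ≫ mulc f g := by
  simpa using comp_mulc (𝟙 _) v f g

lemma mulc_assoc (f : X ⟶ hom V a b) (g : Y ⟶ hom V b c) (h : Z ⟶ hom V c d) :
    mulc (mulc f g) h = (α_ _ _ _).hom ≫ mulc f (mulc g h) := by
  have h1 : mulc (mulc f g) h = ((f ⊗ₘ g) ⊗ₘ h) ≫ eComp V a b c ▷ _ ≫ eComp V a c d := by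
    rw [mulc, mulc, ← MonoidalCategory.tensorHom_id,
      MonoidalCategory.tensorHom_comp_tensorHom_assoc, Category.comp_id]
  have h2 : mulc f (mulc g h) = (f ⊗ₘ (g ⊗ₘ h)) ≫ _ ◁ eComp V b c d ≫ eComp V a b d := by
    rw [mulc, mulc, ← MonoidalCategory.id_tensorHom,
      MonoidalCategory.tensorHom_comp_tensorHom_assoc, Category.comp_id]
  rw [h1, h2, ← e_assoc', associator_naturality_assoc]

lemma eId_mulc (g : Y ⟶ hom V b c) : mulc (eId V b) g = (λ_ _).hom ≫ g := by
  have := e_id_comp V b c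
  unfold mulc
  rw [MonoidalCategory.tensorHom_def', Category.assoc, ← cancel_epi (λ_ _).inv, ]
  simp [this]

lemma mulc_eId (g : Y ⟶ hom V b c) : mulc g (eId V c) = (ρ_ _).hom ≫ g := by
  have := e_comp_id V b c
  unfold mulc
  rw [MonoidalCategory.tensorHom_def, Category.assoc, ← cancel_epi (ρ_ _).inv, ]
  simp [this]

lemma mulc_map {K' : Type u₂} [EnrichedCategory V K'] (H : EnrichedFunctor V K K')
    (f : X ⟶ hom V a b) (g : Y ⟶ hom V b c) :
    mulc f g ≫ H.map a c = mulc (f ≫ H.map a b) (g ≫ H.map b c) := by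
  simp [mulc, MonoidalCategory.tensorHom_comp_tensorHom_assoc]

end

section closed
variable [MonoidalClosed V]

/-- Currying `A ⊗ X ⟶ B` into the self-enriched hom-object `V(A,B)`. -/
def cur {A B X : V} (f : A ⊗ X ⟶ B) : X ⟶ hom V A B := MonoidalClosed.curry f

/-- The inverse of `cur`. -/
def unc {A B X : V} (f : X ⟶ hom V A B) : A ⊗ X ⟶ B := MonoidalClosed.uncurry f

@[simp] lemma unc_cur {A B X : V} (f : A ⊗ X ⟶ B) : unc (cur f) = f :=
  MonoidalClosed.uncurry_curry f

@[simp] lemma cur_unc {A B X : V} (f : X ⟶ hom V A B) : cur (unc f) = f :=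
  MonoidalClosed.curry_uncurry f

lemma unc_injective {A B X : V} {f g : X ⟶ hom V A B} (h : unc f = unc g) : f = g := by
  rw [← cur_unc f, h, cur_unc]

lemma cur_injective {A B X : V} : Function.Injective (cur : (A ⊗ X ⟶ B) → _) := by
  intro f g h
  rw [← unc_cur f, h, unc_cur]

lemma unc_comp {A B X Y : V} (u : Y ⟶ X) (f : X ⟶ hom V A B) :
    unc (u ≫ f) = A ◁ u ≫ unc f :=
  MonoidalClosed.uncurry_natural_left u f

lemma cur_comp {A B X Y : V} (u : Y ⟶ X) (f : A ⊗ X ⟶ B) :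
    cur (A ◁ u ≫ f) = u ≫ cur f :=
  MonoidalClosed.curry_natural_left u f

lemma unc_mulc {A B C X Y : V} (f : X ⟶ hom V A B) (g : Y ⟶ hom V B C) :
    unc (mulc f g) = (α_ _ _ _).inv ≫ (unc f ▷ Y) ≫ unc g := by
  have h0 : unc (eComp V A B C) = (α_ _ _ _).inv ≫
      unc (𝟙 (hom V A B)) ▷ _ ≫ unc (𝟙 (hom V B C)) := by
    have h1 (D E : V) : unc (𝟙 (hom V D E)) = (ihom.ev D).app E :=
      MonoidalClosed.uncurry_id_eq_ev D E
    rw [h1, h1]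
    exact MonoidalClosed.uncurry_curry (MonoidalClosed.compTranspose A B C)
  have hf : f = f ≫ 𝟙 _ := by simp
  have hg : g = g ≫ 𝟙 _ := by simp
  rw [mulc, unc_comp, h0, hf, hg, unc_comp, unc_comp]
  simp only [Category.comp_id]
  rw [MonoidalCategory.tensorHom_def, MonoidalCategory.whiskerLeft_comp, Category.assoc,
    associator_inv_naturality_right_assoc, associator_inv_naturality_middle_assoc,
    whisker_exchange_assoc, comp_whiskerRight_assoc]

lemma unc_eId (A : V) : unc (eId V A) = (ρ_ A).hom :=
  MonoidalClosed.uncurry_curry (ρ_ A).hom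

/-- The action `K(b,c) ⟶ [K(a,b),K(a,c)]` of `K(a,-)` on hom-objects. -/
def corepMap {K : Type u₁} [EnrichedCategory V K] (a b c : K) :
    hom V b c ⟶ hom V (hom V a b) (hom V a c) := cur (eComp V a b c)

lemma unc_comp_corepMap {K : Type u₁} [EnrichedCategory V K] (a b c : K) {X : V}
    (f : X ⟶ hom V b c) : unc (f ≫ corepMap a b c) = mulc (𝟙 (hom V a b)) f := by
  rw [corepMap, unc_comp, unc_cur, mulc]
  simp

/-- The representable `V`-functor `K(a,-)`. -/
def corep {K : Type u₁} [EnrichedCategory V K] (a : K) : EnrichedFunctor V K V where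
  obj b := hom V a b
  map b c := corepMap a b c
  map_id b := by
    apply unc_injective
    rw [unc_comp_corepMap, unc_eId, mulc_eId, Category.comp_id]
  map_comp b c d := by
    apply unc_injective
    change _ = unc (mulc (corepMap a b c) (corepMap a c d))
    rw [unc_mulc, corepMap, corepMap, corepMap, unc_comp, unc_cur, unc_cur, unc_cur, e_assoc]

end closed

section braided
variable [BraidedCategory V]

/-- `V`-naturality of a `W`-indexed family of generalized elements `σ a : W ⟶ K(F a, G a)`: the
square expressing naturality at the hom-object `A(a, b)` commutes in `V`. For `W = 𝟙_ V` this is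
the usual notion of a `V`-natural transformation. -/
def IsNat {A : Type u₁} [EnrichedCategory V A] {K : Type u₂} [EnrichedCategory V K]
    (F G : EnrichedFunctor V A K) {W : V} (σ : ∀ a, W ⟶ hom V (F.obj a) (G.obj a)) : Prop :=
  ∀ a b : A, mulc (σ a) (G.map a b) = (β_ W (hom V a b)).hom ≫ mulc (F.map a b) (σ b)

lemma isNat_iff {A : Type u₁} [EnrichedCategory V A] {K : Type u₂} [EnrichedCategory V K]
    (F G : EnrichedFunctor V A K) {W : V} (σ : ∀ a, W ⟶ hom V (F.obj a) (G.obj a)) :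
    IsNat F G σ ↔ ∃ τ : GradedNatTrans ((Center.ofBraided V).obj W) F G, τ.app = σ := by
  constructor
  · intro h
    exact ⟨⟨σ, fun a b => (h a b).symm⟩, rfl⟩
  · rintro ⟨τ, rfl⟩ a b
    exact (τ.naturality a b).symm

lemma IsNat.precomp {A : Type u₁} [EnrichedCategory V A] {K : Type u₂} [EnrichedCategory V K]
    {F G : EnrichedFunctor V A K} {W W' : V} {σ : ∀ a, W ⟶ hom V (F.obj a) (G.obj a)}
    (h : IsNat F G σ) (f : W' ⟶ W) : IsNat F G (fun a => f ≫ σ a) := by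
  intro a b
  rw [comp_mulc_left, h a b, comp_mulc_right, BraidedCategory.braiding_naturality_left_assoc]

lemma IsNat.id {A : Type u₁} [EnrichedCategory V A] {K : Type u₂} [EnrichedCategory V K]
    (F : EnrichedFunctor V A K) : IsNat F F (fun a => eId V (F.obj a)) := by
  intro a b
  rw [eId_mulc, mulc_eId]
  simp

lemma IsNat.comp {A : Type u₁} [EnrichedCategory V A] {K : Type u₂} [EnrichedCategory V K]
    {F G H : EnrichedFunctor V A K} {W W' : V} {σ : ∀ a, W ⟶ hom V (F.obj a) (G.obj a)}
    {τ : ∀ a, W' ⟶ hom V (G.obj a) (H.obj a)}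
    (hσ : IsNat F G σ) (hτ : IsNat G H τ) : IsNat F H (fun a => mulc (σ a) (τ a)) := by
  intro a b
  rw [mulc_assoc, hτ a b, comp_mulc_right, BraidedCategory.braiding_tensor_left_hom]
  rw [← cancel_epi ((α_ W W' _).inv)]
  simp only [Iso.inv_hom_id_assoc, Category.assoc]
  rw [← mulc_assoc, ← comp_mulc_left, ← hσ a b, mulc_assoc]
  simp
end braided

section functorCategory
variable [SymmetricCategory V] [MonoidalClosed V] [HasLimits V]
variable {A : Type w} [EnrichedCategory V A] {K : Type u₂} [EnrichedCategory V K]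
variable (F G : EnrichedFunctor V A K)


/-- The product of all `K(F a, G a)`. -/
abbrev natProd : V := ∏ᶜ fun a : A => hom V (F.obj a) (G.obj a)
/-- The product of all `[A(a, b), K(F a, G b)]`. -/
abbrev natCod : V := ∏ᶜ fun p : A × A => hom V (hom V p.1 p.2) (hom V (F.obj p.1) (G.obj p.2))
/-- The map that composes with the action of `G` on hom-objects. -/
def natL : natProd F G ⟶ natCod F G :=
  Pi.lift fun p => cur ((β_ _ _).hom ≫ mulc (Pi.π _ p.1) (G.map p.1 p.2))
/-- The map that composes with the action of `F` on hom-objects. -/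
def natR : natProd F G ⟶ natCod F G :=
  Pi.lift fun p => cur (mulc (F.map p.1 p.2) (Pi.π _ p.2))
/-- The object of `V`-natural transformations `[A, K](F, G)`, the end of `K(F a, G a)`. -/
def natObj : V := equalizer (natL F G) (natR F G)
/-- The inclusion in the product. -/
def natObj.ι : natObj F G ⟶ natProd F G := equalizer.ι (natL F G) (natR F G)
/-- The component at `a`. -/
def natObj.π (a : A) : natObj F G ⟶ hom V (F.obj a) (G.obj a) :=
  natObj.ι F G ≫ Pi.π _ a

variable {F G}
lemma natObj.hom_ext {W : V} {f g : W ⟶ natObj F G}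
    (h : ∀ a, f ≫ natObj.π F G a = g ≫ natObj.π F G a) : f = g := by
  have h1 : f ≫ natObj.ι F G = g ≫ natObj.ι F G := by
    apply Pi.hom_ext
    intro a
    simpa only [natObj.π, Category.assoc] using h a
  exact equalizer.hom_ext h1

lemma nat_eq_iff {W : V} (f : W ⟶ natProd F G) :
    f ≫ natL F G = f ≫ natR F G ↔ IsNat F G (fun a => f ≫ Pi.π _ a) := by
  have key (p : A × A) : (f ≫ natL F G) ≫ Pi.π _ p = (f ≫ natR F G) ≫ Pi.π _ p ↔
      mulc (f ≫ Pi.π _ p.1) (G.map p.1 p.2) =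
        (β_ W (hom V p.1 p.2)).hom ≫ mulc (F.map p.1 p.2) (f ≫ Pi.π _ p.2) := by
    rw [Category.assoc, Category.assoc, natL, natR, Pi.lift_π, Pi.lift_π,
      ← cur_comp, ← cur_comp, cur_injective.eq_iff, BraidedCategory.braiding_naturality_right_assoc,
      ← comp_mulc_left, ← comp_mulc_right, ← cancel_epi (β_ W _).hom]
    simp
  constructor
  · intro h a b
    exact (key (a, b)).1 (by rw [h])
  · intro h
    apply Pi.hom_ext
    intro p
    exact (key p).2 (h p.1 p.2)

variable (F G) in
lemma natObj.isNat : IsNat F G (natObj.π F G) :=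
  (nat_eq_iff (natObj.ι F G)).1 (equalizer.condition _ _)

/-- The universal property of `[A, K](F, G)`. -/
def natObj.lift {W : V} (σ : ∀ a, W ⟶ hom V (F.obj a) (G.obj a)) (h : IsNat F G σ) :
    W ⟶ natObj F G :=
  equalizer.lift (Pi.lift σ) ((nat_eq_iff _).2 (by simpa only [Pi.lift_π] using h))

@[simp]
lemma natObj.lift_π {W : V} (σ : ∀ a, W ⟶ hom V (F.obj a) (G.obj a)) (h : IsNat F G σ) (a : A) :
    natObj.lift σ h ≫ natObj.π F G a = σ a := by
  have h1 : natObj.lift σ h ≫ natObj.ι F G = Pi.lift σ := equalizer.lift_ι _ _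
  rw [natObj.π, reassoc_of% h1, Pi.lift_π]

/-- The `V`-category `[A, K]` of `V`-functors, for small `A`. -/
instance functorCategory : EnrichedCategory V (EnrichedFunctor V A K) where
  Hom F G := natObj F G
  id F := natObj.lift _ (IsNat.id F)
  comp F G H := natObj.lift _ ((natObj.isNat F G).comp (natObj.isNat G H))
  id_comp F G := by
    apply natObj.hom_ext
    intro a
    rw [Category.assoc, Category.assoc, natObj.lift_π, ← comp_mulc_left, natObj.lift_π, eId_mulc]
    simp
  comp_id F G := by
    apply natObj.hom_ext
    intro a
    rw [Category.assoc, Category.assoc, natObj.lift_π, ← comp_mulc_right, natObj.lift_π, mulc_eId]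
    simp
  assoc F G H J := by
    apply natObj.hom_ext
    intro a
    rw [Category.assoc, Category.assoc, Category.assoc, natObj.lift_π, natObj.lift_π,
      ← comp_mulc_left, ← comp_mulc_right, natObj.lift_π, natObj.lift_π, mulc_assoc]
    simp

lemma eId_π (F : EnrichedFunctor V A K) (a : A) :
    eId V F ≫ natObj.π F F a = eId V (F.obj a) :=
  natObj.lift_π _ (IsNat.id F) a

lemma eComp_π (F G H : EnrichedFunctor V A K) (a : A) :
    eComp V F G H ≫ natObj.π F H a = mulc (natObj.π F G a) (natObj.π G H a) :=
  natObj.lift_π _ ((natObj.isNat F G).comp (natObj.isNat G H)) a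

lemma mulc_π {F G H : EnrichedFunctor V A K} {X Y : V} (f : X ⟶ hom V F G) (g : Y ⟶ hom V G H)
    (a : A) : mulc f g ≫ natObj.π F H a = mulc (f ≫ natObj.π F G a) (g ≫ natObj.π G H a) := by
  rw [mulc, Category.assoc, eComp_π, comp_mulc]

/-- The evaluation `V`-functor `[A, K] ⟶ K` at `a`. -/
def evalAt (a : A) : EnrichedFunctor V (EnrichedFunctor V A K) K where
  obj F := F.obj a
  map F G := natObj.π F G a
  map_id F := eId_π F a
  map_comp F G H := eComp_π F G H a

end functorCategory

section weighted
variable [SymmetricCategory V] [MonoidalClosed V]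
variable {A : Type u₁} [EnrichedCategory V A] {K : Type u₂} [EnrichedCategory V K]

/-- A cone over `S` with vertex `L` and weight `W`, that is, a `V`-natural transformation
`W ⟶ K(L, S -)`. -/
structure WeightedCone (W : EnrichedFunctor V A V) (S : EnrichedFunctor V A K) (L : K) where
  app (a : A) : W.obj a ⟶ hom V L (S.obj a)
  naturality (a b : A) : mulc (app a) (S.map a b) = unc (W.map a b) ≫ app b

variable {W : EnrichedFunctor V A V} {S S' : EnrichedFunctor V A K} {L : K}

lemma isNat_cur (X : K) {Y : V} (s : ∀ a, W.obj a ⊗ Y ⟶ hom V X (S.obj a))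
    (h : ∀ a b, (α_ _ _ _).inv ≫ mulc (s a) (S.map a b) =
      W.obj a ◁ (β_ _ _).hom ≫ (α_ _ _ _).inv ≫ unc (W.map a b) ▷ Y ≫ s b) :
    IsNat W (S.comp V (corep X)) (fun a => cur (s a)) := by
  intro a b
  apply unc_injective
  change unc (mulc (cur (s a)) (S.map a b ≫ corepMap X _ _)) =
    unc (_ ≫ mulc (W.map a b) (cur (s b)))
  rw [unc_mulc, unc_cur, unc_comp_corepMap, unc_comp, unc_mulc, unc_cur, ← h a b, ← comp_mulc_left]
  simp

lemma IsNat.unc_eq {X : K} {Y : V} {σ : ∀ a, Y ⟶ hom V (W.obj a) (hom V X (S.obj a))}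
    (h : IsNat W (S.comp V (corep X)) σ) (a b : A) :
    (α_ _ _ _).inv ≫ mulc (unc (σ a)) (S.map a b) =
      W.obj a ◁ (β_ _ _).hom ≫ (α_ _ _ _).inv ≫ unc (W.map a b) ▷ Y ≫ unc (σ b) := by
  have h1 := congrArg unc (h a b)
  change unc (mulc (σ a) (S.map a b ≫ corepMap X _ _)) =
    unc (_ ≫ mulc (W.map a b) (σ b)) at h1
  rw [unc_mulc, unc_comp_corepMap, unc_comp, unc_mulc, ← comp_mulc_left] at h1
  simpa using h1

namespace WeightedCone

/-- The map `K(X, L) ⟶ [W a, K(X, S a)]` given by composition with the cone. -/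
def push (c : WeightedCone W S L) (X : K) (a : A) :
    hom V X L ⟶ hom V (W.obj a) (hom V X (S.obj a)) :=
  cur ((β_ _ _).hom ≫ mulc (𝟙 (hom V X L)) (c.app a))

lemma isNat_push (c : WeightedCone W S L) (X : K) :
    IsNat W (S.comp V (corep X)) (c.push X) := by
  apply isNat_cur
  intro a b
  rw [comp_mulc_left, mulc_assoc, c.naturality, comp_mulc_right,
    BraidedCategory.braiding_naturality_left_assoc, BraidedCategory.braiding_tensor_left_hom]
  simp [← MonoidalCategory.whiskerLeft_comp_assoc]

/-- The image of a cone under a `V`-functor. -/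
def map {K' : Type u₃} [EnrichedCategory V K'] (c : WeightedCone W S L)
    (H : EnrichedFunctor V K K') : WeightedCone W (S.comp V H) (H.obj L) where
  app a := c.app a ≫ H.map _ _
  naturality a b := by
    change mulc (c.app a ≫ H.map _ _) (S.map a b ≫ H.map _ _) = _
    rw [← mulc_map, c.naturality, Category.assoc]
    rfl

end WeightedCone
end weighted

section weighted
variable [SymmetricCategory V] [MonoidalClosed V] [HasLimits V]
variable {A : Type w} [EnrichedCategory V A] {K : Type u₂} [EnrichedCategory V K]
variable {W : EnrichedFunctor V A V} {S S' : EnrichedFunctor V A K} {L : K}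


lemma natObj.isIso_iff {A : Type w} [EnrichedCategory V A] {F G : EnrichedFunctor V A K}
    {Z : V} (p : ∀ a, Z ⟶ hom V (F.obj a) (G.obj a)) (hp : IsNat F G p) :
    IsIso (natObj.lift p hp) ↔
    ∀ (Y : V) (σ : ∀ a, Y ⟶ hom V (F.obj a) (G.obj a)),
      IsNat F G σ → ∃! f : Y ⟶ Z, ∀ a, f ≫ p a = σ a := by
  constructor
  · intro h Y σ hσ
    refine ⟨natObj.lift σ hσ ≫ inv (natObj.lift p hp), fun a => ?_, fun g hg => ?_⟩
    · have h3 : inv (natObj.lift p hp) ≫ p a = natObj.π F G a := by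
        rw [IsIso.inv_comp_eq, natObj.lift_π]
      rw [Category.assoc, h3, natObj.lift_π]
    · rw [IsIso.eq_comp_inv]
      apply natObj.hom_ext
      intro a
      simpa using hg a
  · intro h
    obtain ⟨g, hg, -⟩ := h _ _ (natObj.isNat F G)
    refine ⟨g, ?_, ?_⟩
    · obtain ⟨_, _, h2⟩ := h _ _ hp
      refine (h2 _ fun a => ?_).trans (h2 (𝟙 _) fun a => by simp).symm
      simp [hg]
    · apply natObj.hom_ext
      intro a
      simpa using hg a

namespace WeightedCone
/-- The comparison `K(X, L) ⟶ [A, V](W, K(X, S -))`. -/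
def comparison (c : WeightedCone W S L) (X : K) :
    hom V X L ⟶ natObj W (S.comp V (corep X)) :=
  natObj.lift (c.push X) (c.isNat_push X)

/-- `c` exhibits `L` as the limit `{W, S}`: each comparison is invertible. -/
def IsLimit (c : WeightedCone W S L) : Prop := ∀ X : K, IsIso (c.comparison X)

lemma isLimit_iff (c : WeightedCone W S L) : c.IsLimit ↔
    ∀ (X : K) (Y : V) (σ : ∀ a, Y ⟶ hom V (W.obj a) (hom V X (S.obj a))),
      IsNat W (S.comp V (corep X)) σ → ∃! f : Y ⟶ hom V X L, ∀ a, f ≫ c.push X a = σ a :=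
  forall_congr' fun X => natObj.isIso_iff _ (c.isNat_push X)
end WeightedCone
end weighted

section opposite
variable [SymmetricCategory V]

@[simp]
lemma whiskerLeft_symm_assoc (X Y Z : V) {T : V} (h : X ⊗ Y ⊗ Z ⟶ T) :
    X ◁ (β_ Y Z).hom ≫ X ◁ (β_ Z Y).hom ≫ h = h := by
  rw [← MonoidalCategory.whiskerLeft_comp_assoc, SymmetricCategory.symmetry,
    MonoidalCategory.whiskerLeft_id, Category.id_comp]

@[simp]
lemma whiskerLeft₂_symm_assoc (X X' Y Z : V) {T : V} (h : X ⊗ X' ⊗ Y ⊗ Z ⟶ T) :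
    X ◁ X' ◁ (β_ Y Z).hom ≫ X ◁ X' ◁ (β_ Z Y).hom ≫ h = h := by
  rw [← MonoidalCategory.whiskerLeft_comp_assoc, ← MonoidalCategory.whiskerLeft_comp,
    SymmetricCategory.symmetry, MonoidalCategory.whiskerLeft_id, MonoidalCategory.whiskerLeft_id,
    Category.id_comp]

lemma braid_aux (G H R Y : V) :
    (β_ (G ⊗ H) R).hom ▷ Y ≫ (α_ _ _ _).hom ≫ R ◁ (α_ _ _ _).hom ≫
      R ◁ G ◁ (β_ H Y).hom ≫ R ◁ (α_ _ _ _).inv ≫ R ◁ (β_ (G ⊗ Y) H).hom ≫ (α_ _ _ _).inv =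
    ((α_ _ _ _).hom ≫ G ◁ (β_ H R).hom ≫ (β_ G (R ⊗ H)).hom) ▷ Y ≫ (α_ _ _ _).hom := by
  simp only [BraidedCategory.braiding_tensor_left_hom, BraidedCategory.braiding_tensor_right_hom,
    MonoidalCategory.whiskerLeft_comp, comp_whiskerRight, Category.assoc,
    MonoidalCategory.whiskerLeft_inv_hom_assoc, whiskerLeft₂_symm_assoc]
  monoidal

lemma mulc_op {K : Type u₁} [EnrichedCategory V K] {a b c : Kᵒᵖ} {X Y : V}
    (f : X ⟶ hom V a b) (g : Y ⟶ hom V b c) :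
    mulc f g = (β_ X Y).hom ≫ mulc (K := K) (a := c.unop) (b := b.unop) (c := a.unop) g f :=
  tensorHom_eComp_op_eq V f g

/-- A `V`-functor `Aᵒᵖ ⟶ K`, seen as a `V`-functor `A ⟶ Kᵒᵖ`. -/
def rop {A : Type u₁} [EnrichedCategory V A] {K : Type u₂} [EnrichedCategory V K]
    (R : EnrichedFunctor V Aᵒᵖ K) : EnrichedFunctor V A Kᵒᵖ where
  obj a := op (R.obj (op a))
  map a b := R.map (op b) (op a)
  map_id a := R.map_id (op a)
  map_comp a b c := by
    have h1 := R.map_comp (op c) (op b) (op a)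
    have h2 : eComp V (op c) (op b) (op a) = (β_ _ _).hom ≫ eComp V a b c := rfl
    rw [h2, Category.assoc] at h1
    have h3 := congrArg ((β_ (hom V a b) (hom V b c)).hom ≫ ·) h1
    simp only [SymmetricCategory.symmetry_assoc] at h3
    exact h3.trans (tensorHom_eComp_op_eq V (R.map (op b) (op a)) (R.map (op c) (op b))).symm
end opposite

section colimits
variable [SymmetricCategory V] [MonoidalClosed V] [HasLimits V] [HasColimits V]
variable {B : Type w} [EnrichedCategory V B]

namespace WCol
variable (G : EnrichedFunctor V B V) (S : EnrichedFunctor V B Vᵒᵖ)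

/-- The action of `A(a, b)` on the values of a contravariant `V`-functor. -/
def act (a b : B) : hom V a b ⊗ (S.obj b).unop ⟶ (S.obj a).unop :=
  (β_ _ _).hom ≫ unc (A := (S.obj b).unop) (B := (S.obj a).unop) (S.map a b)

/-- The coproduct of all `G b ⊗ S b`. -/
abbrev P : V := ∐ fun b : B => G.obj b ⊗ (S.obj b).unop
/-- The coproduct of all `(G a ⊗ B(a, b)) ⊗ S b`. -/
abbrev Q : V := ∐ fun p : B × B => (G.obj p.1 ⊗ hom V p.1 p.2) ⊗ (S.obj p.2).unop
/-- The action on `G`. -/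
def l : Q G S ⟶ P G S := Sigma.desc fun p =>
  unc (G.map p.1 p.2) ▷ _ ≫ Sigma.ι (fun b : B => G.obj b ⊗ (S.obj b).unop) p.2
/-- The action on `S`. -/
def r : Q G S ⟶ P G S := Sigma.desc fun p =>
  (α_ _ _ _).hom ≫ _ ◁ act S p.1 p.2 ≫ Sigma.ι (fun b : B => G.obj b ⊗ (S.obj b).unop) p.1

lemma cond_iff {X : V} (t : ∀ b : B, G.obj b ⊗ (S.obj b).unop ⟶ X) :
    l G S ≫ Sigma.desc t = r G S ≫ Sigma.desc t ↔
    ∀ a b, unc (G.map a b) ▷ _ ≫ t b = (α_ _ _ _).hom ≫ _ ◁ act S a b ≫ t a := by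
  constructor
  · intro h a b
    have := congrArg (Sigma.ι (fun p : B × B => (G.obj p.1 ⊗ hom V p.1 p.2) ⊗ (S.obj p.2).unop)
      (a, b) ≫ ·) h
    simpa [l, r] using this
  · intro h
    apply Sigma.hom_ext
    intro p
    simpa [l, r] using h p.1 p.2

theorem exists_c : ∃ (c : V) (j : ∀ b : B, G.obj b ⊗ (S.obj b).unop ⟶ c),
    (∀ a b, unc (G.map a b) ▷ _ ≫ j b = (α_ _ _ _).hom ≫ _ ◁ act S a b ≫ j a) ∧
    ∀ (X : V) (t : ∀ b : B, G.obj b ⊗ (S.obj b).unop ⟶ X),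
      (∀ a b, unc (G.map a b) ▷ _ ≫ t b = (α_ _ _ _).hom ≫ _ ◁ act S a b ≫ t a) →
      ∃! f : c ⟶ X, ∀ b, j b ≫ f = t b := by
  refine ⟨coequalizer (l G S) (r G S), fun b => Sigma.ι (fun b : B => G.obj b ⊗ (S.obj b).unop) b ≫
    coequalizer.π (l G S) (r G S), ?_, ?_⟩
  · rw [← cond_iff]
    have : Sigma.desc (fun b => Sigma.ι (fun b : B => G.obj b ⊗ (S.obj b).unop) b ≫
        coequalizer.π (l G S) (r G S)) = coequalizer.π (l G S) (r G S) := by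
      apply Sigma.hom_ext
      simp
    rw [this, coequalizer.condition]
  · intro X t ht
    rw [← cond_iff] at ht
    refine ⟨coequalizer.desc _ ht, by simp, ?_⟩
    intro g hg
    apply coequalizer.hom_ext
    apply Sigma.hom_ext
    intro b
    simpa using hg b

end WCol

/-- `V` has all small weighted colimits. -/
theorem exists_weightedColimit (G : EnrichedFunctor V B V) (S : EnrichedFunctor V B Vᵒᵖ) :
    ∃ (c : V) (κ : WeightedCone G S (op c)), κ.IsLimit := by
  obtain ⟨c, j, hj, hc⟩ := WCol.exists_c G S
  let r (b : B) : V := (S.obj b).unop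
  let Sm (a b : B) : hom V a b ⟶ hom V (r b) (r a) := S.map a b
  have hact (a b : B) : WCol.act S a b = (β_ _ _).hom ≫ unc (Sm a b) := rfl
  let k (b : B) : G.obj b ⟶ hom V (r b) c := cur ((β_ _ _).hom ≫ j b)
  have hk (a b : B) : (β_ _ _).hom ≫ mulc (Sm a b) (k a) = unc (G.map a b) ≫ k b := by
    apply unc_injective
    rw [unc_comp, unc_mulc, unc_cur, unc_comp, unc_cur,
      BraidedCategory.braiding_naturality_right_assoc, hj, hact]
    simp only [MonoidalCategory.whiskerLeft_comp, BraidedCategory.braiding_tensor_right_hom,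
      Category.assoc]
    simp
  let κ : WeightedCone G S (op c) :=
    { app := k
      naturality := fun a b => (mulc_op (K := V) _ _).trans (hk a b) }
  refine ⟨c, κ, ?_⟩
  rw [WeightedCone.isLimit_iff]
  rintro ⟨x⟩ Y σ hσ
  have hpush (b : B) (f : Y ⟶ hom V c x) :
      f ≫ κ.push (op x) b = cur (X := Y) (A := G.obj b) (B := hom V (r b) x) (mulc (k b) f) := by
    have h1 : κ.push (op x) b =
        cur (X := hom V c x) (A := G.obj b) (B := hom V (r b) x) (mulc (k b) (𝟙 _)) := by
      refine congrArg cur ?_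
      have h2 := mulc_op (K := V) (a := op x) (b := op c) (c := S.obj b) (𝟙 (hom V c x)) (k b)
      refine (congrArg ((β_ _ _).hom ≫ ·) h2).trans ?_
      exact SymmetricCategory.symmetry_assoc _ _ _
    rw [h1]
    refine (cur_comp (A := G.obj b) (B := hom V (r b) x) f (mulc (k b) (𝟙 _))).symm.trans ?_
    rw [← comp_mulc_right, Category.comp_id]
  let σ' (b : B) : G.obj b ⊗ Y ⟶ hom V (r b) x := unc (σ b)
  let s (b : B) : (G.obj b ⊗ r b) ⊗ Y ⟶ x := (β_ _ _).hom ▷ Y ≫ (α_ _ _ _).hom ≫ unc (σ' b)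
  have hs (a b : B) : unc (G.map a b) ▷ r b ▷ Y ≫ s b =
      ((α_ _ _ _).hom ≫ _ ◁ WCol.act S a b) ▷ Y ≫ s a := by
    have h1 : (α_ _ _ _).inv ≫ (β_ _ _).hom ≫ mulc (Sm a b) (σ' a) =
      G.obj a ◁ (β_ _ _).hom ≫ (α_ _ _ _).inv ≫ unc (G.map a b) ▷ Y ≫ σ' b := by
      have h2 := hσ.unc_eq a b
      refine Eq.trans ?_ h2
      exact congrArg ((α_ _ _ _).inv ≫ ·) (mulc_op (K := V) (σ' a) (Sm a b)).symm
    have h3 : r b ◁ ((α_ _ _ _).inv ≫ (β_ _ _).hom) ≫ (α_ _ _ _).inv ≫ unc (Sm a b) ▷ _ ≫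
          unc (σ' a) =
        r b ◁ (G.obj a ◁ (β_ _ _).hom ≫ (α_ _ _ _).inv ≫ unc (G.map a b) ▷ Y) ≫ unc (σ' b) := by
      have := congrArg unc h1
      rw [← Category.assoc, unc_comp, unc_mulc] at this
      rw [this, ← unc_comp]
      simp only [Category.assoc]
    have h4 : r b ◁ unc (G.map a b) ▷ Y ≫ unc (σ' b) = r b ◁ (α_ _ _ _).hom ≫
        r b ◁ G.obj a ◁ (β_ _ _).hom ≫ r b ◁ ((α_ _ _ _).inv ≫ (β_ _ _).hom) ≫
        (α_ _ _ _).inv ≫ unc (Sm a b) ▷ _ ≫ unc (σ' a) := by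
      rw [h3]
      simp
    have h5 := braid_aux (G.obj a) (hom V a b) (r b) Y =≫ (unc (Sm a b) ▷ _ ≫ unc (σ' a))
    simp only [Category.assoc, MonoidalCategory.whiskerLeft_comp] at h4 h5
    calc unc (G.map a b) ▷ r b ▷ Y ≫ s b
        = (β_ _ _).hom ▷ Y ≫ (α_ _ _ _).hom ≫ r b ◁ unc (G.map a b) ▷ Y ≫ unc (σ' b) := by
          simp only [s]
          rw [← comp_whiskerRight_assoc, BraidedCategory.braiding_naturality_left,
            comp_whiskerRight_assoc, associator_naturality_middle_assoc]
      _ = _ := by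
          rw [h4, h5, hact]
          have h6 : (β_ (G.obj a) (r b ⊗ hom V a b)).hom ▷ Y ≫ (α_ _ _ _).hom ≫
              unc (Sm a b) ▷ (G.obj a ⊗ Y) ≫ unc (σ' a) =
              (G.obj a ◁ unc (Sm a b)) ▷ Y ≫ s a := by
            simp only [s]
            rw [← associator_naturality_left_assoc, ← comp_whiskerRight_assoc,
              ← BraidedCategory.braiding_naturality_right, comp_whiskerRight_assoc]
          simp only [MonoidalCategory.whiskerLeft_comp, comp_whiskerRight, Category.assoc]
          rw [h6]
  have key (b : B) (f : Y ⟶ hom V c x) :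
      f ≫ κ.push (op x) b = σ b ↔ j b ≫ cur ((β_ _ _).hom ≫ unc f) = cur ((β_ _ _).hom ≫ s b) := by
    rw [← cur_comp, cur_injective.eq_iff, BraidedCategory.braiding_naturality_right_assoc,
      cancel_epi, hpush]
    have h1 : cur (X := Y) (A := G.obj b) (B := hom V (r b) x) (mulc (k b) f) = σ b ↔
        unc (mulc (k b) f) = unc (σ' b) := by
      constructor
      · intro h
        have : mulc (k b) f = σ' b := by
          rw [← unc_cur (mulc (k b) f)]
          exact congrArg unc h
        rw [this]
      · intro h
        have := unc_injective h
        rw [this]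
        exact cur_unc (A := G.obj b) (B := hom V (r b) x) (σ b)
    rw [h1, unc_mulc, unc_cur, Iso.inv_comp_eq, comp_whiskerRight, Category.assoc]
    constructor
    · intro h
      simp only [s]
      rw [← h, ← comp_whiskerRight_assoc, SymmetricCategory.symmetry, id_whiskerRight,
        Category.id_comp]
    · intro h
      rw [h]
      simp only [s]
      rw [← comp_whiskerRight_assoc, SymmetricCategory.symmetry, id_whiskerRight,
        Category.id_comp]
  obtain ⟨f, hf, hu⟩ := hc (hom V Y x) (fun b => cur ((β_ _ _).hom ≫ s b)) (by
    intro a b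
    apply unc_injective
    have h1 {Z Z' : V} (z : Z' ⟶ Z) (t : Z ⊗ Y ⟶ x) :
        unc (z ≫ cur ((β_ _ _).hom ≫ t)) = (β_ _ _).hom ≫ z ▷ Y ≫ t := by
      rw [unc_comp, unc_cur, BraidedCategory.braiding_naturality_right_assoc]
    have h2 := h1 ((α_ _ _ _).hom ≫ _ ◁ WCol.act S a b) (s a)
    rw [Category.assoc] at h2
    rw [h1, h2, hs])
  refine ⟨cur ((β_ _ _).hom ≫ unc f), fun b => ?_, fun g hg => ?_⟩
  · refine (key b _).2 ?_
    simpa using hf b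
  · have := hu (cur ((β_ _ _).hom ≫ unc g)) fun b => (key b g).1 (hg b)
    rw [← this]
    simp

section limHom
variable {A : Type w} [EnrichedCategory V A] {K : Type u₂} [EnrichedCategory V K]
variable {W : EnrichedFunctor V A V} {S S' S'' : EnrichedFunctor V A K} {L L' L'' : K}

lemma isNat_cur_mulc (κ : WeightedCone W S L) {Y : V}
    {τ : ∀ a, Y ⟶ hom V (S.obj a) (S'.obj a)} (hτ : IsNat S S' τ) :
    IsNat W (S'.comp V (corep L)) (fun a => cur (mulc (κ.app a) (τ a))) := by
  apply isNat_cur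
  intro a b
  rw [mulc_assoc, Iso.inv_hom_id_assoc, hτ a b, comp_mulc_right, ← comp_mulc_left,
    ← κ.naturality, mulc_assoc, Iso.inv_hom_id_assoc]

lemma push_iff (κ : WeightedCone W S L) (X : K) {Y : V} (f : Y ⟶ hom V X L) (a : A)
    (t : Y ⊗ W.obj a ⟶ hom V X (S.obj a)) :
    f ≫ κ.push X a = cur ((β_ _ _).hom ≫ t) ↔ mulc f (κ.app a) = t := by
  rw [WeightedCone.push, ← cur_comp, cur_injective.eq_iff,
    BraidedCategory.braiding_naturality_right_assoc, ← comp_mulc_left, Category.comp_id, cancel_epi]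

lemma exists_limHom (κ : WeightedCone W S L) (κ' : WeightedCone W S' L') (h : κ'.IsLimit) {Y : V}
    {τ : ∀ a, Y ⟶ hom V (S.obj a) (S'.obj a)} (hτ : IsNat S S' τ) :
    ∃! f : Y ⟶ hom V L L', ∀ a, mulc f (κ'.app a) = (β_ _ _).hom ≫ mulc (κ.app a) (τ a) := by
  refine (existsUnique_congr fun f => forall_congr' fun a => ?_).1
    ((κ'.isLimit_iff.1 h) L Y _ (isNat_cur_mulc κ hτ))
  rw [← push_iff, SymmetricCategory.symmetry_assoc]
  exact Iff.rfl

lemma limHom_comp (κ : WeightedCone W S L) (κ' : WeightedCone W S' L') (κ'' : WeightedCone W S'' L'')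
    {Y Y' : V} (a : A) {τ : Y ⟶ hom V (S.obj a) (S'.obj a)} {τ' : Y' ⟶ hom V (S'.obj a) (S''.obj a)}
    {f : Y ⟶ hom V L L'} {f' : Y' ⟶ hom V L' L''}
    (h : mulc f (κ'.app a) = (β_ _ _).hom ≫ mulc (κ.app a) τ)
    (h' : mulc f' (κ''.app a) = (β_ _ _).hom ≫ mulc (κ'.app a) τ') :
    mulc (mulc f f') (κ''.app a) = (β_ _ _).hom ≫ mulc (κ.app a) (mulc τ τ') := by
  have e : mulc (κ.app a) (mulc τ τ') = (α_ _ _ _).inv ≫ mulc (mulc (κ.app a) τ) τ' := by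
    rw [mulc_assoc, Iso.inv_hom_id_assoc]
  have e' : mulc f (mulc (κ'.app a) τ') = (α_ _ _ _).inv ≫ mulc (mulc f (κ'.app a)) τ' := by
    rw [mulc_assoc, Iso.inv_hom_id_assoc]
  rw [mulc_assoc, h', comp_mulc_right, e', h, e, comp_mulc_left,
    BraidedCategory.braiding_tensor_left_hom]
  simp

end limHom

lemma isNat_rop {K : Type u₂} [EnrichedCategory V K] {R R' : EnrichedFunctor V Bᵒᵖ K} {Y : V}
    {τ : ∀ b, Y ⟶ hom V (R.obj b) (R'.obj b)} (hτ : IsNat R R' τ) :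
    IsNat (rop R') (rop R) (fun b => τ (op b)) := by
  intro a b
  have h1 := mulc_op (K := K) (a := op (R'.obj (op a))) (b := op (R.obj (op a)))
    (c := op (R.obj (op b))) (τ (op a)) (R.map (op b) (op a))
  have h2 := mulc_op (K := K) (a := op (R'.obj (op a))) (b := op (R'.obj (op b)))
    (c := op (R.obj (op b))) (R'.map (op b) (op a)) (τ (op b))
  refine h1.trans ?_
  refine Eq.trans ?_ (congrArg ((β_ _ _).hom ≫ ·) h2).symm
  refine Eq.trans ?_ (SymmetricCategory.symmetry_assoc _ _ _).symm
  rw [← hτ (op b) (op a)]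

lemma mulc_unop {K : Type u₂} [EnrichedCategory V K] {a b c : K} {X Y : V}
    (f : X ⟶ hom V a b) (g : Y ⟶ hom V b c) :
    mulc f g = (β_ X Y).hom ≫ mulc (K := Kᵒᵖ) (a := op c) (b := op b) (c := op a) g f := by
  have h := mulc_op (K := K) (a := op c) (b := op b) (c := op a) g f
  refine Eq.trans ?_ (congrArg ((β_ _ _).hom ≫ ·) h).symm
  exact (SymmetricCategory.symmetry_assoc _ _ _).symm

/-- The component at `b`, seen in the opposite `V`-category. -/
def ropπ {K : Type u₂} [EnrichedCategory V K] (R R' : EnrichedFunctor V Bᵒᵖ K) (b : B) :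
    hom V R R' ⟶ hom V ((rop R').obj b) ((rop R).obj b) :=
  natObj.π R R' (op b)

lemma isNat_ropπ {K : Type u₂} [EnrichedCategory V K] (R R' : EnrichedFunctor V Bᵒᵖ K) :
    IsNat (rop R') (rop R) (ropπ R R') :=
  isNat_rop (natObj.isNat R R')

lemma eId_ropπ {K : Type u₂} [EnrichedCategory V K] (R : EnrichedFunctor V Bᵒᵖ K) (b : B) :
    eId V R ≫ ropπ R R b = eId V ((rop R).obj b) := eId_π R (op b)

lemma eComp_ropπ {K : Type u₂} [EnrichedCategory V K] (R R' R'' : EnrichedFunctor V Bᵒᵖ K) (b : B) :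
    eComp V R R' R'' ≫ ropπ R R'' b = (β_ _ _).hom ≫ mulc (ropπ R' R'' b) (ropπ R R' b) :=
  (eComp_π R R' R'' (op b)).trans (mulc_unop (natObj.π R R' (op b)) (natObj.π R' R'' (op b)))

/-- The colimit `G * R` of `R` weighted by `G`. -/
def colimObj (G : EnrichedFunctor V B V) (R : EnrichedFunctor V Bᵒᵖ V) : V :=
  (exists_weightedColimit G (rop R)).choose

/-- The limit cone in `Vᵒᵖ` that exhibits `G * R` as a weighted colimit in `V`. -/
def colimCone (G : EnrichedFunctor V B V) (R : EnrichedFunctor V Bᵒᵖ V) :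
    WeightedCone G (rop R) (op (colimObj G R)) :=
  (exists_weightedColimit G (rop R)).choose_spec.choose

lemma colimCone_isLimit (G : EnrichedFunctor V B V) (R : EnrichedFunctor V Bᵒᵖ V) :
    (colimCone G R).IsLimit :=
  (exists_weightedColimit G (rop R)).choose_spec.choose_spec

/-- The action of `G * -` on hom-objects: the map induced by the universal property of `G * R`. -/
def colimMap (G : EnrichedFunctor V B V) (R R' : EnrichedFunctor V Bᵒᵖ V) :
    hom V R R' ⟶ hom V (op (colimObj G R')) (op (colimObj G R)) :=
  (exists_limHom (colimCone G R') (colimCone G R) (colimCone_isLimit G R)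
    (isNat_ropπ R R')).choose

lemma mulc_colimMap (G : EnrichedFunctor V B V) (R R' : EnrichedFunctor V Bᵒᵖ V) (b : B) :
    mulc (colimMap G R R') ((colimCone G R).app b) =
      (β_ _ _).hom ≫ mulc ((colimCone G R').app b) (ropπ R R' b) :=
  (exists_limHom (colimCone G R') (colimCone G R) (colimCone_isLimit G R)
    (isNat_ropπ R R')).choose_spec.1 b

lemma eq_of_mulc_colimCone (G : EnrichedFunctor V B V) (R : EnrichedFunctor V Bᵒᵖ V) {Y : V}
    {X : Vᵒᵖ} {f g : Y ⟶ hom V X (op (colimObj G R))}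
    (h : ∀ b, mulc f ((colimCone G R).app b) = mulc g ((colimCone G R).app b)) : f = g := by
  have h1 := (colimCone G R).isLimit_iff.1 (colimCone_isLimit G R) X Y
    (fun b => g ≫ (colimCone G R).push X b) (((colimCone G R).isNat_push X).precomp g)
  refine h1.unique (fun b => ?_) fun b => rfl
  rw [(push_iff (colimCone G R) X f b (mulc g ((colimCone G R).app b))).2 (h b)]
  exact ((push_iff (colimCone G R) X g b _).2 rfl).symm

lemma colimMap_id (G : EnrichedFunctor V B V) (R : EnrichedFunctor V Bᵒᵖ V) :
    eId V R ≫ colimMap G R R = eId V (op (colimObj G R)) := by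
  apply eq_of_mulc_colimCone
  intro b
  rw [comp_mulc_left, mulc_colimMap, BraidedCategory.braiding_naturality_left_assoc,
    ← comp_mulc_right, eId_ropπ, mulc_eId, eId_mulc]
  simp

lemma colimMap_comp (G : EnrichedFunctor V B V) (R R' R'' : EnrichedFunctor V Bᵒᵖ V) :
    eComp V R R' R'' ≫ colimMap G R R'' =
      (β_ _ _).hom ≫ mulc (colimMap G R' R'') (colimMap G R R') := by
  apply eq_of_mulc_colimCone
  intro b
  have h := limHom_comp (colimCone G R'') (colimCone G R') (colimCone G R) b
    (mulc_colimMap G R' R'' b) (mulc_colimMap G R R' b)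
  rw [comp_mulc_left, mulc_colimMap, BraidedCategory.braiding_naturality_left_assoc,
    ← comp_mulc_right, eComp_ropπ, comp_mulc_right, comp_mulc_left, h,
    BraidedCategory.braiding_naturality_left_assoc]

/-- The `V`-functor `G * - : [Bᵒᵖ, V] ⟶ V`. -/
def weightedColim (G : EnrichedFunctor V B V) : EnrichedFunctor V (EnrichedFunctor V Bᵒᵖ V) V where
  obj R := colimObj G R
  map R R' := colimMap G R R'
  map_id R := colimMap_id G R
  map_comp R R' R'' := by
    refine (colimMap_comp G R R' R'').trans ?_
    exact (mulc_unop (K := V) (a := colimObj G R) (b := colimObj G R') (c := colimObj G R'')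
      (colimMap G R R') (colimMap G R' R'')).symm

end colimits

section free
variable [SymmetricCategory V] [MonoidalClosed V] [HasColimits V]

/-- The set of objects of the free `V`-category on an ordinary small category `D`; the hom-objects
are the copowers of `𝟙_ V` by the hom-sets of `D`. -/
def FreeV (V : Type u) [Category.{w} V] (D : Type w) : Type w := D

variable {D : Type w} [Category.{w} D]

/-- The copower of `𝟙_ V` by the set of morphisms from `d` to `d'`. -/
abbrev freeHom (V : Type u) [Category.{w} V] [MonoidalCategory V] [HasColimits V] {D : Type w}
    [Category.{w} D] (d d' : D) : V :=
  ∐ fun _ : d ⟶ d' => 𝟙_ V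

/-- The generalized element that corresponds to a morphism of `D`. -/
def freeι (V : Type u) [Category.{w} V] [MonoidalCategory V] [HasColimits V] {D : Type w}
    [Category.{w} D] {d d' : D} (f : d ⟶ d') : 𝟙_ V ⟶ freeHom V d d' :=
  Sigma.ι (fun _ : d ⟶ d' => 𝟙_ V) f

lemma freeHom_ext {d d' : D} {Z : V} {s t : freeHom V d d' ⟶ Z}
    (h : ∀ f : d ⟶ d', freeι V f ≫ s = freeι V f ≫ t) : s = t :=
  Sigma.hom_ext _ _ h

lemma freeHom_tensor_ext {d d' : D} {X Z : V} {s t : X ⊗ freeHom V d d' ⟶ Z}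
    (h : ∀ f : d ⟶ d', X ◁ freeι V f ≫ s = X ◁ freeι V f ≫ t) : s = t := by
  apply MonoidalClosed.curry_injective
  apply freeHom_ext
  intro f
  rw [← MonoidalClosed.curry_natural_left, ← MonoidalClosed.curry_natural_left, h f]

lemma freeHom_tensor_ext' {d d' : D} {X Z : V} {s t : freeHom V d d' ⊗ X ⟶ Z}
    (h : ∀ f : d ⟶ d', freeι V f ▷ X ≫ s = freeι V f ▷ X ≫ t) : s = t := by
  rw [← cancel_epi (β_ X _).hom]
  apply freeHom_tensor_ext
  intro f
  rw [BraidedCategory.braiding_naturality_right_assoc,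
    BraidedCategory.braiding_naturality_right_assoc, h f]

lemma freeHom_ext₂ {d d' e e' : D} {Z : V} {s t : freeHom V d d' ⊗ freeHom V e e' ⟶ Z}
    (h : ∀ (f : d ⟶ d') (g : e ⟶ e'), (freeι V f ⊗ₘ freeι V g) ≫ s =
      (freeι V f ⊗ₘ freeι V g) ≫ t) : s = t := by
  apply freeHom_tensor_ext
  intro g
  apply freeHom_tensor_ext'
  intro f
  simpa only [MonoidalCategory.tensorHom_def, Category.assoc] using h f g

lemma freeHom_ext₃ {d d' e e' k k' : D} {Z : V}
    {s t : (freeHom V d d' ⊗ freeHom V e e') ⊗ freeHom V k k' ⟶ Z}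
    (h : ∀ (f : d ⟶ d') (g : e ⟶ e') (l : k ⟶ k'), ((freeι V f ⊗ₘ freeι V g) ⊗ₘ freeι V l) ≫ s =
      ((freeι V f ⊗ₘ freeι V g) ⊗ₘ freeι V l) ≫ t) : s = t := by
  apply freeHom_tensor_ext
  intro l
  rw [← cancel_epi (ρ_ _).inv]
  apply freeHom_ext₂
  intro f g
  rw [rightUnitor_inv_naturality_assoc, rightUnitor_inv_naturality_assoc,
    ← MonoidalCategory.tensorHom_def_assoc, ← MonoidalCategory.tensorHom_def_assoc, h]

/-- Composition in the free `V`-category, induced by composition in `D`. -/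
def freeComp (d₁ d₂ d₃ : D) : freeHom V d₁ d₂ ⊗ freeHom V d₂ d₃ ⟶ freeHom V d₁ d₃ :=
  MonoidalClosed.uncurry (Sigma.desc fun g : d₂ ⟶ d₃ =>
    MonoidalClosed.curry ((ρ_ _).hom ≫ Sigma.desc fun f : d₁ ⟶ d₂ => freeι V (f ≫ g)))

lemma freeι_comp {d₁ d₂ d₃ : D} (f : d₁ ⟶ d₂) (g : d₂ ⟶ d₃) :
    (freeι V f ⊗ₘ freeι V g) ≫ freeComp d₁ d₂ d₃ = (λ_ _).hom ≫ freeι V (f ≫ g) := by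
  have h1 : _ ◁ freeι V g ≫ freeComp (V := V) d₁ d₂ d₃ = (ρ_ _).hom ≫ Sigma.desc fun f : d₁ ⟶ d₂ => freeι V (f ≫ g) := by
    apply MonoidalClosed.curry_injective
    rw [MonoidalClosed.curry_natural_left, freeComp, MonoidalClosed.curry_uncurry]
    exact Sigma.ι_desc _ _
  rw [MonoidalCategory.tensorHom_def, Category.assoc, h1, rightUnitor_naturality_assoc,
    unitors_equal]
  congr 1
  exact Sigma.ι_desc _ _

lemma freeComp_id_comp (d d' : D) :
    (λ_ (freeHom V d d')).inv ≫ freeι V (𝟙 d) ▷ _ ≫ freeComp d d d' = 𝟙 _ := by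
  rw [Iso.inv_comp_eq]
  apply freeHom_tensor_ext
  intro f
  rw [← MonoidalCategory.tensorHom_def'_assoc, freeι_comp]
  simp

lemma freeComp_comp_id (d d' : D) :
    (ρ_ (freeHom V d d')).inv ≫ _ ◁ freeι V (𝟙 d') ≫ freeComp d d' d' = 𝟙 _ := by
  rw [Iso.inv_comp_eq]
  apply freeHom_tensor_ext'
  intro f
  rw [← MonoidalCategory.tensorHom_def_assoc, freeι_comp]
  simp [unitors_equal]

lemma freeComp_assoc (a b c d : D) :
    (α_ (freeHom V a b) (freeHom V b c) (freeHom V c d)).inv ≫ freeComp a b c ▷ _ ≫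
      freeComp a c d = _ ◁ freeComp b c d ≫ freeComp a b d := by
  rw [Iso.inv_comp_eq]
  apply freeHom_ext₃
  intro f g h
  rw [associator_naturality_assoc, ← MonoidalCategory.tensorHom_id, ← MonoidalCategory.id_tensorHom,
    MonoidalCategory.tensorHom_comp_tensorHom_assoc,
    MonoidalCategory.tensorHom_comp_tensorHom_assoc, Category.comp_id, Category.comp_id,
    freeι_comp, freeι_comp, MonoidalCategory.tensorHom_def, MonoidalCategory.tensorHom_def]
  have h1 := freeι_comp (V := V) (f ≫ g) h
  have h2 := freeι_comp (V := V) f (g ≫ h)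
  rw [MonoidalCategory.tensorHom_def, Category.assoc] at h1 h2
  simp only [comp_whiskerRight, Category.assoc, MonoidalCategory.whiskerLeft_comp,
    h1]
  rw [← whisker_exchange_assoc, h2]
  simp [unitors_equal]

/-- The free `V`-category on `D`. -/
instance : EnrichedCategory V (FreeV V D) where
  Hom d d' := freeHom (D := D) V d d'
  id _ := freeι (D := D) V (𝟙 _)
  comp d₁ d₂ d₃ := freeComp (D := D) d₁ d₂ d₃
  id_comp d d' := freeComp_id_comp (D := D) d d'
  comp_id d d' := freeComp_comp_id (D := D) d d'
  assoc a b c d := freeComp_assoc (D := D) a b c d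

lemma freeι_mulc {d₁ d₂ d₃ : D} (f : d₁ ⟶ d₂) (g : d₂ ⟶ d₃) :
    mulc (K := FreeV V D) (a := d₁) (b := d₂) (c := d₃) (freeι V f) (freeι V g) =
      (λ_ _).hom ≫ freeι V (f ≫ g) :=
  freeι_comp f g

lemma freeι_desc {d d' : D} {Z : V} (t : (d ⟶ d') → (𝟙_ V ⟶ Z)) (f : d ⟶ d') :
    freeι V f ≫ Sigma.desc t = t f :=
  Sigma.ι_desc _ _

/-- The `V`-functor on the free `V`-category that corresponds to an ordinary functor from `D` to
the underlying category of `K`. -/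
def freeLift {K : Type u₂} [EnrichedCategory V K] (S : D ⥤ ForgetEnrichment V K) :
    EnrichedFunctor V (FreeV V D) K where
  obj d := ForgetEnrichment.to V (S.obj d)
  map d d' := Sigma.desc fun f : (show D from d) ⟶ (show D from d') =>
    ForgetEnrichment.homTo V (S.map f)
  map_id d := by
    refine (freeι_desc (D := D) _ _).trans ?_
    exact (congrArg (ForgetEnrichment.homTo V) (S.map_id d)).trans (ForgetEnrichment.homTo_id V _)
  map_comp a b c := by
    apply freeHom_ext₂ (D := D)
    intro f g
    refine (Category.assoc _ _ _).symm.trans ?_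
    refine (freeι_comp (V := V) f g =≫ _).trans ?_
    refine (Category.assoc _ _ _).trans ?_
    refine (congrArg ((λ_ (𝟙_ V)).hom ≫ ·) (freeι_desc (D := D) _ (f ≫ g))).trans ?_
    have h1 : ForgetEnrichment.homTo V (S.map (f ≫ g)) =
        ((λ_ (𝟙_ V)).inv ≫ (ForgetEnrichment.homTo V (S.map f) ⊗ₘ
          ForgetEnrichment.homTo V (S.map g))) ≫ eComp V _ _ _ :=
      (congrArg (ForgetEnrichment.homTo V) (S.map_comp f g)).trans
        (ForgetEnrichment.homTo_comp V _ _)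
    refine (congrArg ((λ_ (𝟙_ V)).hom ≫ ·) h1).trans ?_
    refine Eq.trans ?_ (MonoidalCategory.tensorHom_comp_tensorHom_assoc _ _ _ _ _).symm
    refine Eq.trans ?_ (congrArg (· ≫ eComp V _ _ _)
      (congrArg₂ (fun x y => x ⊗ₘ y) (freeι_desc (D := D) _ f) (freeι_desc (D := D) _ g)).symm)
    simp

/-- The weight for conical limits of shape `D`: the constant functor at `𝟙_ V`. -/
def conicalWeight (D : Type w) [Category.{w} D] : EnrichedFunctor V (FreeV V D) V :=
  freeLift ((Functor.const D).obj (ForgetEnrichment.of V (𝟙_ V)))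

end free

section power
variable [SymmetricCategory V] [MonoidalClosed V]

/-- The set of objects of the unit `V`-category: one object `star`. -/
inductive UnitCat : Type w
  | star

/-- The unit `V`-category, whose only hom-object is `𝟙_ V`. -/
instance : EnrichedCategory V UnitCat.{w} where
  Hom _ _ := 𝟙_ V
  id _ := 𝟙 _
  comp _ _ _ := (λ_ (𝟙_ V)).hom
  id_comp _ _ := by simp
  comp_id _ _ := by simp [unitors_equal]
  assoc _ _ _ _ := by simp [unitors_equal]

/-- An object `G` of `V`, seen as a weight on the unit `V`-category. Limits with this weight are
`G`-powers. -/
def powerWeight (G : V) : EnrichedFunctor V UnitCat.{w} V where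
  obj _ := G
  map _ _ := eId V G
  map_id _ := Category.id_comp _
  map_comp _ _ _ := (eId_mulc (eId V G)).symm

end power

section classes
variable (V) [SymmetricCategory V] [MonoidalClosed V] [HasLimits V]

/-- A class of weights on small `V`-categories. -/
abbrev WeightClass : Type (max u (w + 1)) :=
  ∀ (A : Type w) [EnrichedCategory V A], EnrichedFunctor V A V → Prop

variable {V}

/-- A class of weights is saturated if it contains the representables and if, in each `[A, V]`, it
is closed under the colimits whose weight lies in the class. -/
structure IsSaturated (Ψ : WeightClass V) : Prop where
  representable (A : Type w) [EnrichedCategory V A] (a : A) : Ψ A (corep a)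
  colimit (A D : Type w) [EnrichedCategory V A] [EnrichedCategory V D]
    (F : EnrichedFunctor V D V) (S : EnrichedFunctor V D (EnrichedFunctor V A V)ᵒᵖ)
    (C : EnrichedFunctor V A V) (κ : WeightedCone F S (op C)) :
    Ψ D F → (∀ d, Ψ A (S.obj d).unop) → κ.IsLimit → Ψ A C

/-- The saturation of a class of weights: the smallest saturated class that contains it. -/
def saturation (Ψ₀ : WeightClass V) : WeightClass V := fun A _ W =>
  ∀ Ψ : WeightClass V, IsSaturated Ψ →
    (∀ (B : Type w) [EnrichedCategory V B] (W' : EnrichedFunctor V B V), Ψ₀ B W' → Ψ B W') → Ψ A W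

/-- `K` has all limits with weight in `Φ`. -/
def IsComplete (Φ : WeightClass V) (K : Type u₂) [EnrichedCategory V K] : Prop :=
  ∀ (A : Type w) [EnrichedCategory V A] (W : EnrichedFunctor V A V) (S : EnrichedFunctor V A K),
    Φ A W → ∃ (L : K) (c : WeightedCone W S L), c.IsLimit

/-- `H` is `Φ`-continuous: all limits with weight in `Φ` exist in its domain and are preserved
by `H`. -/
def IsContinuous (Φ : WeightClass V) {K : Type u₂} [EnrichedCategory V K] {K' : Type u₃}
    [EnrichedCategory V K'] (H : EnrichedFunctor V K K') : Prop :=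
  IsComplete Φ K ∧
  ∀ (A : Type w) [EnrichedCategory V A] (W : EnrichedFunctor V A V) (S : EnrichedFunctor V A K)
    (L : K) (c : WeightedCone W S L), Φ A W → c.IsLimit → (c.map H).IsLimit

variable [HasColimits V]

/-- `G`-weighted colimits commute in `V` with limits with weight in `Φ`. Here the `V`-functor
`S : A ⟶ [Bᵒᵖ, V]` is a bifunctor `A ⊗ Bᵒᵖ ⟶ V`; the cone `c` exhibits `L : [Bᵒᵖ, V]` as the
pointwise limit `{W, S}`; the cone `θ` exhibits `Q` as `{W, G * S}`; and `m` is the canonical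
comparison `G * {W, S} ⟶ {W, G * S}`, determined by its composites with the legs of `θ`. -/
def IsFlat (Φ : WeightClass V) {B : Type w} [EnrichedCategory V B] (G : EnrichedFunctor V B V) :
    Prop :=
  ∀ (A : Type w) [EnrichedCategory V A] (W : EnrichedFunctor V A V)
    (S : EnrichedFunctor V A (EnrichedFunctor V Bᵒᵖ V)) (L : EnrichedFunctor V Bᵒᵖ V)
    (c : WeightedCone W S L) (Q : V) (θ : WeightedCone W (S.comp V (weightedColim G)) Q)
    (m : (weightedColim G).obj L ⟶ Q),
    Φ A W → (∀ b : Bᵒᵖ, (c.map (evalAt b)).IsLimit) → θ.IsLimit →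
    (∀ a, unc ((c.map (weightedColim G)).app a) = m ▷ W.obj a ≫ unc (θ.app a)) → IsIso m

/-- For small `Φ`-complete `A` and `Φ`-continuous `F : A ⟶ V`, the `V`-functor
`F * - : [Aᵒᵖ, V] ⟶ V` is `Φ`-continuous. -/
def AxiomA (Φ : WeightClass V) : Prop :=
  ∀ (A : Type w) [EnrichedCategory V A] (F : EnrichedFunctor V A V),
    IsComplete Φ A → IsContinuous Φ F → IsContinuous Φ (weightedColim F)

/-- `C` is the colimit in the `V`-category `K` of the ordinary diagram `S`: it is the limit in `Kᵒᵖ`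
of the diagram corresponding to `S`, weighted by the constant weight at the unit. -/
def IsConicalColimit {K : Type u₂} [EnrichedCategory V K] {E : Type w} [SmallCategory E]
    (S : E ⥤ ForgetEnrichment V K) (C : K) : Prop :=
  ∃ κ : WeightedCone (conicalWeight Eᵒᵖ)
    (freeLift (S.op ⋙ forgetEnrichmentOppositeEquivalence.inverse V K)) (op C), κ.IsLimit

end classes

/-- A doctrine: a small collection of small categories. -/
structure Doctrine where
  ι : Type w
  J : ι → Type w
  [cat : ∀ i, SmallCategory (J i)]

attribute [instance] Doctrine.cat

namespace Doctrine
variable (𝔻 : Doctrine.{w})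

/-- `C` is `𝔻`-filtered: `C`-colimits commute in sets with `𝔻`-limits. -/
def IsFiltered (C : Type w) [SmallCategory C] : Prop :=
  ∀ i, PreservesLimitsOfShape (𝔻.J i) (Limits.colim : (C ⥤ Type w) ⥤ Type w)

/-- `𝔻` is sound: `C` is `𝔻`-filtered as soon as, for each diagram `S : Dᵒᵖ ⥤ C` with `D` in `𝔻`,
the category of cocones under `S` is connected. -/
def IsSound : Prop :=
  ∀ (C : Type w) [SmallCategory C],
    (∀ (i : 𝔻.ι) (S : (𝔻.J i)ᵒᵖ ⥤ C), IsConnected (Cocone S)) → 𝔻.IsFiltered C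

/-- `H` preserves colimits of shape `E`, for each small `𝔻`-filtered `E`. -/
def PreservesFilteredColimits {C : Type u₁} [Category.{u₂} C] {C' : Type u₃} [Category.{w} C']
    (H : C ⥤ C') : Prop :=
  ∀ (E : Type w) [SmallCategory E], 𝔻.IsFiltered E → PreservesColimitsOfShape E H

/-- The category of `𝔻`-continuous functors `A ⥤ Type w`. -/
abbrev Cts (A : Type w) [SmallCategory A] :=
  ObjectProperty.FullSubcategory fun F : A ⥤ Type w => ∀ i, PreservesLimitsOfShape (𝔻.J i) F

/-- `C` is equivalent to the category of `𝔻`-continuous set-valued functors on a small category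
with `𝔻`-limits. -/
def IsLocallyPresentable (C : Type u) [Category.{w} C] : Prop :=
  ∃ (A : Type w) (_ : SmallCategory A),
    (∀ i, HasLimitsOfShape (𝔻.J i) A) ∧ Nonempty (C ≌ 𝔻.Cts A)

/-- `X` is a `𝔻`-presentable object of the ordinary category `C`. -/
def IsPresentable {C : Type u} [Category.{w} C] (X : C) : Prop :=
  𝔻.PreservesFilteredColimits (coyoneda.obj (op X))

variable (V) [SymmetricCategory V] [MonoidalClosed V]

/-- `V` is locally `𝔻`-presentable as a `⊗`-category: its underlying category is locally
`𝔻`-presentable and the `𝔻`-presentable objects are closed under `⊗`. -/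
def IsTensorLocallyPresentable : Prop :=
  𝔻.IsLocallyPresentable V ∧
    ∀ X Y : V, 𝔻.IsPresentable X → 𝔻.IsPresentable Y → 𝔻.IsPresentable (X ⊗ Y)

variable {V} in
/-- `G` is in `V_𝔻`: the internal hom `[G, -] : V ⟶ V` preserves `𝔻`-filtered colimits. -/
def IsEnrichedPresentable (G : V) : Prop := 𝔻.PreservesFilteredColimits (ihom G)

variable [HasLimits V] [HasColimits V]

/-- The weights for conical `𝔻`-limits and for `G`-powers with `G` in `V_𝔻`. -/
inductive BasicWeight : (A : Type w) → [EnrichedCategory V A] → EnrichedFunctor V A V → Prop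
  | conical (i : 𝔻.ι) : BasicWeight (FreeV V (𝔻.J i)) (conicalWeight (𝔻.J i))
  | power (G : V) : 𝔻.IsEnrichedPresentable G → BasicWeight UnitCat (powerWeight G)

/-- The saturation of the class of conical `𝔻`-limits and `V_𝔻`-powers. -/
def weights : WeightClass V := saturation (𝔻.BasicWeight V)

variable {V} in
/-- `F` is a conical `𝔻`-filtered colimit in `[T, V]` of representables. -/
def IsFilteredColimitOfRepresentables {T : Type w} [EnrichedCategory V T]
    (F : EnrichedFunctor V T V) : Prop :=
  ∃ (E : Type w) (_ : SmallCategory E) (P : E ⥤ ForgetEnrichment V (EnrichedFunctor V T V)),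
    𝔻.IsFiltered E ∧
    (∀ e, ∃ t : T, Nonempty (P.obj e ≅ ForgetEnrichment.of V (corep t))) ∧
    IsConicalColimit P F

end Doctrine
end EnrichedTheory
end

/-!
A weight `W` *commutes* if `[A, V](W, -)` preserves the pointwise `𝔻`-filtered colimits
(`commutingWeights`). The commuting weights form a saturated class, because for a weighted colimit
`C = F * S` of weights `[A, V](C, N) ≅ [D, V](F, [A, V](S -, N))`. The class contains the powers by
objects of `V_𝔻` by definition of `V_𝔻`, and the conical `𝔻`-limits because these commute with
`𝔻`-filtered colimits in a locally `𝔻`-presentable category, where this can be tested in sets on the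
`𝔻`-presentable generators. Hence every weight in `𝔻.weights` commutes
(`weights_le_commutingWeights`), and the theorem becomes a cycle of three implications.

*A filtered colimit of representables is flat.* A diagram of representables lifts along the fully
faithful `reps : Bᵒᵖ ⟶ [B, V]` to a diagram `t` in `Bᵒᵖ`. If `F` is the colimit of the `B(t e, -)`,
then `F * R` is the colimit of the `R (t e)` (`isColimit_injCocone`), so `F * {W, S} ⟶ {W, F * S}`
compares two colimits over `E` of the isomorphic diagrams `{W, S} (t e)` and `{W, S - (t e)}`; that
the target is a colimit is what it means that `W` commutes (`isIso_comparison_of_isColimit`).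

*A flat functor is continuous.* The Yoneda embedding `T ⟶ [Tᵒᵖ, V]` turns limits into pointwise
limits, flatness of `F` makes `F * -` preserve these, and by the co-Yoneda lemma the composite of
the two is `F` (`isIso_toColim`).

*A continuous functor is a filtered colimit of representables.* The conical `𝔻`-limits of `T` are
limits in the underlying category, and are preserved by `t ↦ V(𝟙, F t)`. The category of elements of
this functor therefore has `𝔻`-limits, so each category of cocones in its opposite `E` has an
initial object, and `E` is `𝔻`-filtered by soundness (`isFiltered_elements`). It remains to see that
the `T(t, s)`, over the elements of `F`, have colimit `F s`. It suffices to test this on the maps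
out of each `𝔻`-presentable generator `G`; such generators lie in `V_𝔻` because `⊗` preserves
`𝔻`-presentability. As `T` has `G`-powers and `F` preserves them, a map `G ⟶ F s` is an element of
`F` at the power of `s`, and the claim reduces to the density of representables among set-valued
functors (`isColimit_eval_elementsCocone`). Since `- ⊗ Y` preserves colimits, a pointwise colimit in
`[T, V]` is a conical one (`isConicalColimit_of_pointwise`).

Axiom A follows: a continuous `F` is flat, limits in `[Aᵒᵖ, V]` exist and are pointwise, and `F * -`
preserves them.
-/

noncomputable section
namespace EnrichedTheory

/-! ### Enriched naturality in uncurried form -/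

section uncurried
variable {V : Type u} [Category.{w} V] [MonoidalCategory V] [SymmetricCategory V] [MonoidalClosed V]

/-- Currying in the left variable: the generalized element of `V(A, B)` named by `Y ⊗ A ⟶ B`. -/
def lcur {Y A B : V} (t : Y ⊗ A ⟶ B) : Y ⟶ hom V A B := cur ((β_ A Y).hom ≫ t)

/-- The inverse of `lcur`. -/
def lunc {Y A B : V} (f : Y ⟶ hom V A B) : Y ⊗ A ⟶ B := (β_ Y A).hom ≫ unc f

@[simp] lemma lunc_lcur {Y A B : V} (t : Y ⊗ A ⟶ B) : lunc (lcur t) = t := by simp [lunc, lcur]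

@[simp] lemma lcur_lunc {Y A B : V} (f : Y ⟶ hom V A B) : lcur (lunc f) = f := by simp [lunc, lcur]

lemma lunc_injective {Y A B : V} {f g : Y ⟶ hom V A B} (h : lunc f = lunc g) : f = g := by
  rw [← lcur_lunc f, h, lcur_lunc]

lemma unc_lcur {Y A B : V} (t : Y ⊗ A ⟶ B) : unc (lcur t) = (β_ A Y).hom ≫ t := unc_cur _

lemma lunc_comp {X Y A B : V} (u : X ⟶ Y) (f : Y ⟶ hom V A B) :
    lunc (u ≫ f) = u ▷ A ≫ lunc f := by
  rw [lunc, unc_comp, lunc, BraidedCategory.braiding_naturality_left_assoc]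

lemma comp_lcur {X Y A B : V} (u : X ⟶ Y) (t : Y ⊗ A ⟶ B) : u ≫ lcur t = lcur (u ▷ A ≫ t) := by
  apply lunc_injective
  rw [lunc_comp, lunc_lcur, lunc_lcur]

variable {A : Type u₁} [EnrichedCategory V A]

/-- `V`-naturality of a family `t a : Y ⊗ F a ⟶ G a`, for `V`-functors `F` and `G` with values
in `V`. Keeping the parameter `Y` on the left avoids braidings. -/
def IsLNat (F G : EnrichedFunctor V A V) {Y : V} (t : ∀ a, Y ⊗ F.obj a ⟶ G.obj a) : Prop :=
  ∀ a b : A, t a ▷ hom V a b ≫ unc (G.map a b) =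
    (α_ Y (F.obj a) (hom V a b)).hom ≫ Y ◁ unc (F.map a b) ≫ t b

lemma IsLNat.precomp {F G : EnrichedFunctor V A V} {Y X : V} {t : ∀ a, Y ⊗ F.obj a ⟶ G.obj a}
    (h : IsLNat F G t) (f : X ⟶ Y) : IsLNat F G (fun a => f ▷ _ ≫ t a) := by
  intro a b
  rw [comp_whiskerRight_assoc, h a b, whisker_exchange_assoc, associator_naturality_left_assoc]

lemma isNat_iff_isLNat {F G : EnrichedFunctor V A V} {Y : V}
    (σ : ∀ a, Y ⟶ hom V (F.obj a) (G.obj a)) :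
    IsNat F G σ ↔ IsLNat F G (fun a => lunc (σ a)) := by
  refine forall_congr' fun a => forall_congr' fun b => ?_
  have h1 : mulc (σ a) (G.map a b) = (β_ Y (hom V a b)).hom ≫ mulc (F.map a b) (σ b) ↔
      unc (mulc (σ a) (G.map a b)) = unc ((β_ Y (hom V a b)).hom ≫ mulc (F.map a b) (σ b)) :=
    ⟨fun h => by rw [h], unc_injective⟩
  simp only [lunc]
  rw [h1, unc_mulc, unc_comp, unc_mulc,
    ← cancel_epi ((β_ Y (F.obj a)).hom ▷ hom V a b ≫ (α_ _ _ _).hom)]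
  simp only [Category.assoc, Iso.hom_inv_id_assoc, comp_whiskerRight]
  refine Eq.congr_right ?_
  rw [BraidedCategory.braiding_naturality_right_assoc, BraidedCategory.braiding_tensor_right_hom]
  simp

lemma isNat_lcur_iff {F G : EnrichedFunctor V A V} {Y : V} (t : ∀ a, Y ⊗ F.obj a ⟶ G.obj a) :
    IsNat F G (fun a => lcur (t a)) ↔ IsLNat F G t := by
  simp [isNat_iff_isLNat]

end uncurried

/-! ### Weighted limits through generalized elements -/

section limits
variable {V : Type u} [Category.{w} V] [MonoidalCategory V] [SymmetricCategory V] [MonoidalClosed V]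
  [HasLimits V] [HasColimits V]
variable {A : Type w} [EnrichedCategory V A] {K : Type u₂} [EnrichedCategory V K]

lemma isLNat_corep_iff {W : EnrichedFunctor V A V} {S : EnrichedFunctor V A K} {X : K} {Y : V}
    (t : ∀ a, Y ⊗ W.obj a ⟶ hom V X (S.obj a)) :
    IsLNat W (S.comp V (corep X)) t ↔ ∀ a b, mulc (t a) (S.map a b) =
      (α_ Y (W.obj a) (hom V a b)).hom ≫ Y ◁ unc (W.map a b) ≫ t b := by
  refine forall_congr' fun a => forall_congr' fun b => Eq.congr_left ?_
  refine (congrArg (t a ▷ hom V a b ≫ ·) (unc_comp_corepMap _ _ _ (S.map a b))).trans ?_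
  rw [← comp_mulc_left, Category.comp_id]

namespace WeightedCone

lemma isLNat_mulc {W : EnrichedFunctor V A V} {S : EnrichedFunctor V A K} {L : K}
    (c : WeightedCone W S L) {X : K} {Y : V} (f : Y ⟶ hom V X L) :
    IsLNat W (S.comp V (corep X)) (fun a => mulc f (c.app a)) := by
  rw [isLNat_corep_iff]
  intro a b
  rw [mulc_assoc, c.naturality, comp_mulc_right]

/-- The universal property of a weighted limit, in terms of generalized elements. -/
lemma isLimit_iff_mulc {W : EnrichedFunctor V A V} {S : EnrichedFunctor V A K} {L : K}
    (c : WeightedCone W S L) : c.IsLimit ↔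
    ∀ (X : K) (Y : V) (t : ∀ a, Y ⊗ W.obj a ⟶ hom V X (S.obj a)),
      IsLNat W (S.comp V (corep X)) t → ∃! f : Y ⟶ hom V X L, ∀ a, mulc f (c.app a) = t a := by
  rw [isLimit_iff]
  refine forall_congr' fun X => forall_congr' fun Y => ⟨fun h t ht => ?_, fun h σ hσ => ?_⟩
  · refine (existsUnique_congr fun f => forall_congr' fun a => ?_).1
      (h _ ((isNat_lcur_iff (G := S.comp V (corep X)) t).2 ht))
    exact push_iff c X f a (t a)
  · refine (existsUnique_congr fun f => forall_congr' fun a => ?_).1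
      (h _ ((isNat_iff_isLNat (G := S.comp V (corep X)) σ).1 hσ))
    refine (push_iff c X f a (lunc (B := hom V X (S.obj a)) (σ a))).symm.trans ?_
    exact Eq.congr_right (lcur_lunc (B := hom V X (S.obj a)) (σ a))

lemma isLNat_unc {W S : EnrichedFunctor V A V} {L : V} (c : WeightedCone W S L) :
    IsLNat W S (fun a => unc (c.app a)) := by
  intro a b
  have h := congrArg unc (c.naturality a b)
  rw [unc_mulc, unc_comp, Iso.inv_comp_eq] at h
  exact h

/-- The cone in `V` with given uncurried components. -/
def ofLNat {W S : EnrichedFunctor V A V} {L : V} (t : ∀ a, L ⊗ W.obj a ⟶ S.obj a)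
    (h : IsLNat W S t) : WeightedCone W S L where
  app a := cur (t a)
  naturality a b := by
    apply unc_injective
    rw [unc_mulc, unc_comp, Iso.inv_comp_eq, unc_cur, unc_cur]
    exact h a b

/-- Weighted limits in `V` itself: it suffices to test the universal property on families
`Y ⊗ W a ⟶ S a`, since `[X, S a]` is determined by the maps into it. -/
lemma isLimit_iff_unc {W S : EnrichedFunctor V A V} {L : V} (c : WeightedCone W S L) :
    c.IsLimit ↔ ∀ (Y : V) (t : ∀ a, Y ⊗ W.obj a ⟶ S.obj a), IsLNat W S t →
      ∃! f : Y ⟶ L, ∀ a, f ▷ W.obj a ≫ unc (c.app a) = t a := by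
  rw [isLimit_iff_mulc]
  have key (X Y : V) (t : ∀ a, Y ⊗ W.obj a ⟶ hom V X (S.obj a)) :
      IsLNat W (S.comp V (corep X)) t ↔
        IsLNat (Y := X ⊗ Y) W S (fun a => (α_ _ _ _).hom ≫ unc (t a)) := by
    rw [isLNat_corep_iff]
    refine forall_congr' fun a => forall_congr' fun b => ?_
    rw [← (show Function.Injective (unc (X := _) (A := X) (B := S.obj b)) from
      fun _ _ => unc_injective).eq_iff, unc_mulc, unc_comp, unc_comp, ← cancel_epi
      ((α_ _ _ _).hom ▷ hom V a b ≫ (α_ _ _ _).hom)]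
    simp
  have key2 (X Y : V) (f : Y ⟶ hom V X L) (a : A) (t : Y ⊗ W.obj a ⟶ hom V X (S.obj a)) :
      mulc f (c.app a) = t ↔ unc f ▷ W.obj a ≫ unc (c.app a) = (α_ _ _ _).hom ≫ unc t := by
    rw [← (show Function.Injective (unc (X := _) (A := X) (B := S.obj a)) from
      fun _ _ => unc_injective).eq_iff, unc_mulc, Iso.inv_comp_eq]
  constructor
  · intro h Y t ht
    let t' (a : A) : 𝟙_ V ⊗ W.obj a ⟶ hom V Y (S.obj a) := cur (Y ◁ (λ_ _).hom ≫ t a)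
    have ht' (a : A) : (α_ _ _ _).hom ≫ unc (t' a) = (ρ_ Y).hom ▷ W.obj a ≫ t a := by
      simp [t']
    obtain ⟨f, hf, hu⟩ := h Y (𝟙_ V) t' (by
      rw [key]
      simp only [ht']
      exact ht.precomp _)
    refine ⟨(ρ_ Y).inv ≫ unc f, fun a => ?_, fun g hg => ?_⟩
    · have := (key2 _ _ f a _).1 (hf a)
      rw [ht'] at this
      rw [comp_whiskerRight_assoc, this]
      simp
    · have h1 : cur ((ρ_ Y).hom ≫ g) = f := by
        refine hu _ fun a => ?_
        rw [key2, ht', unc_cur, comp_whiskerRight_assoc]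
        exact congrArg _ (hg a)
      rw [← h1]
      simp
  · intro h X Y t ht
    obtain ⟨f, hf, hu⟩ := h _ _ ((key X Y t).1 ht)
    refine ⟨cur f, fun a => ?_, fun g hg => ?_⟩
    · rw [key2, unc_cur]
      exact hf a
    · rw [← hu (unc g) fun a => (key2 _ _ _ _ _).1 (hg a), cur_unc]

/-- The canonical limit cone on the end `natObj W S`. -/
def canonical (W S : EnrichedFunctor V A V) : WeightedCone W S (natObj W S) :=
  ofLNat (fun a => lunc (natObj.π W S a)) ((isNat_iff_isLNat _).1 (natObj.isNat W S))

lemma unc_canonical_app (W S : EnrichedFunctor V A V) (a : A) :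
    unc ((canonical W S).app a) = lunc (natObj.π W S a) := unc_cur _

lemma canonical_isLimit (W S : EnrichedFunctor V A V) : (canonical W S).IsLimit := by
  rw [isLimit_iff_unc]
  intro Y t ht
  refine ⟨natObj.lift _ ((isNat_lcur_iff t).2 ht), fun a => ?_, fun g hg => ?_⟩
  · rw [unc_canonical_app, ← lunc_comp, natObj.lift_π, lunc_lcur]
  · apply natObj.hom_ext
    intro a
    rw [natObj.lift_π]
    apply lunc_injective
    rw [lunc_lcur, lunc_comp, ← unc_canonical_app, hg a]

/-- The map to the end that corresponds to a cone in `V`. -/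
def toEnd {W S : EnrichedFunctor V A V} {L : V} (c : WeightedCone W S L) : L ⟶ natObj W S :=
  natObj.lift _ ((isNat_lcur_iff _).2 c.isLNat_unc)

lemma toEnd_π {W S : EnrichedFunctor V A V} {L : V} (c : WeightedCone W S L) (a : A) :
    c.toEnd ≫ natObj.π W S a = lcur (unc (c.app a)) := natObj.lift_π _ _ a

lemma isLimit_iff_isIso_toEnd {W S : EnrichedFunctor V A V} {L : V} (c : WeightedCone W S L) :
    c.IsLimit ↔ IsIso c.toEnd := by
  rw [isLimit_iff_unc, toEnd, natObj.isIso_iff]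
  refine forall_congr' fun Y => ⟨fun h σ hσ => ?_, fun h t ht => ?_⟩
  · refine (existsUnique_congr fun f => forall_congr' fun a => ?_).1
      (h _ ((isNat_iff_isLNat σ).1 hσ))
    rw [comp_lcur]
    constructor
    · intro h
      rw [h, lcur_lunc]
    · intro h
      rw [← h, lunc_lcur]
  · refine (existsUnique_congr fun f => forall_congr' fun a => ?_).1
      (h _ ((isNat_lcur_iff t).2 ht))
    rw [comp_lcur]
    constructor
    · intro h
      rw [← lunc_lcur (t a), ← h, lunc_lcur]
    · intro h
      rw [h]

/-- Since limits are unique, a `V`-functor that preserves one limit cone preserves all limit cones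
over the same diagram. -/
lemma IsLimit.map_of_map {K' : Type u₃} [EnrichedCategory V K'] {W : EnrichedFunctor V A V}
    {S : EnrichedFunctor V A K} {L L' : K} {c : WeightedCone W S L} {c' : WeightedCone W S L'}
    (h : c.IsLimit) (h' : c'.IsLimit) (H : EnrichedFunctor V K K') (hH : (c'.map H).IsLimit) :
    (c.map H).IsLimit := by
  rw [isLimit_iff_mulc] at h h'
  have factor {M M' : K} (d : WeightedCone W S M) (d' : WeightedCone W S M')
      (hd' : ∀ (X : K) (Y : V) (t : ∀ a, Y ⊗ W.obj a ⟶ hom V X (S.obj a)),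
        IsLNat W (S.comp V (corep X)) t → ∃! f : Y ⟶ hom V X M', ∀ a, mulc f (d'.app a) = t a) :
      ∃ f : 𝟙_ V ⟶ hom V M M', ∀ a, mulc f (d'.app a) = (λ_ _).hom ≫ d.app a := by
    obtain ⟨f, hf, -⟩ := hd' M (𝟙_ V) _ (d.isLNat_mulc (eId V M))
    exact ⟨f, fun a => (hf a).trans (eId_mulc _)⟩
  obtain ⟨f, hf⟩ := factor c c' h'
  obtain ⟨g, hg⟩ := factor c' c h
  have hgf : mulc f g = (λ_ _).hom ≫ eId V L := by
    obtain ⟨_, _, hu⟩ := h L _ _ (c.isLNat_mulc (mulc f g))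
    refine (hu _ fun a => rfl).trans (hu _ fun a => ?_).symm
    rw [mulc_assoc, hg, comp_mulc_right, hf, comp_mulc_left, eId_mulc]
    rw [MonoidalCategory.triangle_assoc, unitors_equal]
  rw [isLimit_iff_mulc] at hH ⊢
  intro X Y t ht
  obtain ⟨z, hz, hzu⟩ := hH X Y t ht
  have hf' (a : A) : mulc (f ≫ H.map _ _) ((c'.map H).app a) = (λ_ _).hom ≫ (c.map H).app a := by
    have := (hf a) =≫ H.map L (S.obj a)
    rw [mulc_map, Category.assoc] at this
    exact this
  have hg' (a : A) : mulc (g ≫ H.map _ _) ((c.map H).app a) = (λ_ _).hom ≫ (c'.map H).app a := by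
    have := (hg a) =≫ H.map L' (S.obj a)
    rw [mulc_map, Category.assoc] at this
    exact this
  refine ⟨(ρ_ _).inv ≫ mulc z (g ≫ H.map _ _), fun a => ?_, fun y hy => ?_⟩
  -- `g` is an isomorphism `L' ⟶ L` with inverse `f`, so a factorization through `H L'` is moved
  -- to `H L` along `H g`.
  · rw [comp_mulc_left, mulc_assoc, hg', comp_mulc_right, hz]
    simp
  · have h1 : (ρ_ _).inv ≫ mulc y (f ≫ H.map _ _) = z := by
      refine hzu _ fun a => ?_
      rw [comp_mulc_left, mulc_assoc, hf', comp_mulc_right, hy]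
      simp
    rw [← h1, comp_mulc_left, mulc_assoc, ← mulc_map, hgf, Category.assoc, H.map_id,
      comp_mulc_right, mulc_eId]
    simp

end WeightedCone
end limits

/-! ### Underlying functors and natural transformations -/

section named
variable {V : Type u} [Category.{w} V] [MonoidalCategory V] [MonoidalClosed V]

/-- The morphism named by an element of `V(A, B)`. -/
def unname {A B : V} (f : 𝟙_ V ⟶ hom V A B) : A ⟶ B := (ρ_ A).inv ≫ unc f

/-- The element of `V(A, B)` that names a morphism. -/
def name {A B : V} (g : A ⟶ B) : 𝟙_ V ⟶ hom V A B := cur ((ρ_ A).hom ≫ g)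

@[simp] lemma unname_name {A B : V} (g : A ⟶ B) : unname (name g) = g := by simp [unname, name]

@[simp] lemma name_unname {A B : V} (f : 𝟙_ V ⟶ hom V A B) : name (unname f) = f := by
  simp [unname, name]

lemma unname_injective {A B : V} {f g : 𝟙_ V ⟶ hom V A B} (h : unname f = unname g) : f = g := by
  rw [← name_unname f, h, name_unname]

lemma unname_eId (A : V) : unname (eId V A) = 𝟙 A := by simp [unname, unc_eId]

lemma unc_mulc_name {A B C Y : V} (f : Y ⟶ hom V A B) (g : B ⟶ C) :
    (A ◁ (ρ_ Y).inv) ≫ unc (mulc f (name g)) = unc f ≫ g := by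
  rw [unc_mulc, name, unc_cur, ← cancel_epi (A ◁ (ρ_ Y).hom)]
  simp

lemma unname_mulc {A B C : V} (f : 𝟙_ V ⟶ hom V A B) (g : 𝟙_ V ⟶ hom V B C) :
    unname ((λ_ _).inv ≫ mulc f g) = unname f ≫ unname g := by
  rw [unname, unc_comp, unitors_inv_equal]
  obtain ⟨h, rfl⟩ : ∃ h, g = name h := ⟨unname g, (name_unname g).symm⟩
  rw [unc_mulc_name, unname_name, unname, Category.assoc]

lemma unname_comp_corepMap {K : Type u₂} [EnrichedCategory V K] (a b c : K)
    (f : 𝟙_ V ⟶ hom V b c) :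
    unname (f ≫ corepMap a b c) = (ρ_ _).inv ≫ mulc (𝟙 (hom V a b)) f := by
  rw [unname, unc_comp_corepMap]

variable {K : Type u₂} [EnrichedCategory V K]

/-- The ordinary functor with values in `V` that underlies a `V`-functor. -/
def und (H : EnrichedFunctor V K V) : ForgetEnrichment V K ⥤ V where
  obj Z := H.obj (ForgetEnrichment.to V Z)
  map f := unname (ForgetEnrichment.homTo V f ≫ H.map _ _)
  map_id Z := by rw [ForgetEnrichment.homTo_id, H.map_id, unname_eId]
  map_comp f g := by
    rw [← unname_mulc, ← mulc_map, ForgetEnrichment.homTo_comp]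
    simp [mulc]

/-- `V`-naturality of a family of morphisms of `V`. -/
def IsVNat (F G : EnrichedFunctor V K V) (n : ∀ k, F.obj k ⟶ G.obj k) : Prop :=
  ∀ k l, unc (F.map k l) ≫ n l = n k ▷ hom V k l ≫ unc (G.map k l)

lemma IsVNat.unname_comp {F G : EnrichedFunctor V K V} {n : ∀ k, F.obj k ⟶ G.obj k}
    (h : IsVNat F G n) {k l : K} (f : 𝟙_ V ⟶ hom V k l) :
    unname (f ≫ F.map k l) ≫ n l = n k ≫ unname (f ≫ G.map k l) := by
  rw [unname, unname, unc_comp, unc_comp, Category.assoc, Category.assoc, h,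
    rightUnitor_inv_naturality_assoc, whisker_exchange_assoc]

/-- The ordinary natural transformation that underlies a `V`-natural one. -/
def IsVNat.natTrans {F G : EnrichedFunctor V K V} {n : ∀ k, F.obj k ⟶ G.obj k}
    (h : IsVNat F G n) : und F ⟶ und G where
  app Z := n (ForgetEnrichment.to V Z)
  naturality _ _ f := h.unname_comp (ForgetEnrichment.homTo V f)

lemma IsVNat.inv {F G : EnrichedFunctor V K V} {n : ∀ k, F.obj k ⟶ G.obj k}
    (hn : IsVNat F G n) [∀ k, IsIso (n k)] : IsVNat G F (fun k => inv (n k)) := by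
  intro k l
  rw [IsIso.comp_inv_eq, Category.assoc, hn k l, ← comp_whiskerRight_assoc, IsIso.inv_hom_id,
    id_whiskerRight, Category.id_comp]

lemma IsVNat.precomp {K' : Type u₃} [EnrichedCategory V K'] (J : EnrichedFunctor V K' K)
    {F G : EnrichedFunctor V K V} {n : ∀ k, F.obj k ⟶ G.obj k} (hn : IsVNat F G n) :
    IsVNat (J.comp V F) (J.comp V G) (fun k => n (J.obj k)) := by
  intro k l
  refine (congrArg (· ≫ n (J.obj l)) (unc_comp (J.map k l) (F.map _ _))).trans ?_
  refine Eq.trans ?_ (congrArg (n (J.obj k) ▷ _ ≫ ·) (unc_comp (J.map k l) (G.map _ _))).symm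
  rw [Category.assoc, hn, whisker_exchange_assoc]

end named

section functors
variable {V : Type u} [Category.{w} V] [MonoidalCategory V] [SymmetricCategory V] [MonoidalClosed V]

lemma lunc_name {A B : V} (g : A ⟶ B) : lunc (name g) = (λ_ A).hom ≫ g := by
  simp [lunc, name]

lemma lunc_mulc {A B C X Y : V} (f : Y ⟶ hom V A B) (g : X ⟶ hom V B C) :
    lunc (mulc f g) = (β_ Y X).hom ▷ A ≫ (α_ _ _ _).hom ≫ X ◁ lunc f ≫ lunc g := by
  have h := BraidedCategory.yang_baxter Y X A =≫ (A ◁ (β_ X Y).hom ≫ (α_ _ _ _).inv)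
  simp only [Category.assoc, ← MonoidalCategory.whiskerLeft_comp_assoc,
    SymmetricCategory.symmetry, MonoidalCategory.whiskerLeft_id, Category.id_comp] at h
  have h2 : (β_ (Y ⊗ X) A).hom ≫ (α_ _ _ _).inv =
      (β_ Y X).hom ▷ A ≫ (α_ _ _ _).hom ≫ X ◁ (β_ Y A).hom ≫ (β_ X (A ⊗ Y)).hom := by
    rw [BraidedCategory.braiding_tensor_left_hom, BraidedCategory.braiding_tensor_right_hom,
      ← cancel_epi (α_ Y X A).inv]
    simp only [Category.assoc, Iso.inv_hom_id_assoc]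
    rw [← h]
  simp only [lunc]
  rw [unc_mulc, reassoc_of% h2, ← BraidedCategory.braiding_naturality_right_assoc]
  simp

variable {A : Type u₁} [EnrichedCategory V A]

lemma isLNat_unit_iff {F G : EnrichedFunctor V A V} (n : ∀ a, F.obj a ⟶ G.obj a) :
    IsLNat (Y := 𝟙_ V) F G (fun a => (λ_ _).hom ≫ n a) ↔ IsVNat F G n := by
  refine forall_congr' fun a => forall_congr' fun b => ?_
  rw [← cancel_epi ((λ_ (F.obj a)).hom ▷ hom V a b)]
  simp only [comp_whiskerRight, Category.assoc]
  rw [eq_comm]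
  refine Eq.congr_left ?_
  rw [leftUnitor_naturality_assoc]
  simp

lemma isNat_name_iff {F G : EnrichedFunctor V A V} (n : ∀ a, F.obj a ⟶ G.obj a) :
    IsNat F G (fun a => name (n a)) ↔ IsVNat F G n := by
  rw [isNat_iff_isLNat, ← isLNat_unit_iff]
  simp only [lunc_name]

lemma isNat_iff_isVNat {F G : EnrichedFunctor V A V}
    (σ : ∀ a, 𝟙_ V ⟶ hom V (F.obj a) (G.obj a)) :
    IsNat F G σ ↔ IsVNat F G (fun a => unname (σ a)) := by
  rw [← isNat_name_iff]
  simp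

/-- The canonical `V`-functor from a `V`-category to its double opposite. -/
def opop (K : Type u₁) [EnrichedCategory V K] : EnrichedFunctor V K Kᵒᵖᵒᵖ where
  obj k := op (op k)
  map k l := 𝟙 (hom V k l)
  map_id k := Category.comp_id _
  map_comp k l m := by
    refine (Category.comp_id _).trans ?_
    rw [id_tensorHom_id, Category.id_comp]
    exact (SymmetricCategory.symmetry_assoc _ _ (eComp V k l m)).symm

variable [HasLimits V]

/-- An element of `[D, K](F, G)` is a `V`-natural transformation. -/
def IsVNat.arrow {D : Type w} [EnrichedCategory V D] {F G : EnrichedFunctor V D V}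
    {n : ∀ a, F.obj a ⟶ G.obj a} (h : IsVNat F G n) :
    ForgetEnrichment.of V F ⟶ ForgetEnrichment.of V G :=
  ForgetEnrichment.homOf V (natObj.lift (fun a => name (n a)) ((isNat_name_iff n).2 h))

lemma IsVNat.map_arrow {D : Type w} [EnrichedCategory V D] {F G : EnrichedFunctor V D V}
    {n : ∀ a, F.obj a ⟶ G.obj a} (h : IsVNat F G n) (a : D) :
    (und (evalAt a)).map h.arrow = n a := by
  have : natObj.lift (fun a => name (n a)) ((isNat_name_iff n).2 h) ≫ natObj.π F G a =
    name (n a) := natObj.lift_π _ _ a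
  exact (congrArg unname this).trans (unname_name _)

lemma isVNat_map {D : Type w} [EnrichedCategory V D]
    {F G : ForgetEnrichment V (EnrichedFunctor V D V)} (f : F ⟶ G) :
    IsVNat (ForgetEnrichment.to V F) (ForgetEnrichment.to V G)
      (fun a => (und (evalAt a)).map f) :=
  (isNat_iff_isVNat _).1 ((natObj.isNat _ _).precomp (ForgetEnrichment.homTo V f))

lemma arrow_ext {D : Type w} [EnrichedCategory V D]
    {F G : ForgetEnrichment V (EnrichedFunctor V D V)} {f g : F ⟶ G}
    (h : ∀ a : D, (und (evalAt a)).map f = (und (evalAt a)).map g) : f = g :=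
  natObj.hom_ext (f := ForgetEnrichment.homTo V f) (g := ForgetEnrichment.homTo V g)
    fun a => unname_injective (h a)

/-- A `V`-functor to a functor category, from a family of `V`-natural actions. -/
def functorMk {C : Type u₁} [EnrichedCategory V C] {D : Type w} [EnrichedCategory V D]
    {K : Type u₂} [EnrichedCategory V K] (obj : C → EnrichedFunctor V D K)
    (m : ∀ x y d, hom V x y ⟶ hom V ((obj x).obj d) ((obj y).obj d))
    (nat : ∀ x y, IsNat (obj x) (obj y) (m x y))
    (id : ∀ x d, eId V x ≫ m x x d = eId V ((obj x).obj d))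
    (comp : ∀ x y z d, eComp V x y z ≫ m x z d = mulc (m x y d) (m y z d)) :
    EnrichedFunctor V C (EnrichedFunctor V D K) where
  obj := obj
  map x y := natObj.lift (m x y) (nat x y)
  map_id x := by
    apply natObj.hom_ext
    intro d
    rw [Category.assoc, natObj.lift_π, eId_π, id]
  map_comp x y z := by
    apply natObj.hom_ext
    intro d
    refine Eq.trans ?_ (mulc_π _ _ d).symm
    rw [Category.assoc, natObj.lift_π, natObj.lift_π, natObj.lift_π, comp]

lemma functorMk_map_π {C : Type u₁} [EnrichedCategory V C] {D : Type w} [EnrichedCategory V D]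
    {K : Type u₂} [EnrichedCategory V K] (obj : C → EnrichedFunctor V D K)
    (m : ∀ x y d, hom V x y ⟶ hom V ((obj x).obj d) ((obj y).obj d))
    (nat : ∀ x y, IsNat (obj x) (obj y) (m x y))
    (id : ∀ x d, eId V x ≫ m x x d = eId V ((obj x).obj d))
    (comp : ∀ x y z d, eComp V x y z ≫ m x z d = mulc (m x y d) (m y z d)) (x y : C) (d : D) :
    (functorMk obj m nat id comp).map x y ≫ natObj.π (obj x) (obj y) d = m x y d :=
  natObj.lift_π _ (nat x y) d

lemma isLNat_eComp {D : Type w} [EnrichedCategory V D] [HasColimits V] {K : Type u₂}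
    [EnrichedCategory V K] (S : EnrichedFunctor V D K) (X X' : K) :
    IsLNat (Y := hom V X' X) (S.comp V (corep X)) (S.comp V (corep X'))
      (fun d => eComp V X' X (S.obj d)) := by
  refine (isLNat_corep_iff (W := S.comp V (corep X)) (Y := hom V X' X)
    (fun d => eComp V X' X (S.obj d))).2 fun d d' => ?_
  have h (d : D) : eComp V X' X (S.obj d) = mulc (𝟙 _) (𝟙 _) := by simp [mulc]
  have h2 : unc ((S.comp V (corep X)).map d d') = mulc (𝟙 _) (S.map d d') :=
    unc_comp_corepMap _ _ _ _
  rw [h, h, h2]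
  refine (mulc_assoc _ _ _).trans ?_
  refine congrArg ((α_ _ _ _).hom ≫ ·) ?_
  have h3 := comp_mulc_right (mulc (𝟙 (hom V X (S.obj d))) (S.map d d')) (𝟙 (hom V X' X)) (𝟙 _)
  rwa [Category.comp_id] at h3

lemma eId_lcur_eComp {K : Type u₂} [EnrichedCategory V K] (X Y : K) :
    eId V X ≫ lcur (eComp V X X Y) = eId V (hom V X Y) := by
  apply unc_injective
  rw [unc_eId, comp_lcur, unc_lcur]
  have := eId_mulc (𝟙 (hom V X Y))
  simp only [mulc, tensorHom_id, Category.comp_id] at this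
  rw [this]
  simp

lemma eComp_lcur_eComp {K : Type u₂} [EnrichedCategory V K] (X X' X'' Y : K) :
    ((β_ _ _).hom ≫ eComp V X'' X' X) ≫ lcur (eComp V X'' X Y) =
      mulc (lcur (eComp V X' X Y)) (lcur (eComp V X'' X' Y)) := by
  apply lunc_injective
  rw [lunc_mulc, comp_lcur, lunc_lcur, lunc_lcur, lunc_lcur, comp_whiskerRight_assoc,
    ← e_assoc, Iso.hom_inv_id_assoc]

/-- The `V`-functor `Kᵒᵖ ⟶ [D, V]` that sends `X` to `K(X, S -)`. -/
def nerve {D : Type w} [EnrichedCategory V D] [HasColimits V] {K : Type u₂} [EnrichedCategory V K]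
    (S : EnrichedFunctor V D K) : EnrichedFunctor V Kᵒᵖ (EnrichedFunctor V D V) :=
  functorMk (fun X => S.comp V (corep X.unop))
    (fun X X' d => lcur (Y := hom V X'.unop X.unop) (eComp V X'.unop X.unop (S.obj d)))
    (fun X X' => (isNat_lcur_iff (F := S.comp V (corep X.unop)) (G := S.comp V (corep X'.unop))
      _).2 (isLNat_eComp S X.unop X'.unop))
    (fun X d => eId_lcur_eComp X.unop (S.obj d))
    (fun X X' X'' d => eComp_lcur_eComp X.unop X'.unop X''.unop (S.obj d))

lemma nerve_map_π {D : Type w} [EnrichedCategory V D] [HasColimits V] {K : Type u₂}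
    [EnrichedCategory V K] (S : EnrichedFunctor V D K) (X X' : Kᵒᵖ) (d : D) :
    (nerve S).map X X' ≫ natObj.π (S.comp V (corep X.unop)) (S.comp V (corep X'.unop)) d =
      lcur (Y := hom V X'.unop X.unop) (eComp V X'.unop X.unop (S.obj d)) :=
  functorMk_map_π _ _ _ _ _ X X' d

/-- The `V`-functor `B ⟶ [A, V]` that corresponds to `A ⟶ [B, V]`. -/
def transpose {D : Type w} [EnrichedCategory V D] {B : Type w} [EnrichedCategory V B]
    (S : EnrichedFunctor V D (EnrichedFunctor V B V)) :
    EnrichedFunctor V B (EnrichedFunctor V D V) :=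
  functorMk (fun b => S.comp V (evalAt b)) (fun b b' d => (S.obj d).map b b')
    (fun b b' d d' => by
      have h := ((natObj.isNat (S.obj d) (S.obj d')).precomp (S.map d d')) b b'
      refine Eq.trans ?_ (congrArg ((β_ _ _).hom ≫ ·) h).symm
      exact (SymmetricCategory.symmetry_assoc _ _ _).symm)
    (fun b d => (S.obj d).map_id b) (fun b b' b'' d => (S.obj d).map_comp b b' b'')

lemma transpose_map_π {D : Type w} [EnrichedCategory V D] {B : Type w} [EnrichedCategory V B]
    (S : EnrichedFunctor V D (EnrichedFunctor V B V)) (b b' : B) (d : D) :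
    (transpose S).map b b' ≫ natObj.π (S.comp V (evalAt b)) (S.comp V (evalAt b')) d =
      (S.obj d).map b b' :=
  functorMk_map_π _ _ _ _ _ b b' d

end functors

/-! ### Limits in functor categories are pointwise -/

section pointwise
variable {V : Type u} [Category.{w} V] [MonoidalCategory V] [SymmetricCategory V] [MonoidalClosed V]
  [HasLimits V] [HasColimits V]
variable {A : Type w} [EnrichedCategory V A] {K : Type u₂} [EnrichedCategory V K]

lemma IsLNat.map {K' : Type u₃} [EnrichedCategory V K'] {W : EnrichedFunctor V A V}
    {S : EnrichedFunctor V A K} {X : K} {Y : V} {t : ∀ a, Y ⊗ W.obj a ⟶ hom V X (S.obj a)}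
    (h : IsLNat W (S.comp V (corep X)) t) (H : EnrichedFunctor V K K') :
    IsLNat W ((S.comp V H).comp V (corep (H.obj X))) (fun a => t a ≫ H.map _ _) := by
  refine (isLNat_corep_iff (S := S.comp V H) (X := H.obj X) (fun a => t a ≫ H.map _ _)).2
    fun a b => ?_
  refine (mulc_map H (t a) (S.map a b)).symm.trans ?_
  rw [(isLNat_corep_iff t).1 h a b]
  simp only [Category.assoc]
  rfl

namespace WeightedCone

lemma IsLimit.hom_ext {W : EnrichedFunctor V A V} {S : EnrichedFunctor V A K} {L : K}
    {c : WeightedCone W S L} (h : c.IsLimit) {X : K} {Y : V} {f g : Y ⟶ hom V X L}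
    (hfg : ∀ a, mulc f (c.app a) = mulc g (c.app a)) : f = g :=
  (c.isLimit_iff_mulc.1 h X Y _ (c.isLNat_mulc g)).unique hfg fun _ => rfl

lemma IsLimit.of_app_eq {W : EnrichedFunctor V A V} {S : EnrichedFunctor V A K} {L : K}
    {c c' : WeightedCone W S L} (h : ∀ a, c.app a = c'.app a) (hc : c'.IsLimit) : c.IsLimit := by
  obtain ⟨f, _⟩ := c
  obtain ⟨f', _⟩ := c'
  obtain rfl : f = f' := funext h
  exact hc

variable {B : Type w} [EnrichedCategory V B]

lemma isLimit_of_pointwise {W : EnrichedFunctor V A V}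
    {S : EnrichedFunctor V A (EnrichedFunctor V B V)} {L : EnrichedFunctor V B V}
    (c : WeightedCone W S L) (h : ∀ b : B, (c.map (evalAt b)).IsLimit) : c.IsLimit := by
  rw [isLimit_iff_mulc]
  intro X Y t ht
  let k (b : B) (a : A) : W.obj a ⟶ hom V (L.obj b) ((S.obj a).obj b) :=
    c.app a ≫ natObj.π L (S.obj a) b
  let s (b : B) (a : A) : Y ⊗ W.obj a ⟶ hom V (X.obj b) ((S.obj a).obj b) :=
    t a ≫ natObj.π X (S.obj a) b
  have h1 (b : B) : ∃! f : Y ⟶ hom V (X.obj b) (L.obj b), ∀ a, mulc f (k b a) = s b a :=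
    (isLimit_iff_mulc _).1 (h b) (X.obj b) Y (s b) (ht.map (evalAt b))
  choose f hf hu using h1
  have hnat : IsNat X L f := by
    intro b b'
    refine IsLimit.hom_ext (X := X.obj b) (h b') fun a => ?_
    change mulc (mulc (f b) (L.map b b')) (k b' a) =
      mulc ((β_ _ _).hom ≫ mulc (X.map b b') (f b')) (k b' a)
    have hk : mulc (L.map b b') (k b' a) = (β_ _ _).hom ≫ mulc (k b a) ((S.obj a).map b b') := by
      have := (natObj.isNat L (S.obj a)).precomp (c.app a) b b'
      beta_reduce at this
      rw [this]
      exact (SymmetricCategory.symmetry_assoc _ _ _).symm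
    have hs : mulc (s b a) ((S.obj a).map b b') =
        (β_ _ _).hom ≫ mulc (X.map b b') (s b' a) :=
      (natObj.isNat X (S.obj a)).precomp (t a) b b'
    have e : mulc (f b) (mulc (k b a) ((S.obj a).map b b')) =
        (α_ _ _ _).inv ≫ mulc (mulc (f b) (k b a)) ((S.obj a).map b b') := by
      rw [mulc_assoc, Iso.inv_hom_id_assoc]
    rw [mulc_assoc, hk, comp_mulc_right, e, hf, hs, comp_mulc_left, mulc_assoc, hf,
      BraidedCategory.braiding_tensor_left_hom]
    simp
  refine ⟨natObj.lift f hnat, fun a => ?_, fun g hg => ?_⟩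
  · apply natObj.hom_ext
    intro b
    rw [mulc_π, natObj.lift_π]
    exact hf b a
  · apply natObj.hom_ext
    intro b
    rw [natObj.lift_π]
    refine hu b _ fun a => ?_
    refine (mulc_π g (c.app a) b).symm.trans ?_
    rw [hg a]

lemma isNat_canonical (W : EnrichedFunctor V A V)
    (S : EnrichedFunctor V A (EnrichedFunctor V B V)) (a : A) :
    IsNat ((transpose S).comp V (corep W)) (S.obj a)
      (fun b => (canonical W (S.comp V (evalAt b))).app a) := by
  intro b b'
  apply unc_injective
  have h0 (b : B) : unc ((canonical W (S.comp V (evalAt b))).app a) =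
    lunc (natObj.π W (S.comp V (evalAt b)) a) := unc_canonical_app _ _ a
  have h1 : unc (((transpose S).comp V (corep W)).map b b') =
      mulc (𝟙 (natObj W (S.comp V (evalAt b)))) ((transpose S).map b b') :=
    unc_comp_corepMap _ _ _ _
  have h2 : (transpose S).map b b' ≫ natObj.π (S.comp V (evalAt b)) (S.comp V (evalAt b')) a =
    (S.obj a).map b b' := transpose_map_π S b b' a
  have h3 : mulc (𝟙 (natObj W (S.comp V (evalAt b)))) ((transpose S).map b b') ≫
      natObj.π W (S.comp V (evalAt b')) a =
      mulc (natObj.π W (S.comp V (evalAt b)) a) ((S.obj a).map b b') := by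
    refine (mulc_π (𝟙 (natObj W (S.comp V (evalAt b)))) ((transpose S).map b b') a).trans ?_
    rw [Category.id_comp]
    exact congrArg (mulc _) h2
  have h4 := lunc_comp (mulc (𝟙 (natObj W (S.comp V (evalAt b)))) ((transpose S).map b b'))
    (natObj.π W (S.comp V (evalAt b')) a)
  have h5 {Y X A B C : V} (p : Y ⟶ hom V A B) (q : X ⟶ hom V B C) :
      (α_ _ _ _).inv ≫ lunc p ▷ X ≫ unc q =
        Y ◁ (β_ _ _).hom ≫ (α_ _ _ _).inv ≫ lunc (mulc p q) := by
    rw [lunc, lunc, unc_mulc, BraidedCategory.braiding_tensor_left_hom]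
    simp
  refine (unc_mulc ((canonical W (S.comp V (evalAt b))).app a) ((S.obj a).map b b')).trans ?_
  refine Eq.trans ?_ (unc_comp _ _).symm
  refine Eq.trans ?_ (congrArg (_ ◁ (β_ _ _).hom ≫ ·) (unc_mulc _ _)).symm
  refine (congrArg (fun z => (α_ _ _ _).inv ≫ z ▷ _ ≫ unc ((S.obj a).map b b')) (h0 b)).trans ?_
  refine (h5 (natObj.π W (S.comp V (evalAt b)) a) ((S.obj a).map b b')).trans ?_
  refine congrArg (_ ◁ (β_ _ _).hom ≫ (α_ _ _ _).inv ≫ ·) ?_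
  refine (congrArg lunc h3).symm.trans (h4.trans ?_)
  exact congrArg₂ (fun y z => y ▷ W.obj a ≫ z) h1.symm (h0 b').symm

/-- Functor categories have pointwise limits. -/
theorem exists_pointwise_limit (W : EnrichedFunctor V A V)
    (S : EnrichedFunctor V A (EnrichedFunctor V B V)) :
    ∃ (L : EnrichedFunctor V B V) (c : WeightedCone W S L),
      ∀ b : B, (c.map (evalAt b)).IsLimit := by
  let k (a : A) := natObj.lift _ (isNat_canonical W S a)
  have hk (a : A) (b : B) : k a ≫ natObj.π ((transpose S).comp V (corep W)) (S.obj a) b =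
    (canonical W (S.comp V (evalAt b))).app a := natObj.lift_π _ _ b
  let c : WeightedCone W S ((transpose S).comp V (corep W)) := ⟨k, fun a a' => by
    apply natObj.hom_ext
    intro b
    rw [mulc_π, Category.assoc, hk, hk]
    exact (canonical W (S.comp V (evalAt b))).naturality a a'⟩
  refine ⟨_, c, fun b => ?_⟩
  exact IsLimit.of_app_eq (c := c.map (evalAt b)) (fun a => hk a b)
    (canonical_isLimit W (S.comp V (evalAt b)))

end WeightedCone
end pointwise

/-! ### The Yoneda lemma and the comparison maps -/

section yoneda
variable {V : Type u} [Category.{w} V] [MonoidalCategory V] [SymmetricCategory V] [MonoidalClosed V]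
  [HasLimits V] [HasColimits V]
variable {B : Type w} [EnrichedCategory V B]

lemma isLNat_unc_map (b : B) (N : EnrichedFunctor V B V) :
    IsLNat (corep b) N (fun c => unc (N.map b c)) := by
  intro c d
  have h := congrArg unc (N.map_comp b c d)
  refine Eq.trans ?_ (congrArg (fun z => (α_ _ _ _).hom ≫ N.obj b ◁ z ≫ unc (N.map b d))
    (unc_cur (eComp V b c d))).symm
  rw [unc_comp] at h
  refine Eq.trans ?_ (congrArg ((α_ _ _ _).hom ≫ ·) h).symm
  refine Eq.trans ?_ (congrArg ((α_ _ _ _).hom ≫ ·) (unc_mulc (N.map b c) (N.map c d))).symm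
  exact (Iso.hom_inv_id_assoc _ _).symm

/-- The Yoneda map `N b ⟶ [B, V](B(b, -), N)`. -/
def yonedaMap (b : B) (N : EnrichedFunctor V B V) : N.obj b ⟶ hom V (corep b) N :=
  natObj.lift (fun c => lcur (unc (N.map b c))) ((isNat_lcur_iff _).2 (isLNat_unc_map b N))

lemma yonedaMap_π (b : B) (N : EnrichedFunctor V B V) (c : B) :
    yonedaMap b N ≫ natObj.π (corep b) N c = lcur (unc (N.map b c)) := natObj.lift_π _ _ c

lemma existsUnique_yoneda (b : B) (N : EnrichedFunctor V B V) {Y : V}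
    (t : ∀ c, Y ⊗ hom V b c ⟶ N.obj c) (ht : IsLNat (corep b) N t) :
    ∃! f : Y ⟶ N.obj b, ∀ c, f ▷ hom V b c ≫ unc (N.map b c) = t c := by
  have hid : N.obj b ◁ eId V b ≫ unc (N.map b b) = (ρ_ _).hom := by
    rw [← unc_comp, N.map_id, unc_eId]
  refine ⟨(ρ_ Y).inv ≫ Y ◁ eId V b ≫ t b, fun c => ?_, fun g hg => ?_⟩
  · have h1 : t b ▷ hom V b c ≫ unc (N.map b c) =
        (α_ _ _ _).hom ≫ Y ◁ eComp V b b c ≫ t c :=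
      (ht b c).trans (congrArg (fun z => (α_ _ _ _).hom ≫ Y ◁ z ≫ t c) (unc_cur (eComp V b b c)))
    rw [comp_whiskerRight_assoc, comp_whiskerRight_assoc, h1]
    rw [associator_naturality_middle_assoc, ← MonoidalCategory.whiskerLeft_comp_assoc]
    have h3 : eId V b ▷ hom V b c ≫ eComp V b b c = (λ_ _).hom := by
      have h4 := eId_mulc (𝟙 (hom V b c))
      simpa [mulc] using h4
    rw [h3]
    simp
  · rw [← hg b, whisker_exchange_assoc, hid]
    simp

instance (b : B) (N : EnrichedFunctor V B V) : IsIso (yonedaMap b N) := by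
  refine (natObj.isIso_iff _ _).2 fun Y σ hσ => ?_
  refine (existsUnique_congr fun f => forall_congr' fun c => ?_).1
    (existsUnique_yoneda b N _ ((isNat_iff_isLNat _).1 hσ))
  rw [comp_lcur]
  constructor
  · intro h
    exact (congrArg lcur h).trans (lcur_lunc _)
  · intro h
    rw [← h]
    exact (lunc_lcur _).symm

/-- The Yoneda isomorphism is `V`-natural. -/
lemma isVNat_yonedaMap (b : B) :
    IsVNat (evalAt b) (corep (K := EnrichedFunctor V B V) (corep b)) (yonedaMap b) := by
  intro N N'
  refine Eq.trans ?_ (congrArg (yonedaMap b N ▷ hom V N N' ≫ ·)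
    (unc_cur (eComp V (corep b) N N'))).symm
  apply natObj.hom_ext
  intro c
  have h1 : mulc (yonedaMap b N) (𝟙 (hom V N N')) = yonedaMap b N ▷ hom V N N' ≫
    eComp V (corep b) N N' := by simp [mulc]
  rw [← h1]
  refine Eq.trans ?_ (mulc_π (yonedaMap b N) (𝟙 (hom V N N')) c).symm
  rw [yonedaMap_π, Category.id_comp]
  refine (Category.assoc (unc (natObj.π N N' b)) (yonedaMap b N') _).trans ?_
  rw [yonedaMap_π]
  apply lunc_injective
  refine Eq.trans ?_ (lunc_mulc (lcur (unc (N.map b c))) (natObj.π N N' c)).symm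
  have h2 : lunc (natObj.π N N' b) ▷ hom V b c ≫ unc (N'.map b c) = (α_ _ _ _).hom ≫
    natObj N N' ◁ unc (N.map b c) ≫ lunc (natObj.π N N' c) :=
    (isNat_iff_isLNat _).1 (natObj.isNat N N') b c
  have h3 : (β_ _ _).hom ▷ hom V b c ≫ lunc (natObj.π N N' b) ▷ hom V b c =
      unc (natObj.π N N' b) ▷ hom V b c := by
    rw [← comp_whiskerRight, lunc, SymmetricCategory.symmetry_assoc]
  refine (congrArg lunc (comp_lcur (unc (natObj.π N N' b)) (unc (N'.map b c)))).trans ?_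
  rw [lunc_lcur, lunc_lcur]
  refine Eq.trans ?_ (congrArg ((β_ _ _).hom ▷ hom V b c ≫ ·) h2)
  rw [reassoc_of% h3]

variable {A : Type w} [EnrichedCategory V A] {K : Type u₂} [EnrichedCategory V K]

lemma WeightedCone.push_comp {W : EnrichedFunctor V A V} {S : EnrichedFunctor V A K} {L : K}
    (c : WeightedCone W S L) (X X' : K) (a : A) :
    ((β_ (hom V X L) (hom V X' X)).hom ≫ eComp V X' X L) ≫ c.push X' a =
      mulc (c.push X a) (lcur (eComp V X' X (S.obj a))) := by
  have h (X : K) : c.push X a = lcur (mulc (𝟙 (hom V X L)) (c.app a)) := rfl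
  have h1 (X X' X'' : K) : eComp V X X' X'' = mulc (𝟙 _) (𝟙 _) := by simp [mulc]
  apply lunc_injective
  rw [h, h, lunc_mulc, comp_lcur, lunc_lcur, lunc_lcur, lunc_lcur, h1, h1, ← comp_mulc_left,
    ← comp_mulc_right, Category.comp_id, Category.comp_id, comp_mulc_left, mulc_assoc]

lemma WeightedCone.comparison_comp {W : EnrichedFunctor V A V} {S : EnrichedFunctor V A K} {L : K}
    (c : WeightedCone W S L) (X X' : K) :
    ((β_ (hom V X L) (hom V X' X)).hom ≫ eComp V X' X L) ≫ c.comparison X' =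
      mulc (c.comparison X) ((nerve S).map (op X) (op X')) := by
  apply natObj.hom_ext
  intro a
  have h (X : K) : c.comparison X ≫ natObj.π W (S.comp V (corep X)) a = c.push X a :=
    natObj.lift_π _ _ a
  have h2 : (nerve S).map (op X) (op X') ≫
      natObj.π (S.comp V (corep X)) (S.comp V (corep X')) a =
      lcur (Y := hom V X' X) (eComp V X' X (S.obj a)) := nerve_map_π S (op X) (op X') a
  rw [Category.assoc, h]
  refine (c.push_comp X X' a).trans ?_
  rw [← h X]
  refine Eq.trans ?_ (mulc_π (c.comparison X) ((nerve S).map (op X) (op X')) a).symm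
  exact congrArg (mulc _) h2.symm

end yoneda

/-! ### Locally `𝔻`-presentable ordinary categories -/

lemma nonempty_isColimit_of_iso {C : Type u₁} [Category.{u₂} C] {D : Type u₃} [Category.{w} D]
    {E : Type w} [Category.{w} E] {N : E ⥤ C} {H H' : C ⥤ D} (e : H ≅ H') (t : Cocone N)
    (h : Nonempty (IsColimit (H.mapCocone t))) : Nonempty (IsColimit (H'.mapCocone t)) :=
  h.map (IsColimit.mapCoconeEquiv e)

section types

/-- If colimits over `E` commute with limits over `J`, then the limit cocone of a `J`-indexed
family of colimit cocones over `E` is a colimit cocone. -/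
lemma isColimit_of_commute {E J : Type w} [SmallCategory E] [SmallCategory J]
    [PreservesLimitsOfShape J (colim : (E ⥤ Type w) ⥤ Type w)]
    {Φ : J ⥤ E ⥤ Type w} (c : Cone Φ) (hc : IsLimit c) {Φ' : J ⥤ Type w} (c' : Cone Φ')
    (hc' : IsLimit c') (τ : ∀ j, Φ.obj j ⟶ (Functor.const E).obj (Φ'.obj j))
    (hτ : ∀ j, IsColimit (Cocone.mk _ (τ j)))
    (hnat : ∀ {j k} (f : j ⟶ k) e, (Φ.map f).app e ≫ (τ k).app e = (τ j).app e ≫ Φ'.map f)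
    (s : c.pt ⟶ (Functor.const E).obj c'.pt)
    (hs : ∀ j e, s.app e ≫ c'.π.app j = (c.π.app j).app e ≫ (τ j).app e) :
    Nonempty (IsColimit (Cocone.mk _ s)) := by
  let θ : Φ ⋙ colim ≅ Φ' := NatIso.ofComponents
    (fun j => (colimit.isColimit (Φ.obj j)).coconePointUniqueUpToIso (hτ j)) (by
      intro j k f
      apply colimit.hom_ext
      intro e
      have h1 (j : J) (e : E) : colimit.ι (Φ.obj j) e ≫
          ((colimit.isColimit (Φ.obj j)).coconePointUniqueUpToIso (hτ j)).hom = (τ j).app e :=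
        (colimit.isColimit (Φ.obj j)).comp_coconePointUniqueUpToIso_hom (hτ j) e
      simp only [Functor.comp_map, colim_map, ι_colimMap_assoc]
      rw [h1, reassoc_of% (h1 j e), hnat])
  have hθ (j : J) (e : E) : colimit.ι (Φ.obj j) e ≫ θ.hom.app j = (τ j).app e :=
    (colimit.isColimit (Φ.obj j)).comp_coconePointUniqueUpToIso_hom (hτ j) e
  have P : IsLimit ((Cone.postcompose θ.hom).obj (colim.mapCone c)) :=
    (IsLimit.postcomposeHomEquiv θ _).symm (isLimitOfPreserves colim hc)
  let m : (Cone.postcompose θ.hom).obj (colim.mapCone c) ⟶ c' :=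
    { hom := colimit.desc c.pt (Cocone.mk _ s)
      w := fun j => by
        apply colimit.hom_ext
        intro e
        simp [hs, hθ] }
  have hm : IsIso m := IsLimit.hom_isIso P hc' m
  have hm' : IsIso ((colimit.isColimit c.pt).desc (Cocone.mk _ s)) :=
    inferInstanceAs (IsIso ((Cone.forget _).map m))
  exact ⟨IsColimit.ofPointIso (colimit.isColimit c.pt)⟩

end types

namespace Doctrine
variable {𝔻 : Doctrine.{w}}

/-- The functors that preserve `𝔻`-limits, as a property of objects of a functor category. -/
abbrev ctsProp (𝔻 : Doctrine.{w}) (A : Type w) [SmallCategory A] :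
    ObjectProperty (A ⥤ Type w) :=
  fun F => ∀ i, PreservesLimitsOfShape (𝔻.J i) F

/-- The `𝔻`-continuous functors are closed under `𝔻`-filtered colimits, since these commute with
`𝔻`-limits in sets. -/
lemma isClosedUnderColimits_cts (A : Type w) [SmallCategory A] {E : Type w} [SmallCategory E]
    (hE : 𝔻.IsFiltered E) : (𝔻.ctsProp A).IsClosedUnderColimitsOfShape E where
  colimitsOfShape_le := by
    rintro F ⟨h⟩ i
    have := hE i
    have h1 : PreservesLimitsOfShape (𝔻.J i) h.diag.flip := by
      apply preservesLimitsOfShape_of_evaluation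
      intro e
      exact h.prop_diag_obj e i
    have e : h.diag.flip ⋙ colim ≅ F :=
      (colimitIsoFlipCompColim h.diag).symm ≪≫
        (colimit.isColimit h.diag).coconePointUniqueUpToIso h.isColimit
    exact preservesLimitsOfShape_of_natIso e

/-- A locally `𝔻`-presentable category has a small family of `𝔻`-presentable objects whose
represented functors jointly reflect colimits. -/
theorem IsLocallyPresentable.exists_generators {C : Type u} [Category.{w} C]
    (hC : 𝔻.IsLocallyPresentable C) : ∃ (ι : Type w) (G : ι → C), (∀ a, 𝔻.IsPresentable (G a)) ∧
      ∀ (E : Type w) [SmallCategory E] (N : E ⥤ C) (t : Cocone N),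
        (∀ a, Nonempty (IsColimit ((coyoneda.obj (op (G a))).mapCocone t))) →
          Nonempty (IsColimit t) := by
  obtain ⟨A, _, _, ⟨e⟩⟩ := hC
  -- The generators are the objects that correspond to the representables of `A`; they represent
  -- the evaluation functors.
  let y (a : A) : 𝔻.Cts A := ⟨coyoneda.obj (op a), fun i => inferInstance⟩
  let ev (a : A) : C ⥤ Type w := e.functor ⋙ (𝔻.ctsProp A).ι ⋙ (evaluation A (Type w)).obj a
  let rep (a : A) : (ev a).CorepresentableBy (e.inverse.obj (y a)) :=
    { homEquiv := fun {X} => (e.symm.toAdjunction.homEquiv (y a) X).trans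
        ((𝔻.ctsProp A).fullyFaithfulι.homEquiv.trans coyonedaEquiv)
      homEquiv_comp := fun {X Y} g f => by
        simp only [ev, y, Adjunction.homEquiv_unit, Equiv.trans_apply,
          Functor.map_comp, ← Category.assoc]
        rfl }
  refine ⟨A, fun a => e.inverse.obj (y a), fun a E _ hE => ?_, fun E _ N t h => ?_⟩
  · have := isClosedUnderColimits_cts (𝔻 := 𝔻) A hE
    have h1 : PreservesColimitsOfShape E (ev a) := inferInstance
    exact preservesColimitsOfShape_of_natIso (rep a).toIso.symm
  · have h1 : Nonempty (IsColimit ((e.functor ⋙ (𝔻.ctsProp A).ι).mapCocone t)) :=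
      ⟨evaluationJointlyReflectsColimits _ fun a =>
        (nonempty_isColimit_of_iso (rep a).toIso t (h a)).some⟩
    exact ⟨isColimitOfReflects (e.functor ⋙ (𝔻.ctsProp A).ι) h1.some⟩

/-- In a locally `𝔻`-presentable category, `𝔻`-filtered colimits commute with `𝔻`-limits. -/
lemma IsLocallyPresentable.preservesColimitsOfShape_lim {C : Type u} [Category.{w} C] [HasLimits C]
    [HasColimits C]
    (hC : 𝔻.IsLocallyPresentable C) {E : Type w} [SmallCategory E] (hE : 𝔻.IsFiltered E)
    (i : 𝔻.ι) : PreservesColimitsOfShape E (lim : (𝔻.J i ⥤ C) ⥤ C) := by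
  obtain ⟨ι, G, hG, href⟩ := hC.exists_generators
  refine ⟨fun {K} => ⟨fun {T} hT => href E _ _ fun a => ?_⟩⟩
  have := hE i
  have := hG a E hE
  let g := coyoneda.obj (op (G a))
  let c : Cone (K.flip ⋙ (Functor.whiskeringRight E C (Type w)).obj g) :=
    { pt := K ⋙ lim ⋙ g
      π := { app := fun j => { app := fun e => g.map (limit.π (K.obj e) j)
                               naturality := fun e e' f => by
                                simp [← Functor.map_comp] }
             naturality := fun j k f => by
              ext e : 2
              simp [← Functor.map_comp] } }
  have hc : IsLimit c := evaluationJointlyReflectsLimits _ fun e =>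
    isLimitOfPreserves g (limit.isLimit (K.obj e))
  refine isColimit_of_commute c hc (g.mapCone (limit.cone T.pt))
    (isLimitOfPreserves g (limit.isLimit T.pt))
    (fun j => { app := fun e => g.map ((T.ι.app e).app j)
                naturality := fun e e' f => by
                  simp [← Functor.map_comp, ← NatTrans.comp_app] })
    (fun j => isColimitOfPreserves g (isColimitOfPreserves ((evaluation _ _).obj j) hT))
    (fun f e => by simp [← Functor.map_comp])
    (Cocone.ι (g.mapCocone (lim.mapCocone T)))
    (fun j e => by simp [c, ← Functor.map_comp])

variable {V : Type u} [Category.{w} V] [MonoidalCategory V] [SymmetricCategory V] [MonoidalClosed V]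

/-- If `𝔻`-presentable objects are closed under `⊗`, then `[G, -]` preserves `𝔻`-filtered colimits
for `𝔻`-presentable `G`. -/
lemma IsTensorLocallyPresentable.isEnrichedPresentable (hV : 𝔻.IsTensorLocallyPresentable V)
    {G : V} (hG : 𝔻.IsPresentable G) : 𝔻.IsEnrichedPresentable G := by
  obtain ⟨ι, X, hX, hr⟩ := hV.1.exists_generators
  intro E _ hE
  refine ⟨fun {K} => ⟨fun {T} hT => hr E _ _ fun a => ?_⟩⟩
  have := hV.2 G (X a) hG (hX a) E hE
  let e : coyoneda.obj (op (G ⊗ X a)) ≅ ihom G ⋙ coyoneda.obj (op (X a)) :=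
    NatIso.ofComponents (fun Y => ((ihom.adjunction G).homEquiv (X a) Y).toIso) (fun f => by
      ext z
      exact (ihom.adjunction G).homEquiv_naturality_right z f)
  exact nonempty_isColimit_of_iso e T ⟨isColimitOfPreserves _ hT⟩

end Doctrine

/-! ### Conical limits -/

section conical
variable {V : Type u} [Category.{w} V] [MonoidalCategory V] [SymmetricCategory V] [MonoidalClosed V]
  [HasLimits V] [HasColimits V]
variable {J : Type w} [SmallCategory J] {K : Type u₂} [EnrichedCategory V K]

/-- An object of `J`, as an object of the free `V`-category. -/
def toFree (V : Type u) [Category.{w} V] {J : Type w} (j : J) : FreeV V J := j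

/-- A morphism of `J`, as an element of a hom-object of the free `V`-category. -/
def freeArr (V : Type u) [Category.{w} V] [MonoidalCategory V] [SymmetricCategory V]
    [MonoidalClosed V] [HasColimits V] {j j' : J} (f : j ⟶ j') :
    𝟙_ V ⟶ hom V (toFree V j) (toFree V j') := freeι V f

lemma freeArr_id (j : J) : freeArr V (𝟙 j) = eId V (toFree V j) := rfl

lemma freeArr_comp {j k l : J} (f : j ⟶ k) (g : k ⟶ l) :
    mulc (freeArr V f) (freeArr V g) = (λ_ _).hom ≫ freeArr V (f ≫ g) :=
  freeι_mulc f g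

lemma freeArr_ext {j k : J} {X Z : V} {s t : X ⊗ hom V (toFree V j) (toFree V k) ⟶ Z}
    (h : ∀ f : j ⟶ k, X ◁ freeArr V f ≫ s = X ◁ freeArr V f ≫ t) : s = t :=
  freeHom_tensor_ext h

lemma freeArr_freeLift (S : J ⥤ ForgetEnrichment V K) {j k : J} (f : j ⟶ k) :
    freeArr V f ≫ (freeLift S).map (toFree V j) (toFree V k) =
      ForgetEnrichment.homTo V (S.map f) :=
  freeι_desc (D := J) _ f

/-- The ordinary functor that corresponds to a `V`-functor on a free `V`-category. -/
def freeUnd (S : EnrichedFunctor V (FreeV V J) K) : J ⥤ ForgetEnrichment V K where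
  obj j := ForgetEnrichment.of V (S.obj (toFree V j))
  map {j k} f := ForgetEnrichment.homOf V (freeArr V f ≫ S.map (toFree V j) (toFree V k))
  map_id j := by
    rw [freeArr_id, S.map_id]
    exact ForgetEnrichment.homOf_eId V _
  map_comp {j k l} f g := by
    have h := freeArr_comp (V := V) f g =≫ S.map _ _
    rw [mulc_map, Category.assoc, ← Iso.inv_comp_eq] at h
    rw [← h]
    exact ForgetEnrichment.homOf_comp V _ _

lemma unc_conicalWeight {j k : J} (f : j ⟶ k) :
    𝟙_ V ◁ freeArr V f ≫ unc ((conicalWeight (V := V) J).map (toFree V j) (toFree V k)) =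
      (ρ_ (𝟙_ V)).hom := by
  refine (unc_comp (A := 𝟙_ V) (B := 𝟙_ V) (freeArr V f) _).symm.trans ?_
  refine (congrArg unc (freeArr_freeLift (V := V) (K := V) _ f)).trans ?_
  refine (congrArg unc (ForgetEnrichment.homTo_id V
    (ForgetEnrichment.of V (𝟙_ V)))).trans ?_
  exact unc_eId _

/-- A naturality equation for a weight with value `𝟙_ V`, restricted along an element `z` of the
hom-object on which the weight acts by the identity. -/
lemma whisker_unit_eq_iff {Y A B H : V} (t : Y ⊗ 𝟙_ V ⟶ A) (t' : Y ⊗ 𝟙_ V ⟶ B) (z : 𝟙_ V ⟶ H)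
    (m : H ⟶ hom V A B) (v : 𝟙_ V ⊗ H ⟶ 𝟙_ V) (hv : 𝟙_ V ◁ z ≫ v = (ρ_ (𝟙_ V)).hom) :
    (Y ⊗ 𝟙_ V) ◁ z ≫ t ▷ H ≫ unc m = (Y ⊗ 𝟙_ V) ◁ z ≫ (α_ Y (𝟙_ V) H).hom ≫ Y ◁ v ≫ t' ↔
      ((ρ_ Y).inv ≫ t) ≫ unname (z ≫ m) = (ρ_ Y).inv ≫ t' := by
  have h2 : (Y ⊗ 𝟙_ V) ◁ z ≫ (α_ Y (𝟙_ V) H).hom ≫ Y ◁ v ≫ t' = (ρ_ _).hom ≫ t' := by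
    rw [associator_naturality_right_assoc, ← MonoidalCategory.whiskerLeft_comp_assoc, hv]
    simp
  rw [h2, unname, unc_comp, whisker_exchange_assoc, Category.assoc, cancel_epi,
    ← cancel_epi (ρ_ (Y ⊗ 𝟙_ V)).inv, Iso.inv_hom_id_assoc, rightUnitor_inv_naturality_assoc]

/-- For the conical weight, naturality reduces to compatibility with the morphisms of `J`. -/
lemma isLNat_conical_iff {S : EnrichedFunctor V (FreeV V J) V} {Y : V}
    (t : ∀ j : FreeV V J, Y ⊗ 𝟙_ V ⟶ S.obj j) :
    IsLNat (conicalWeight J) S t ↔ ∀ {j k : J} (f : j ⟶ k),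
      ((ρ_ Y).inv ≫ t (toFree V j)) ≫ (freeUnd S ⋙ und (EnrichedFunctor.id V V)).map f =
        (ρ_ Y).inv ≫ t (toFree V k) := by
  have key {j k : J} (f : j ⟶ k) :
      (Y ⊗ 𝟙_ V) ◁ freeArr V f ≫ t (toFree V j) ▷ hom V (toFree V j) (toFree V k) ≫
          unc (S.map (toFree V j) (toFree V k)) =
        (Y ⊗ 𝟙_ V) ◁ freeArr V f ≫ (α_ Y (𝟙_ V) (hom V (toFree V j) (toFree V k))).hom ≫
          Y ◁ unc ((conicalWeight J).map (toFree V j) (toFree V k)) ≫ t (toFree V k) ↔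
      ((ρ_ Y).inv ≫ t (toFree V j)) ≫ (freeUnd S ⋙ und (EnrichedFunctor.id V V)).map f =
        (ρ_ Y).inv ≫ t (toFree V k) := by
    have h1 : (freeUnd S ⋙ und (EnrichedFunctor.id V V)).map f =
        unname (freeArr V f ≫ S.map (toFree V j) (toFree V k)) :=
      congrArg unname (Category.comp_id _)
    rw [h1]
    exact whisker_unit_eq_iff _ _ _ _ _ (unc_conicalWeight f)
  constructor
  · intro h j k f
    exact (key f).1 (congrArg ((Y ⊗ 𝟙_ V) ◁ freeArr V f ≫ ·) (h (toFree V j) (toFree V k)))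
  · intro h j k
    exact freeArr_ext (J := J) fun f => (key f).2 (h f)

/-- The ordinary cone that corresponds to a cone for the conical weight. -/
def freeCone {S : EnrichedFunctor V (FreeV V J) V} {L : V}
    (c : WeightedCone (conicalWeight J) S L) : Cone (freeUnd S ⋙ und (EnrichedFunctor.id V V)) where
  pt := L
  π :=
    { app := fun j => unname (c.app (toFree V j))
      naturality := fun j k f => by
        have := (isLNat_conical_iff _).1 c.isLNat_unc f
        exact (Category.id_comp _).trans this.symm }

lemma isLimit_iff_freeCone {S : EnrichedFunctor V (FreeV V J) V} {L : V}
    (c : WeightedCone (conicalWeight J) S L) : c.IsLimit ↔ Nonempty (IsLimit (freeCone c)) := by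
  rw [c.isLimit_iff_unc]
  have key {Y : V} (f : Y ⟶ L) (j : J) : f ≫ (freeCone c).π.app j =
      (ρ_ Y).inv ≫ f ▷ 𝟙_ V ≫ unc (A := L) (B := S.obj (toFree V j)) (c.app (toFree V j)) := by
    rw [← rightUnitor_inv_naturality_assoc]
    rfl
  constructor
  · intro h
    have h1 (s : Cone (freeUnd S ⋙ und (EnrichedFunctor.id V V))) :
        ∃! f : s.pt ⟶ L, ∀ j, f ≫ (freeCone c).π.app j = s.π.app j := by
      refine (existsUnique_congr fun f => forall_congr' fun j => ?_).1
        (h s.pt (fun j : J => (ρ_ s.pt).hom ≫ (s.π.app j : s.pt ⟶ S.obj (toFree V j)))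
          ((isLNat_conical_iff _).2 fun {j k} f => ?_))
      · rw [key]
        exact (Iso.inv_comp_eq (ρ_ _)).symm
      · have h2 (j : J) : (ρ_ _).inv ≫ (ρ_ _).hom ≫ s.π.app j = s.π.app j :=
          Iso.inv_hom_id_assoc _ _
        exact ((congrArg (· ≫ _) (h2 j)).trans (s.w f)).trans (h2 k).symm
    choose f hf hu using h1
    exact ⟨{ lift := f, fac := hf, uniq := fun s g hg => hu s g hg }⟩
  · rintro ⟨h⟩ Y t ht
    let s : Cone (freeUnd S ⋙ und (EnrichedFunctor.id V V)) :=
      { pt := Y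
        π := { app := fun j => (ρ_ _).inv ≫ t (toFree V j)
               naturality := fun j k f =>
                (Category.id_comp _).trans ((isLNat_conical_iff _).1 ht f).symm } }
    have e (f : Y ⟶ L) (j : J) : f ≫ (freeCone c).π.app j = s.π.app j ↔
        f ▷ 𝟙_ V ≫ unc (c.app (toFree V j)) = t (toFree V j) := by
      rw [key]
      exact Iso.cancel_iso_inv_left _ _ _
    exact ⟨h.lift s, fun j => (e _ j).1 (h.fac s j), fun g hg =>
      h.uniq s g fun j => (e _ j).2 (hg j)⟩

end conical

/-! ### Weights whose limits commute with `𝔻`-filtered colimits -/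

section commuting
variable {V : Type u} [Category.{w} V] [MonoidalCategory V] [SymmetricCategory V] [MonoidalClosed V]
  [HasLimits V] [HasColimits V]

lemma lunc_mulc_name {A B C Y : V} (f : Y ⟶ hom V A B) (g : B ⟶ C) :
    lunc ((ρ_ Y).inv ≫ mulc f (name g)) = lunc f ≫ g := by
  rw [lunc, unc_comp, unc_mulc_name, lunc, Category.assoc]

lemma natObj_map_π {A : Type w} [EnrichedCategory V A] (W : EnrichedFunctor V A V)
    {N N' : ForgetEnrichment V (EnrichedFunctor V A V)} (f : N ⟶ N') (a : A) :
    (und (corep W)).map f ≫ natObj.π W (ForgetEnrichment.to V N') a =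
      (ρ_ _).inv ≫ mulc (natObj.π W (ForgetEnrichment.to V N) a)
        (name ((und (evalAt a)).map f)) := by
  have h : (und (corep W)).map f =
      (ρ_ _).inv ≫ mulc (𝟙 (natObj W (ForgetEnrichment.to V N))) (ForgetEnrichment.homTo V f) :=
    unname_comp_corepMap _ _ _ _
  have h2 : name ((und (evalAt a)).map f) = ForgetEnrichment.homTo V f ≫ natObj.π _ _ a :=
    name_unname _
  refine (congrArg (· ≫ natObj.π W (ForgetEnrichment.to V N') a) h).trans ?_
  refine (Category.assoc (ρ_ (natObj W (ForgetEnrichment.to V N))).inv _ _).trans ?_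
  refine (congrArg (_ ≫ ·) (mulc_π (𝟙 (natObj W (ForgetEnrichment.to V N))) _ a)).trans ?_
  rw [Category.id_comp]
  exact congrArg (fun z => (ρ_ _).inv ≫ mulc _ z) h2.symm

lemma lunc_π_natural {A : Type w} [EnrichedCategory V A] (W : EnrichedFunctor V A V)
    {N N' : ForgetEnrichment V (EnrichedFunctor V A V)} (f : N ⟶ N') (a : A) :
    (und (corep W)).map f ▷ W.obj a ≫ lunc (natObj.π W (ForgetEnrichment.to V N') a) =
      lunc (natObj.π W (ForgetEnrichment.to V N) a) ≫ (und (evalAt a)).map f := by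
  refine (lunc_comp _ _).symm.trans ?_
  exact (congrArg lunc (natObj_map_π W f a)).trans (lunc_mulc_name _ _)

/-- The weights `W` for which `[A, V](W, -)` preserves the colimits of shape `E` that are
computed pointwise, for each `𝔻`-filtered `E`. -/
def commutingWeights (V : Type u) [Category.{w} V] [MonoidalCategory V] [SymmetricCategory V]
    [MonoidalClosed V] [HasLimits V] (𝔻 : Doctrine.{w}) : WeightClass V := fun A _ W =>
  ∀ (E : Type w) [SmallCategory E], 𝔻.IsFiltered E →
    ∀ (N : E ⥤ ForgetEnrichment V (EnrichedFunctor V A V)) (t : Cocone N),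
      (∀ a, Nonempty (IsColimit ((und (evalAt a)).mapCocone t))) →
        Nonempty (IsColimit ((und (corep W)).mapCocone t))

/-- The natural isomorphism of underlying functors given by invertible `V`-natural components. -/
def IsVNat.natIso {K : Type u₂} [EnrichedCategory V K] {F G : EnrichedFunctor V K V}
    {n : ∀ k, F.obj k ⟶ G.obj k} (h : IsVNat F G n) (hn : ∀ k, IsIso (n k)) :
    und F ≅ und G :=
  NatIso.ofComponents (fun Z => @asIso _ _ _ _ (n (ForgetEnrichment.to V Z)) (hn _))
    (fun f => h.natTrans.naturality f)

/-- The isomorphism `[A, V](C, N) ≅ [D, V](F, [A, V](S -, N))` for `C = F * S` is `V`-natural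
in `N`. -/
lemma isVNat_comparison {A D : Type w} [EnrichedCategory V A] [EnrichedCategory V D]
    {F : EnrichedFunctor V D V} {S : EnrichedFunctor V D (EnrichedFunctor V A V)ᵒᵖ}
    {C : EnrichedFunctor V A V} (κ : WeightedCone F S (op C)) :
    IsVNat (corep C) (((opop (EnrichedFunctor V A V)).comp V (nerve S)).comp V (corep F))
      (fun N => κ.comparison (op N)) := by
  intro N N'
  have h1 : unc ((corep C).map N N') = eComp V C N N' := unc_cur _
  have h2 : (opop (EnrichedFunctor V A V)).map N N' ≫ (nerve S).map (op (op N)) (op (op N')) =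
    (nerve S).map (op (op N)) (op (op N')) := Category.id_comp _
  have h3 : unc ((((opop (EnrichedFunctor V A V)).comp V (nerve S)).comp V (corep F)).map N N') =
      mulc (𝟙 _) ((nerve S).map (op (op N)) (op (op N'))) :=
    (unc_comp_corepMap _ _ _ _).trans (congrArg (mulc _) h2)
  have h4 := κ.comparison_comp (op N) (op N')
  have h5 : (β_ (hom V (op N) (op C)) (hom V (op N') (op N))).hom ≫
      eComp V (op N') (op N) (op C) = eComp V C N N' :=
    SymmetricCategory.symmetry_assoc _ _ _
  refine (congrArg (· ≫ κ.comparison (op N')) (h1.trans h5.symm)).trans (h4.trans ?_)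
  refine Eq.trans ?_ (congrArg (κ.comparison (op N) ▷ hom V N N' ≫ ·) h3).symm
  refine Eq.trans ?_
    (comp_mulc_left (κ.comparison (op N)) (𝟙 _) ((nerve S).map (op (op N)) (op (op N'))))
  exact congrArg (fun z => mulc z ((nerve S).map (op (op N)) (op (op N'))))
    (Category.comp_id (κ.comparison (op N))).symm

lemma lcur_eComp_op {K : Type u₂} [EnrichedCategory V K] (a b c : K) :
    lcur (Y := hom V b c) (A := hom V a b) (B := hom V a c) (eComp V (op c) (op b) (op a)) =
      corepMap a b c :=
  congrArg cur (SymmetricCategory.symmetry_assoc _ _ (eComp V a b c))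

/-- The class of commuting weights is saturated: for a weighted colimit `C = F * S` of weights the
universal property reads `[A, V](C, N) ≅ [D, V](F, [A, V](S -, N))`, and both steps preserve
`𝔻`-filtered colimits in `N`. -/
theorem isSaturated_commutingWeights (𝔻 : Doctrine.{w}) :
    IsSaturated (commutingWeights V 𝔻) where
  representable A _ a E _ _ N t h :=
    nonempty_isColimit_of_iso ((isVNat_yonedaMap a).natIso fun N =>
      (inferInstance : IsIso (yonedaMap a N))) t (h a)
  colimit A D _ _ F S C κ hF hS hκ E _ hE N t h := by
    let Θ : ForgetEnrichment V (EnrichedFunctor V A V) ⥤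
        ForgetEnrichment V (EnrichedFunctor V D V) :=
      ((opop (EnrichedFunctor V A V)).comp V (nerve S)).forget
    let e : und (corep C) ≅ Θ ⋙ und (corep F) :=
      NatIso.ofComponents (fun N => @asIso _ _ _ _ (κ.comparison (op (ForgetEnrichment.to V N)))
        (hκ (op (ForgetEnrichment.to V N))))
        (fun {N N'} f => by
          refine ((isVNat_comparison κ).unname_comp (ForgetEnrichment.homTo V f)).trans ?_
          refine congrArg (κ.comparison (op (ForgetEnrichment.to V N)) ≫ ·) (congrArg unname ?_)
          exact (Category.assoc _ _ _).symm)
    have h1 : Nonempty (IsColimit ((und (corep F)).mapCocone (Θ.mapCocone t))) := by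
      refine hF E hE (N ⋙ Θ) (Θ.mapCocone t) fun d => ?_
      let e' : und (corep (S.obj d).unop) ≅ Θ ⋙ und (evalAt d) :=
        NatIso.ofComponents (fun N => Iso.refl _) (fun {N N'} f => by
          refine (Category.comp_id _).trans (Eq.trans ?_ (Category.id_comp _).symm)
          refine congrArg unname ?_
          have h2 := (nerve_map_π S (op (op (ForgetEnrichment.to V N)))
            (op (op (ForgetEnrichment.to V N'))) d).trans (lcur_eComp_op _ _ _)
          refine (congrArg (ForgetEnrichment.homTo V f ≫ ·) h2).symm.trans ?_
          refine (Category.assoc _ _ _).symm.trans ?_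
          exact congrArg (fun z => (ForgetEnrichment.homTo V f ≫ z) ≫ natObj.π _ _ d)
            (Category.id_comp _).symm)
      exact nonempty_isColimit_of_iso e' t (hS d E hE N t h)
    exact nonempty_isColimit_of_iso e.symm t h1

section basic
variable {𝔻 : Doctrine.{w}}

/-- Over the unit `V`-category, naturality is automatic. -/
lemma isNat_powerWeight (G : V) (N : EnrichedFunctor V UnitCat.{w} V) {Y : V}
    (σ : ∀ a, Y ⟶ hom V ((powerWeight G).obj a) (N.obj a)) : IsNat (powerWeight G) N σ := by
  have hN : N.map UnitCat.star UnitCat.star = eId V (N.obj UnitCat.star) := by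
    rw [← N.map_id]
    exact (Category.id_comp _).symm
  rintro ⟨⟩ ⟨⟩
  refine (congrArg (mulc _) hN).trans ((mulc_eId _).trans ?_)
  refine Eq.trans ?_ (congrArg ((β_ _ _).hom ≫ ·) (eId_mulc (σ UnitCat.star))).symm
  refine Eq.trans ?_ (Category.assoc _ _ _)
  exact congrArg (· ≫ σ UnitCat.star) (braiding_leftUnitor _).symm

/-- The end over the unit `V`-category is the internal hom. -/
lemma isIso_powerWeight_π (G : V) (N : EnrichedFunctor V UnitCat.{w} V) :
    IsIso (natObj.π (powerWeight G) N UnitCat.star) := by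
  have hnat := isNat_powerWeight G N (fun a => match a with
      | UnitCat.star => 𝟙 (hom V G (N.obj UnitCat.star)))
  refine ⟨natObj.lift _ hnat, ?_, natObj.lift_π _ hnat _⟩
  apply natObj.hom_ext
  rintro ⟨⟩
  refine (Category.assoc _ _ _).trans ?_
  refine (congrArg (natObj.π (powerWeight G) N UnitCat.star ≫ ·)
    (natObj.lift_π _ hnat UnitCat.star)).trans ?_
  exact (Category.comp_id _).trans (Category.id_comp _).symm

lemma commutingWeights_power {G : V} (hG : 𝔻.IsEnrichedPresentable G) :
    commutingWeights V 𝔻 UnitCat.{w} (powerWeight G) := by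
  intro E _ hE N t h
  have := hG E hE
  let e : und (corep (powerWeight G)) ≅ und (evalAt UnitCat.star) ⋙ ihom G :=
    NatIso.ofComponents
      (fun N => @asIso _ _ _ _ (natObj.π (powerWeight G) (ForgetEnrichment.to V N) UnitCat.star)
        (isIso_powerWeight_π G _))
      (fun {N N'} f => by
        refine (natObj_map_π (powerWeight G) f UnitCat.star).trans ?_
        apply unc_injective
        refine (unc_comp _ _).trans ((unc_mulc_name _ _).trans ?_)
        exact (MonoidalClosed.uncurry_natural_right
          (natObj.π (powerWeight G) (ForgetEnrichment.to V N) UnitCat.star) _).symm)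
  exact nonempty_isColimit_of_iso e.symm t ⟨isColimitOfPreserves (ihom G) (h _).some⟩

/-- The end of a functor on a free `V`-category is an ordinary limit, which commutes with
`𝔻`-filtered colimits. -/
lemma commutingWeights_conical (hV : 𝔻.IsLocallyPresentable V) (i : 𝔻.ι) :
    commutingWeights V 𝔻 (FreeV V (𝔻.J i)) (conicalWeight (𝔻.J i)) := by
  intro E _ hE N t h
  have := hV.preservesColimitsOfShape_lim hE i
  -- `U` restricts a `V`-functor on the free `V`-category to an ordinary functor.
  let U : ForgetEnrichment V (EnrichedFunctor V (FreeV V (𝔻.J i)) V) ⥤ (𝔻.J i ⥤ V) :=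
    { obj := fun N => freeUnd (ForgetEnrichment.to V N) ⋙ und (EnrichedFunctor.id V V)
      map := fun {N N'} f =>
        { app := fun j => (und (evalAt (toFree V j))).map f
          naturality := fun j k g => by
            have h1 (N : ForgetEnrichment V (EnrichedFunctor V (FreeV V (𝔻.J i)) V)) :
                (freeUnd (ForgetEnrichment.to V N) ⋙ und (EnrichedFunctor.id V V)).map g =
                  unname (freeArr V g ≫ (ForgetEnrichment.to V N).map (toFree V j) (toFree V k)) :=
              congrArg unname (Category.comp_id _)
            rw [h1, h1]
            exact (isVNat_map f).unname_comp (freeArr V g) }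
      map_id := fun N => by
        ext j
        exact (und (evalAt (toFree V j))).map_id N
      map_comp := fun f g => by
        ext j
        exact (und (evalAt (toFree V j))).map_comp f g }
  let cn (N : ForgetEnrichment V (EnrichedFunctor V (FreeV V (𝔻.J i)) V)) : Cone (U.obj N) :=
    freeCone (WeightedCone.canonical (conicalWeight (𝔻.J i)) (ForgetEnrichment.to V N))
  have hcn (N) : IsLimit (cn N) :=
    ((isLimit_iff_freeCone _).1 (WeightedCone.canonical_isLimit _ _)).some
  let e : und (corep (conicalWeight (𝔻.J i))) ≅ U ⋙ lim :=
    NatIso.ofComponents (fun N => (hcn N).conePointUniqueUpToIso (limit.isLimit (U.obj N)))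
      (fun {N N'} f => by
        apply limit.hom_ext
        intro j
        have h1 (N) (j) : ((hcn N).conePointUniqueUpToIso (limit.isLimit (U.obj N))).hom ≫
            limit.π (U.obj N) j = (cn N).π.app j :=
          (hcn N).conePointUniqueUpToIso_hom_comp (limit.isLimit (U.obj N)) j
        have h2 (N : ForgetEnrichment V (EnrichedFunctor V (FreeV V (𝔻.J i)) V)) :
            (cn N).π.app j = (ρ_ _).inv ≫ lunc (natObj.π (conicalWeight (𝔻.J i))
              (ForgetEnrichment.to V N) (toFree V j)) :=
          congrArg ((ρ_ _).inv ≫ ·) (WeightedCone.unc_canonical_app _ _ _)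
        have h3 : (U ⋙ lim).map f ≫ limit.π (U.obj N') j =
            limit.π (U.obj N) j ≫ (und (evalAt (toFree V j))).map f := limMap_π _ _
        refine (Category.assoc _ _ _).trans ?_
        refine (congrArg (_ ≫ ·) (h1 N' j)).trans ?_
        refine Eq.trans ?_ (Category.assoc _ _ _).symm
        refine Eq.trans ?_ (congrArg (_ ≫ ·) h3).symm
        refine Eq.trans ?_ ((congrArg (· ≫ (und (evalAt (toFree V j))).map f) (h1 N j)).symm.trans
          (Category.assoc _ _ _))
        rw [h2, h2]
        refine Eq.trans ?_ (Category.assoc _ _ _).symm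
        refine (rightUnitor_inv_naturality_assoc _ _).trans ?_
        exact congrArg (_ ≫ ·) (lunc_π_natural (conicalWeight (𝔻.J i)) f (toFree V j)))
  have hU : IsColimit (U.mapCocone t) := evaluationJointlyReflectsColimits _ fun j =>
    (h (toFree V j)).some
  exact nonempty_isColimit_of_iso e.symm t ⟨isColimitOfPreserves lim hU⟩

theorem weights_le_commutingWeights (hV : 𝔻.IsLocallyPresentable V) {A : Type w}
    [EnrichedCategory V A] {W : EnrichedFunctor V A V} (hW : 𝔻.weights V A W) :
    commutingWeights V 𝔻 A W := by
  refine hW _ (isSaturated_commutingWeights 𝔻) ?_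
  rintro B _ W' ⟨i⟩
  · exact commutingWeights_conical hV _
  · exact commutingWeights_power ‹_›

end basic
end commuting

/-! ### Conical limits and limits in underlying categories -/

section underlying
variable {V : Type u} [Category.{w} V] [MonoidalCategory V] [SymmetricCategory V] [MonoidalClosed V]
  [HasLimits V] [HasColimits V]
variable {A : Type w} [EnrichedCategory V A] {K : Type u₂} [EnrichedCategory V K]

namespace WeightedCone

lemma toEnd_map_corep {W : EnrichedFunctor V A V} {S : EnrichedFunctor V A K} {L : K}
    (c : WeightedCone W S L) (X : K) : (c.map (corep X)).toEnd = c.comparison X := by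
  apply natObj.hom_ext
  intro a
  refine (toEnd_π (c.map (corep X)) a).trans ?_
  refine Eq.trans ?_ (natObj.lift_π _ (c.isNat_push X) a).symm
  exact congrArg lcur (unc_comp_corepMap X L (S.obj a) (c.app a))

/-- A cone is a limit precisely if all representables send it to a limit in `V`. -/
lemma isLimit_iff_corep {W : EnrichedFunctor V A V} {S : EnrichedFunctor V A K} {L : K}
    (c : WeightedCone W S L) : c.IsLimit ↔ ∀ X, (c.map (corep X)).IsLimit := by
  refine forall_congr' fun X => ?_
  rw [isLimit_iff_isIso_toEnd, toEnd_map_corep]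
  exact Iff.rfl

end WeightedCone

variable {J : Type w} [SmallCategory J] {S : J ⥤ ForgetEnrichment V K} {L : K}

lemma homTo_comp_eq {X Y Z : ForgetEnrichment V K} (f : X ⟶ Y) (g : Y ⟶ Z) :
    (λ_ (𝟙_ V)).hom ≫ ForgetEnrichment.homTo V (f ≫ g) =
      mulc (ForgetEnrichment.homTo V f) (ForgetEnrichment.homTo V g) := by
  rw [ForgetEnrichment.homTo_comp, Category.assoc, Iso.hom_inv_id_assoc]
  rfl

/-- A family of elements is `V`-natural for the conical weight precisely if it is a cone in the
underlying category. -/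
lemma conical_naturality_iff (s : ∀ j : FreeV V J, 𝟙_ V ⟶ hom V L ((freeLift S).obj j)) :
    (∀ j k : FreeV V J, mulc (s j) ((freeLift S).map j k) =
      unc ((conicalWeight J).map j k) ≫ s k) ↔
    ∀ {j k : J} (f : j ⟶ k),
      (ForgetEnrichment.homOf V (s (toFree V j)) : _ ⟶ S.obj j) ≫ S.map f =
        ForgetEnrichment.homOf V (s (toFree V k)) := by
  have key {j k : J} (f : j ⟶ k) :
      𝟙_ V ◁ freeArr V f ≫ mulc (s (toFree V j)) ((freeLift S).map (toFree V j) (toFree V k)) =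
        𝟙_ V ◁ freeArr V f ≫ unc ((conicalWeight J).map (toFree V j) (toFree V k)) ≫
          s (toFree V k) ↔
      (ForgetEnrichment.homOf V (s (toFree V j)) : _ ⟶ S.obj j) ≫ S.map f =
        ForgetEnrichment.homOf V (s (toFree V k)) := by
    have h1 : 𝟙_ V ◁ freeArr V f ≫
        mulc (s (toFree V j)) ((freeLift S).map (toFree V j) (toFree V k)) =
        (λ_ (𝟙_ V)).hom ≫ ForgetEnrichment.homTo V
          ((ForgetEnrichment.homOf V (s (toFree V j)) : _ ⟶ S.obj j) ≫ S.map f) := by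
      refine (comp_mulc_right _ _ _).symm.trans ?_
      refine (congrArg (mulc (s (toFree V j))) (freeArr_freeLift S f)).trans ?_
      exact (homTo_comp_eq _ _).symm
    have h2 : 𝟙_ V ◁ freeArr V f ≫ unc ((conicalWeight J).map (toFree V j) (toFree V k)) ≫
          s (toFree V k) = (λ_ (𝟙_ V)).hom ≫ s (toFree V k) := by
      rw [unitors_equal, ← unc_conicalWeight f]
      exact (Category.assoc _ _ _).symm
    exact ⟨fun h => (cancel_epi (λ_ (𝟙_ V)).hom).1 (h1.symm.trans (h.trans h2)),
      fun h => h1.trans ((congrArg (fun z => (λ_ (𝟙_ V)).hom ≫ ForgetEnrichment.homTo V z) h).trans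
        h2.symm)⟩
  constructor
  · intro h j k f
    exact (key f).1 (congrArg (𝟙_ V ◁ freeArr V f ≫ ·) (h (toFree V j) (toFree V k)))
  · intro h j k
    exact freeArr_ext (J := J) fun f => (key f).2 (h f)

/-- The cone in the underlying category that corresponds to a cone for the conical weight. -/
def coneOf (κ : WeightedCone (conicalWeight J) (freeLift S) L) : Cone S where
  pt := ForgetEnrichment.of V L
  π :=
    { app := fun j => ForgetEnrichment.homOf V (κ.app (toFree V j))
      naturality := fun _ _ f => (Category.id_comp _).trans
        ((conical_naturality_iff (S := S) κ.app).1 κ.naturality f).symm }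

/-- The cone for the conical weight that corresponds to a cone in the underlying category. -/
def ofCone (s : Cone S) :
    WeightedCone (conicalWeight J) (freeLift S) (ForgetEnrichment.to V s.pt) where
  app j := ForgetEnrichment.homTo V (s.π.app j)
  naturality := (conical_naturality_iff (S := S)
    fun j : J => ForgetEnrichment.homTo V (s.π.app j)).2 fun f => s.w f

/-- The image of a conical limit cone under a `V`-functor to `V` is a limit cone precisely if
it is one in the ordinary sense. -/
lemma isLimit_map_iff (κ : WeightedCone (conicalWeight J) (freeLift S) L)
    (H : EnrichedFunctor V K V) :
    (κ.map H).IsLimit ↔ Nonempty (IsLimit ((und H).mapCone (coneOf κ))) := by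
  rw [isLimit_iff_freeCone]
  let e : freeUnd ((freeLift S).comp V H) ⋙ und (EnrichedFunctor.id V V) ≅ S ⋙ und H :=
    NatIso.ofComponents (fun j => Iso.refl _) (fun {j k} f => by
      refine (Category.comp_id _).trans (Eq.trans ?_ (Category.id_comp _).symm)
      refine congrArg unname ((Category.comp_id _).trans ?_)
      refine (Category.assoc _ _ _).symm.trans ?_
      exact congrArg (· ≫ H.map _ _) (freeArr_freeLift S f))
  let e' : (Cone.postcompose e.hom).obj (freeCone (κ.map H)) ≅ (und H).mapCone (coneOf κ) :=
    Cone.ext (Iso.refl _) (fun j => by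
      refine (Category.comp_id _).trans (Eq.trans ?_ (Category.id_comp _).symm)
      rfl)
  constructor
  · rintro ⟨h⟩
    exact ⟨((IsLimit.postcomposeHomEquiv e _).symm h).ofIsoLimit e'⟩
  · rintro ⟨h⟩
    exact ⟨(IsLimit.postcomposeHomEquiv e _) (h.ofIsoLimit e'.symm)⟩

lemma element_comp_corepMap {a b c : K} (g : 𝟙_ V ⟶ hom V a b) (f : 𝟙_ V ⟶ hom V b c) :
    g ≫ (ρ_ _).inv ≫ mulc (𝟙 (hom V a b)) f = (λ_ (𝟙_ V)).inv ≫ mulc g f := by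
  rw [rightUnitor_inv_naturality_assoc, ← comp_mulc_left, Category.comp_id, unitors_inv_equal]

/-- Elements of hom-objects are the morphisms of the underlying category. -/
def coyonedaUnd (X : K) : und (corep X) ⋙ coyoneda.obj (op (𝟙_ V)) ≅
    coyoneda.obj (op (ForgetEnrichment.of V X)) :=
  NatIso.ofComponents (fun Z => Equiv.toIso (show (𝟙_ V ⟶ hom V X (ForgetEnrichment.to V Z)) ≃
      (ForgetEnrichment.of V X ⟶ Z) from Equiv.refl _)) (fun {Z Z'} f => by
    ext g
    refine (congrArg (g ≫ ·) (unname_comp_corepMap _ _ _ _)).trans ?_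
    refine (element_comp_corepMap g (ForgetEnrichment.homTo V f)).trans ?_
    exact (Category.assoc _ _ _).symm)

/-- A conical limit in `K` is a limit in the underlying category. -/
lemma isLimit_coneOf {κ : WeightedCone (conicalWeight J) (freeLift S) L} (h : κ.IsLimit) :
    Nonempty (IsLimit (coneOf κ)) :=
  ⟨coyonedaJointlyReflectsLimits _ _ fun X =>
    IsLimit.mapConeEquiv (coyonedaUnd (ForgetEnrichment.to V X.unop))
      (isLimitOfPreserves (coyoneda.obj (op (𝟙_ V)))
        ((isLimit_map_iff κ _).1 ((κ.isLimit_iff_corep).1 h (ForgetEnrichment.to V X.unop))).some)⟩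

end underlying

/-! ### The Yoneda embedding and colimits of representables -/

section representables
variable {V : Type u} [Category.{w} V] [MonoidalCategory V] [SymmetricCategory V] [MonoidalClosed V]
  [HasLimits V] [HasColimits V]
variable {B : Type w} [EnrichedCategory V B]

/-- The Yoneda embedding `Bᵒᵖ ⟶ [B, V]`, with values the representables `B(b, -)`. -/
def reps (V : Type u) [Category.{w} V] [MonoidalCategory V] [SymmetricCategory V] [MonoidalClosed V]
    [HasLimits V] [HasColimits V] (B : Type w) [EnrichedCategory V B] :
    EnrichedFunctor V Bᵒᵖ (EnrichedFunctor V B V) where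
  obj b := corep b.unop
  map b b' := yonedaMap b.unop (corep b'.unop)
  map_id b := by
    apply natObj.hom_ext
    intro d
    have h : yonedaMap b.unop (corep b.unop) ≫ natObj.π (corep b.unop) (corep b.unop) d =
      lcur (eComp V b.unop b.unop d) := (yonedaMap_π _ _ _).trans (congrArg lcur (unc_cur _))
    refine (Category.assoc _ _ _).trans ((congrArg (eId V b.unop ≫ ·) h).trans ?_)
    exact (eId_lcur_eComp b.unop d).trans (eId_π (corep b.unop) d).symm
  map_comp b b' b'' := by
    apply natObj.hom_ext
    intro d
    have h (c c' : B) : yonedaMap c (corep c') ≫ natObj.π (corep c) (corep c') d =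
        lcur (eComp V c' c d) := (yonedaMap_π _ _ _).trans (congrArg lcur (unc_cur _))
    refine Eq.trans ?_ (mulc_π (yonedaMap b.unop (corep b'.unop))
      (yonedaMap b'.unop (corep b''.unop)) d).symm
    refine (Category.assoc _ _ _).trans ?_
    refine (congrArg (_ ≫ ·) (h _ _)).trans (Eq.trans ?_ (congrArg₂ mulc (h _ _) (h _ _)).symm)
    exact eComp_lcur_eComp b.unop b'.unop b''.unop d

/-- The morphism `B(b, -) ⟶ G` that corresponds to an element of `G b`. -/
def yonedaArrow (b : B) (G : EnrichedFunctor V B V) (x : 𝟙_ V ⟶ G.obj b) :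
    ForgetEnrichment.of V (corep b) ⟶ ForgetEnrichment.of V G :=
  ForgetEnrichment.homOf V (x ≫ yonedaMap b G)

lemma yonedaArrow_bijective (b : B) (G : EnrichedFunctor V B V) :
    Function.Bijective (yonedaArrow b G) :=
  ⟨fun _ _ h => (cancel_mono (yonedaMap b G)).1 h,
    fun g => ⟨ForgetEnrichment.homTo V g ≫ inv (yonedaMap b G),
      (Category.assoc _ _ _).trans ((congrArg (ForgetEnrichment.homTo V g ≫ ·)
        (IsIso.inv_hom_id (yonedaMap b G))).trans (Category.comp_id _))⟩⟩

lemma yonedaArrow_comp (b : B) {G G' : EnrichedFunctor V B V} (x : 𝟙_ V ⟶ G.obj b)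
    (g : ForgetEnrichment.of V G ⟶ ForgetEnrichment.of V G') :
    yonedaArrow b G x ≫ g =
      yonedaArrow b G' (x ≫ unname (ForgetEnrichment.homTo V g ≫ natObj.π G G' b)) := by
  let g' : 𝟙_ V ⟶ hom V G G' := ForgetEnrichment.homTo V g
  have h1 : (λ_ (𝟙_ V)).inv ≫ mulc (x ≫ yonedaMap b G) g' =
      (x ≫ yonedaMap b G) ≫ unname (g' ≫ corepMap (corep b) G G') := by
    rw [unname_comp_corepMap]
    exact (element_comp_corepMap (x ≫ yonedaMap b G) g').symm
  have h2 : unname (g' ≫ natObj.π G G' b) ≫ yonedaMap b G' =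
      yonedaMap b G ≫ unname (g' ≫ corepMap (corep b) G G') := (isVNat_yonedaMap b).unname_comp g'
  have h3 : (x ≫ unname (g' ≫ natObj.π G G' b)) ≫ yonedaMap b G' =
      (λ_ (𝟙_ V)).inv ≫ mulc (x ≫ yonedaMap b G) g' := by
    rw [h1, Category.assoc, h2, Category.assoc]
  exact (Category.assoc _ _ _).trans h3.symm

lemma yonedaArrow_precomp {b b' : B} (G : EnrichedFunctor V B V) (f : 𝟙_ V ⟶ hom V b' b)
    (x : 𝟙_ V ⟶ G.obj b') :
    yonedaArrow b (corep b') f ≫ yonedaArrow b' G x =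
      yonedaArrow b G (x ≫ unname (f ≫ G.map b' b)) := by
  refine (yonedaArrow_comp b (G := corep b') f _).trans (congrArg (yonedaArrow b G) ?_)
  have h1 : (x ≫ yonedaMap b' G) ≫ natObj.π (corep b') G b = lcur (x ▷ _ ≫ unc (G.map b' b)) := by
    rw [Category.assoc, yonedaMap_π]
    exact comp_lcur x (unc (G.map b' b))
  refine (congrArg (fun z => f ≫ unname z) h1).trans ?_
  have h2 {X Y Z : V} (f : 𝟙_ V ⟶ X) (x : 𝟙_ V ⟶ Y) (m : X ⟶ hom V Y Z) :
      f ≫ unname (lcur (x ▷ _ ≫ unc m)) = x ≫ unname (f ≫ m) := by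
    rw [unname, unname, unc_lcur, unc_comp, rightUnitor_inv_naturality_assoc,
      rightUnitor_inv_naturality_assoc, ← BraidedCategory.braiding_naturality_right_assoc,
      ← MonoidalCategory.tensorHom_def_assoc, BraidedCategory.braiding_naturality_assoc,
      ← MonoidalCategory.tensorHom_def_assoc]
    simp [unitors_inv_equal]
  exact h2 f x (G.map b' b)

instance : (reps V B).forget.Faithful :=
  ⟨fun {X Y} _ _ h => (yonedaArrow_bijective (V := V) (ForgetEnrichment.to V X).unop
    (corep (ForgetEnrichment.to V Y).unop)).1 h⟩

instance : (reps V B).forget.Full :=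
  ⟨fun {X Y} g => (yonedaArrow_bijective (V := V) (ForgetEnrichment.to V X).unop
    (corep (ForgetEnrichment.to V Y).unop)).2 g⟩

/-- A diagram of representables comes from a diagram in `Bᵒᵖ`. -/
lemma exists_lift_reps {E : Type w} [SmallCategory E]
    (P : E ⥤ ForgetEnrichment V (EnrichedFunctor V B V))
    (hP : ∀ e, ∃ b : B, Nonempty (P.obj e ≅ ForgetEnrichment.of V (corep b))) :
    ∃ t : E ⥤ ForgetEnrichment V Bᵒᵖ, Nonempty (t ⋙ (reps V B).forget ≅ P) :=
  have h (e) : (reps V B).forget.essImage (P.obj e) :=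
    ⟨ForgetEnrichment.of V (op (hP e).choose), ⟨(hP e).choose_spec.some.symm⟩⟩
  ⟨_, ⟨Functor.essImage.liftFunctorCompIso P (reps V B).forget h⟩⟩

/-- A conical colimit in `K` is a colimit in the underlying category. -/
lemma IsConicalColimit.exists_isColimit {K : Type u₂} [EnrichedCategory V K] {E : Type w}
    [SmallCategory E] {P : E ⥤ ForgetEnrichment V K} {C : K} (h : IsConicalColimit P C) :
    ∃ s : Cocone P, s.pt = ForgetEnrichment.of V C ∧ Nonempty (IsColimit s) := by
  obtain ⟨κ, hκ⟩ := h
  obtain ⟨h1⟩ := isLimit_coneOf hκ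
  let s : Cone P.op := (forgetEnrichmentOppositeEquivalence.functor V K).mapCone (coneOf κ)
  have : (forgetEnrichmentOppositeEquivalence.functor V K).IsEquivalence :=
    (forgetEnrichmentOppositeEquivalence V K).isEquivalence_functor
  have hs : IsLimit s :=
    isLimitOfPreserves (forgetEnrichmentOppositeEquivalence.functor V K) h1
  exact ⟨s.unop, rfl, ⟨hs.unop⟩⟩

end representables

section weightedColimits
variable {V : Type u} [Category.{w} V] [MonoidalCategory V] [SymmetricCategory V] [MonoidalClosed V]
  [HasLimits V] [HasColimits V]
variable {B : Type w} [EnrichedCategory V B] (F : EnrichedFunctor V B V)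

/-- The coprojection `F b ⟶ [R b, F * R]` of a weighted colimit. -/
def colimι (R : EnrichedFunctor V Bᵒᵖ V) (b : B) : F.obj b ⟶ hom V (R.obj (op b)) (colimObj F R) :=
  (colimCone F R).app b

/-- `V`-naturality of the coprojection at `b` in the functor `R`. -/
lemma isNat_colimι (b : B) :
    IsNat (evalAt (op b)) (weightedColim F) (fun R => colimι F R b) := by
  intro R R'
  have h := mulc_colimMap F R R' b
  have h1 : mulc (colimι F R b) (colimMap F R R') = (β_ _ _).hom ≫
      mulc (K := Vᵒᵖ) (a := op (colimObj F R')) (b := op (colimObj F R)) (c := op (R.obj (op b)))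
        (colimMap F R R') (colimι F R b) :=
    mulc_unop (K := V) (colimι F R b) (colimMap F R R')
  have h2 : mulc (natObj.π R R' (op b)) (colimι F R' b) = (β_ _ _).hom ≫
      mulc (K := Vᵒᵖ) (a := op (colimObj F R')) (b := op (R'.obj (op b))) (c := op (R.obj (op b)))
        (colimι F R' b) (natObj.π R R' (op b)) :=
    mulc_unop (K := V) (natObj.π R R' (op b)) (colimι F R' b)
  refine h1.trans ((congrArg ((β_ _ _).hom ≫ ·) h).trans ?_)
  refine Eq.trans (SymmetricCategory.symmetry_assoc _ _ _) ?_
  refine Eq.trans ?_ (congrArg ((β_ _ _).hom ≫ ·) h2).symm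
  exact (SymmetricCategory.symmetry_assoc _ _ _).symm

/-- The map `R b ⟶ F * R` given by an element of `F b`. -/
def inj {b : B} (x : 𝟙_ V ⟶ F.obj b) (R : EnrichedFunctor V Bᵒᵖ V) :
    R.obj (op b) ⟶ colimObj F R :=
  unname (x ≫ colimι F R b)

lemma isVNat_inj {b : B} (x : 𝟙_ V ⟶ F.obj b) :
    IsVNat (evalAt (op b)) (weightedColim F) (inj F x) :=
  (isNat_iff_isVNat (F := evalAt (op b)) (G := weightedColim F) (fun R => x ≫ colimι F R b)).1
    ((isNat_colimι F b).precomp x)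

/-- `V`-naturality of the coprojections in `b`. -/
lemma mulc_colimι (R : EnrichedFunctor V Bᵒᵖ V) (b b' : B) :
    (β_ _ _).hom ≫ mulc (R.map (op b') (op b)) (colimι F R b) =
      unc (F.map b b') ≫ colimι F R b' :=
  (mulc_op (K := V) (a := op (colimObj F R)) (b := op (R.obj (op b))) (c := op (R.obj (op b')))
    (colimι F R b) (R.map (op b') (op b))).symm.trans ((colimCone F R).naturality b b')

lemma inj_precomp {b b' : B} (f : 𝟙_ V ⟶ hom V b b') (x : 𝟙_ V ⟶ F.obj b)
    (R : EnrichedFunctor V Bᵒᵖ V) :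
    unname (f ≫ R.map (op b') (op b)) ≫ inj F x R = inj F (x ≫ unname (f ≫ F.map b b')) R := by
  rw [inj, inj, ← unname_mulc]
  refine congrArg unname ?_
  refine (congrArg ((λ_ (𝟙_ V)).inv ≫ ·) (comp_mulc f x (R.map (op b') (op b))
    (colimι F R b))).trans ?_
  have h := mulc_colimι F R b b'
  rw [unname, unc_comp, Category.assoc, Category.assoc, Category.assoc, ← h]
  have h2 {X Y Z : V} (f : 𝟙_ V ⟶ X) (x : 𝟙_ V ⟶ Y) (m : X ⊗ Y ⟶ Z) :
      (λ_ (𝟙_ V)).inv ≫ (f ⊗ₘ x) ≫ m = x ≫ (ρ_ _).inv ≫ _ ◁ f ≫ (β_ _ _).hom ≫ m := by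
    rw [rightUnitor_inv_naturality_assoc, ← MonoidalCategory.tensorHom_def_assoc,
      BraidedCategory.braiding_naturality_assoc]
    simp
  exact h2 f x _

end weightedColimits

/-! ### Colimits weighted by a colimit of representables -/

section flat
variable {V : Type u} [Category.{w} V] [MonoidalCategory V] [SymmetricCategory V] [MonoidalClosed V]
  [HasLimits V] [HasColimits V]
variable {B : Type w} [EnrichedCategory V B] (F : EnrichedFunctor V B V)

/-- The functor `b ↦ [R b, Z]`. -/
def homInto (R : EnrichedFunctor V Bᵒᵖ V) (Z : V) : EnrichedFunctor V B V :=
  (rop R).comp V (corep (op Z))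

lemma name_comp_homInto_map (R : EnrichedFunctor V Bᵒᵖ V) {Z : V} {b b' : B}
    (f : 𝟙_ V ⟶ hom V b b') (u : R.obj (op b) ⟶ Z) :
    name u ≫ unname (f ≫ (homInto R Z).map b b') =
      name (unname (f ≫ R.map (op b') (op b)) ≫ u) := by
  apply unname_injective
  refine Eq.trans ?_ (unname_name _).symm
  let r : 𝟙_ V ⟶ hom V (R.obj (op b')) (R.obj (op b)) := f ≫ R.map (op b') (op b)
  have h1 : f ≫ (homInto R Z).map b b' =
      r ≫ corepMap (K := Vᵒᵖ) (op Z) (op (R.obj (op b))) (op (R.obj (op b'))) :=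
    (Category.assoc _ _ _).symm
  let n : 𝟙_ V ⟶ hom V (op Z) (op (R.obj (op b))) := name u
  let r' : 𝟙_ V ⟶ hom V (op (R.obj (op b))) (op (R.obj (op b'))) := r
  have h2 : n ≫ unname (r' ≫ corepMap (op Z) (op (R.obj (op b))) (op (R.obj (op b')))) =
      (λ_ (𝟙_ V)).inv ≫ mulc n r' :=
    (congrArg (n ≫ ·) (unname_comp_corepMap (op Z) (op (R.obj (op b))) (op (R.obj (op b')))
      r')).trans (element_comp_corepMap n r')
  have h3 : mulc n r' = (β_ _ _).hom ≫ mulc r (name u) := mulc_op (K := V) n r'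
  refine (congrArg (fun z => unname (name u ≫ unname z)) h1).trans ?_
  refine (congrArg unname (h2.trans (congrArg ((λ_ (𝟙_ V)).inv ≫ ·) h3))).trans ?_
  have h4 : (λ_ (𝟙_ V)).inv ≫ (β_ (𝟙_ V) (𝟙_ V)).hom ≫ mulc r (name u) =
    (λ_ (𝟙_ V)).inv ≫ mulc r (name u) := by simp [unitors_inv_equal]
  refine (congrArg unname h4).trans ((unname_mulc _ _).trans ?_)
  rw [unname_name]

/-- The universal property of `F * R`, for maps into `Z`. -/
def descEquiv (R : EnrichedFunctor V Bᵒᵖ V) (Z : V) : (colimObj F R ⟶ Z) ≃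
    (ForgetEnrichment.of V F ⟶ ForgetEnrichment.of V (homInto R Z)) :=
  let i := @asIso _ _ _ _ ((colimCone F R).comparison (op Z)) (colimCone_isLimit F R (op Z))
  { toFun := fun φ => ForgetEnrichment.homOf V (name φ ≫ i.hom)
    invFun := fun g => unname (ForgetEnrichment.homTo V g ≫ i.inv)
    left_inv := fun φ => by
      have h : (name φ ≫ i.hom) ≫ i.inv = name φ := (Category.assoc _ _ _).trans
        ((congrArg (name φ ≫ ·) i.hom_inv_id).trans (Category.comp_id _))
      exact (congrArg unname h).trans (unname_name φ)
    right_inv := fun g => by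
      have h : (ForgetEnrichment.homTo V g ≫ i.inv) ≫ i.hom = ForgetEnrichment.homTo V g :=
        (Category.assoc _ _ _).trans
          ((congrArg (ForgetEnrichment.homTo V g ≫ ·) i.inv_hom_id).trans (Category.comp_id _))
      exact (congrArg (· ≫ i.hom) (name_unname _)).trans h }

lemma yonedaArrow_descEquiv (R : EnrichedFunctor V Bᵒᵖ V) {Z : V} {b : B} (x : 𝟙_ V ⟶ F.obj b)
    (φ : colimObj F R ⟶ Z) : yonedaArrow b F x ≫ descEquiv F R Z φ =
      yonedaArrow b (homInto R Z) (name (inj F x R ≫ φ)) := by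
  refine (yonedaArrow_comp b x _).trans (congrArg (yonedaArrow b (homInto R Z)) ?_)
  apply unname_injective
  refine Eq.trans ?_ (unname_name _).symm
  let ψ : 𝟙_ V ⟶ hom V (op Z) (op (colimObj F R)) := name φ
  let k : F.obj b ⟶ hom V (op (colimObj F R)) (op (R.obj (op b))) := (colimCone F R).app b
  have h1 : (ψ ≫ (colimCone F R).comparison (op Z)) ≫ natObj.π F (homInto R Z) b =
      lcur (mulc ψ k) := by
    refine (Category.assoc _ _ _).trans ?_
    refine (congrArg (ψ ≫ ·) (natObj.lift_π _ ((colimCone F R).isNat_push (op Z)) b)).trans ?_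
    refine (comp_lcur ψ (mulc (𝟙 _) k)).trans ?_
    rw [← comp_mulc_left, Category.comp_id]
  have h2 : x ≫ unname (lcur (mulc ψ k)) = (λ_ (𝟙_ V)).inv ≫ mulc ψ (x ≫ k) := by
    rw [unname, unc_lcur, rightUnitor_inv_naturality_assoc,
      BraidedCategory.braiding_naturality_left_assoc, comp_mulc_right]
    simp [unitors_inv_equal]
  have h3 : mulc ψ (x ≫ k) = (β_ _ _).hom ≫ mulc (x ≫ colimι F R b) (name φ) :=
    mulc_op (K := V) ψ (x ≫ k)
  refine (congrArg (fun z => unname (x ≫ unname z)) h1).trans ?_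
  refine (congrArg unname (h2.trans (congrArg ((λ_ (𝟙_ V)).inv ≫ ·) h3))).trans ?_
  have h4 : (λ_ (𝟙_ V)).inv ≫ (β_ (𝟙_ V) (𝟙_ V)).hom ≫ mulc (x ≫ colimι F R b) (name φ) =
    (λ_ (𝟙_ V)).inv ≫ mulc (x ≫ colimι F R b) (name φ) := by simp [unitors_inv_equal]
  refine (congrArg unname h4).trans ((unname_mulc _ _).trans ?_)
  rw [unname_name]
  rfl

variable {F} {E : Type w} [SmallCategory E] {t : E ⥤ ForgetEnrichment V Bᵒᵖ}

/-- The object of `B` that corresponds to the value of a diagram in `Bᵒᵖ`. -/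
abbrev obB (t : E ⥤ ForgetEnrichment V Bᵒᵖ) (e : E) : B := (ForgetEnrichment.to V (t.obj e)).unop

/-- The action of a diagram in `Bᵒᵖ` on morphisms, as an element of a hom-object of `B`. -/
abbrev mapB (t : E ⥤ ForgetEnrichment V Bᵒᵖ) {e e' : E} (f : e ⟶ e') :
    𝟙_ V ⟶ hom V (obB t e') (obB t e) := ForgetEnrichment.homTo V (t.map f)

/-- A compatible family of elements of `F`, as a cocone under a diagram of representables. -/
def elementCocone (ξ : ∀ e, 𝟙_ V ⟶ F.obj (obB t e))
    (hξ : ∀ {e e' : E} (f : e ⟶ e'), ξ e' ≫ unname (mapB t f ≫ F.map _ _) = ξ e) :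
    Cocone (t ⋙ (reps V B).forget) where
  pt := ForgetEnrichment.of V F
  ι :=
    { app := fun e => yonedaArrow (obB t e) F (ξ e)
      naturality := fun e e' f => by
        refine Eq.trans ?_ (Category.comp_id _).symm
        exact (yonedaArrow_precomp F (mapB t f) (ξ e')).trans (congrArg _ (hξ f)) }

/-- By the Yoneda lemma, every cocone under a diagram of representables is given by elements. -/
lemma exists_elementCocone (s : Cocone (t ⋙ (reps V B).forget)) :
    ∃ (ξ : ∀ e, 𝟙_ V ⟶ (ForgetEnrichment.to V s.pt).obj (obB t e))
      (hξ : ∀ {e e' : E} (f : e ⟶ e'),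
        ξ e' ≫ unname (mapB t f ≫ (ForgetEnrichment.to V s.pt).map _ _) = ξ e),
    Nonempty (elementCocone ξ hξ ≅ s) := by
  choose ξ hξ using fun e =>
    (yonedaArrow_bijective (obB t e) (ForgetEnrichment.to V s.pt)).2 (s.ι.app e)
  refine ⟨ξ, fun {e e'} f => ?_, ⟨Cocone.ext (Iso.refl _) fun e =>
    (Category.comp_id _).trans (hξ e)⟩⟩
  apply (yonedaArrow_bijective (obB t e) (ForgetEnrichment.to V s.pt)).1
  refine (yonedaArrow_precomp _ (mapB t f) (ξ e')).symm.trans ?_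
  refine (congrArg (yonedaArrow _ _ (mapB t f) ≫ ·) (hξ e')).trans (Eq.trans ?_ (hξ e).symm)
  exact s.w f

/-- The induced cocone under the values of `R`, with vertex `F * R`. -/
def injCocone (ξ : ∀ e, 𝟙_ V ⟶ F.obj (obB t e))
    (hξ : ∀ {e e' : E} (f : e ⟶ e'), ξ e' ≫ unname (mapB t f ≫ F.map _ _) = ξ e)
    (R : EnrichedFunctor V Bᵒᵖ V) : Cocone (t ⋙ und R) where
  pt := colimObj F R
  ι :=
    { app := fun e => inj F (ξ e) R
      naturality := fun e e' f => by
        refine Eq.trans ?_ (Category.comp_id _).symm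
        exact (inj_precomp F (mapB t f) (ξ e') R).trans (congrArg (fun z => inj F z R) (hξ f)) }

/-- If `F` is a colimit of representables `B(t e, -)`, then `F * R` is the colimit of the
`R (t e)`. -/
lemma isColimit_injCocone {ξ : ∀ e, 𝟙_ V ⟶ F.obj (obB t e)}
    {hξ : ∀ {e e' : E} (f : e ⟶ e'), ξ e' ≫ unname (mapB t f ≫ F.map _ _) = ξ e}
    (h : IsColimit (elementCocone ξ hξ)) (R : EnrichedFunctor V Bᵒᵖ V) :
    Nonempty (IsColimit (injCocone ξ hξ R)) := by
  have key (s : Cocone (t ⋙ und R)) : ∃! φ : colimObj F R ⟶ s.pt,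
      ∀ e, inj F (ξ e) R ≫ φ = s.ι.app e := by
    -- Maps `F * R ⟶ s.pt` are maps `F ⟶ [R -, s.pt]`, and these are cocones of elements of
    -- `[R -, s.pt]`.
    let G := homInto R s.pt
    let u (e : E) : R.obj (op (obB t e)) ⟶ s.pt := s.ι.app e
    have hu {e e' : E} (f : e ⟶ e') : name (u e') ≫ unname (mapB t f ≫ G.map _ _) = name (u e) :=
      (name_comp_homInto_map R (mapB t f) (u e')).trans (congrArg name (s.w f))
    let c : Cocone (t ⋙ (reps V B).forget) :=
      elementCocone (F := G) (fun e => name (u e)) hu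
    have e1 (φ : colimObj F R ⟶ s.pt) (e : E) : inj F (ξ e) R ≫ φ = u e ↔
        (elementCocone ξ hξ).ι.app e ≫ descEquiv F R s.pt φ = c.ι.app e := by
      have h1 : (elementCocone ξ hξ).ι.app e ≫ descEquiv F R s.pt φ =
          yonedaArrow (obB t e) G (name (inj F (ξ e) R ≫ φ)) :=
        yonedaArrow_descEquiv F R (ξ e) φ
      rw [h1]
      refine Iff.trans ?_ (yonedaArrow_bijective (obB t e) G).1.eq_iff.symm
      exact ⟨fun h => congrArg name h, fun h =>
        (unname_name _).symm.trans ((congrArg unname h).trans (unname_name _))⟩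
    refine ⟨(descEquiv F R s.pt).symm (h.desc c), fun e => ?_, fun φ hφ => ?_⟩
    · refine (e1 _ e).2 ?_
      exact (congrArg ((elementCocone ξ hξ).ι.app e ≫ ·)
        (Equiv.apply_symm_apply (descEquiv F R s.pt) _)).trans (h.fac c e)
    · exact (Equiv.eq_symm_apply _).2 (h.uniq c _ fun e => (e1 φ e).1 (hφ e))
  choose d hd hu using key
  exact ⟨{ desc := d, fac := hd, uniq := fun s φ hφ => hu s φ hφ }⟩

variable {A : Type w} [EnrichedCategory V A] {K : Type u₂} [EnrichedCategory V K]

/-- The comparison of a cone in `V` with the end is natural in the diagram. -/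
lemma IsVNat.comp_toEnd_eq {W S S' : EnrichedFunctor V A V} {L L' : V}
    {n : ∀ a, S.obj a ⟶ S'.obj a} (h : IsVNat S S' n) (c : WeightedCone W S L)
    (c' : WeightedCone W S' L') (l : L ⟶ L')
    (hl : ∀ a, unc (c.app a) ≫ n a = l ▷ W.obj a ≫ unc (c'.app a)) :
    l ≫ c'.toEnd = c.toEnd ≫ (und (corep W)).map h.arrow := by
  apply natObj.hom_ext
  intro a
  have h2 : (und (corep W)).map h.arrow ≫ natObj.π W S' a =
      (ρ_ _).inv ≫ mulc (natObj.π W S a) (name (n a)) :=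
    (natObj_map_π W h.arrow a).trans
      (congrArg (fun z => (ρ_ _).inv ≫ mulc (natObj.π W S a) (name z)) (h.map_arrow a))
  refine (Category.assoc _ _ _).trans ?_
  refine Eq.trans ?_ (Category.assoc _ _ _).symm
  refine Eq.trans ?_ (congrArg (c.toEnd ≫ ·) h2).symm
  rw [rightUnitor_inv_naturality_assoc, ← comp_mulc_left, c.toEnd_π, c'.toEnd_π]
  apply lunc_injective
  rw [lunc_mulc_name, comp_lcur, lunc_lcur, lunc_lcur, hl]

/-- The comparison of a cone with the end is natural in the functor that is applied to the cone. -/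
lemma IsVNat.comp_toEnd {W : EnrichedFunctor V A V} {S : EnrichedFunctor V A K} {L : K}
    (c : WeightedCone W S L) {H H' : EnrichedFunctor V K V} {n : ∀ k, H.obj k ⟶ H'.obj k}
    (h : IsVNat H H' n) : n L ≫ (c.map H').toEnd =
      (c.map H).toEnd ≫ (und (corep W)).map (h.precomp S).arrow := by
  refine (h.precomp S).comp_toEnd_eq (c.map H) (c.map H') (n L) fun a => ?_
  refine (congrArg (· ≫ n (S.obj a)) (unc_comp (c.app a) (H.map L (S.obj a)))).trans ?_
  refine Eq.trans ?_ (congrArg (n L ▷ W.obj a ≫ ·) (unc_comp (c.app a) (H'.map L (S.obj a)))).symm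
  rw [Category.assoc, h, whisker_exchange_assoc]

end flat

/-! ### Filtered colimits of representables are flat -/

section flat
variable {V : Type u} [Category.{w} V] [MonoidalCategory V] [SymmetricCategory V] [MonoidalClosed V]
  [HasLimits V] [HasColimits V]
variable {B : Type w} [EnrichedCategory V B] {F : EnrichedFunctor V B V}
variable {A : Type w} [EnrichedCategory V A]

/-- Evaluation is `V`-natural in the object at which one evaluates. -/
lemma isVNat_eval {b b' : B} (g : 𝟙_ V ⟶ hom V b b') :
    IsVNat (evalAt b) (evalAt b')
      (fun R : EnrichedFunctor V B V => unname (g ≫ R.map b b')) := by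
  refine (isNat_iff_isVNat (F := evalAt b) (G := evalAt b')
    (fun R : EnrichedFunctor V B V => g ≫ R.map b b')).1 (IsNat.precomp ?_ g)
  intro R R'
  have h := natObj.isNat R R' b b'
  refine Eq.trans ?_ (congrArg ((β_ _ _).hom ≫ ·) h).symm
  exact (SymmetricCategory.symmetry_assoc _ _ _).symm

lemma transpose_forget_map (S : EnrichedFunctor V A (EnrichedFunctor V B V))
    {b b' : ForgetEnrichment V B} (g : b ⟶ b') (a : A) :
    (und (evalAt a)).map ((transpose S).forget.map g) = (und (S.obj a)).map g :=
  congrArg unname ((Category.assoc _ _ _).trans (congrArg (ForgetEnrichment.homTo V g ≫ ·)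
    (transpose_map_π S (ForgetEnrichment.to V b) (ForgetEnrichment.to V b') a)))

lemma isVNat_eval_arrow (S : EnrichedFunctor V A (EnrichedFunctor V B V))
    {b b' : ForgetEnrichment V B} (g : b ⟶ b') :
    ((isVNat_eval (ForgetEnrichment.homTo V g)).precomp S).arrow = (transpose S).forget.map g :=
  arrow_ext fun a => (IsVNat.map_arrow _ a).trans (transpose_forget_map S g a).symm

/-- The comparison `m` of a cone with the cone `θ`, seen in the end. -/
lemma toEnd_eq_of_comparison {W : EnrichedFunctor V A V} {S : EnrichedFunctor V A V} {L Q : V}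
    {c : WeightedCone W S L} {θ : WeightedCone W S Q} {m : L ⟶ Q}
    (h : ∀ a, unc (c.app a) = m ▷ W.obj a ≫ unc (θ.app a)) : m ≫ θ.toEnd = c.toEnd := by
  apply natObj.hom_ext
  intro a
  rw [Category.assoc, WeightedCone.toEnd_π, WeightedCone.toEnd_π, comp_lcur, h a]

variable {E : Type w} [SmallCategory E] {t : E ⥤ ForgetEnrichment V Bᵒᵖ}

/-- The cocone with vertex `a ↦ F * S a` under the diagram of the functors `a ↦ S a (t e)`. -/
def transposeCocone (ξ : ∀ e, 𝟙_ V ⟶ F.obj (obB t e))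
    (hξ : ∀ {e e' : E} (f : e ⟶ e'), ξ e' ≫ unname (mapB t f ≫ F.map _ _) = ξ e)
    (S : EnrichedFunctor V A (EnrichedFunctor V Bᵒᵖ V)) :
    Cocone (t ⋙ (transpose S).forget) where
  pt := ForgetEnrichment.of V (S.comp V (weightedColim F))
  ι :=
    { app := fun e => ((isVNat_inj F (ξ e)).precomp S).arrow
      naturality := fun e e' f => by
        refine Eq.trans (arrow_ext fun a => ?_) (Category.comp_id _).symm
        refine ((und (evalAt a)).map_comp _ _).trans ?_
        refine (congrArg₂ (· ≫ ·) (transpose_forget_map S (t.map f) a)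
          (((isVNat_inj F (ξ e')).precomp S).map_arrow a)).trans ?_
        refine Eq.trans ?_ (((isVNat_inj F (ξ e)).precomp S).map_arrow a).symm
        exact (injCocone ξ hξ (S.obj a)).w f }

/-- A colimit of representables over `E` is flat with respect to each weight whose limits commute
with colimits over `E`. -/
theorem isIso_comparison_of_isColimit {𝔻 : Doctrine.{w}} (hE : 𝔻.IsFiltered E)
    {ξ : ∀ e, 𝟙_ V ⟶ F.obj (obB t e)}
    {hξ : ∀ {e e' : E} (f : e ⟶ e'), ξ e' ≫ unname (mapB t f ≫ F.map _ _) = ξ e}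
    (h : IsColimit (elementCocone ξ hξ)) {W : EnrichedFunctor V A V}
    (hW : commutingWeights V 𝔻 A W) {S : EnrichedFunctor V A (EnrichedFunctor V Bᵒᵖ V)}
    {L : EnrichedFunctor V Bᵒᵖ V} (c : WeightedCone W S L)
    (hc : ∀ b : Bᵒᵖ, (c.map (evalAt b)).IsLimit) :
    IsIso (c.map (weightedColim F)).toEnd := by
  have h1 (a : A) : Nonempty (IsColimit ((und (evalAt a)).mapCocone (transposeCocone ξ hξ S))) := by
    obtain ⟨h2⟩ := isColimit_injCocone h (S.obj a)
    let e1 : (t ⋙ (transpose S).forget) ⋙ und (evalAt a) ≅ t ⋙ und (S.obj a) :=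
      NatIso.ofComponents (fun e => Iso.refl _) (fun f =>
        (Category.comp_id _).trans ((transpose_forget_map S (t.map f) a).trans
          (Category.id_comp _).symm))
    let e2 : (Cocone.precompose e1.hom).obj (injCocone ξ hξ (S.obj a)) ≅
        (und (evalAt a)).mapCocone (transposeCocone ξ hξ S) :=
      Cocone.ext (Iso.refl _) fun e => (Category.comp_id _).trans ((Category.id_comp _).trans
        (((isVNat_inj F (ξ e)).precomp S).map_arrow a).symm)
    exact ⟨((IsColimit.precomposeHomEquiv e1 _).symm h2).ofIsoColimit e2⟩
  obtain ⟨h2⟩ := hW E hE _ (transposeCocone ξ hξ S) h1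
  obtain ⟨h3⟩ := isColimit_injCocone h L
  -- Since `c` is a pointwise limit, `δ` identifies `L (t e)` with `{W, S - (t e)}`.
  let δ : t ⋙ und L ≅ (t ⋙ (transpose S).forget) ⋙ und (corep W) :=
    NatIso.ofComponents
      (fun e => @asIso _ _ _ _ (c.map (evalAt (ForgetEnrichment.to V (t.obj e)))).toEnd
        ((WeightedCone.isLimit_iff_isIso_toEnd _).1 (hc _)))
      (fun f => ((isVNat_eval (ForgetEnrichment.homTo V (t.map f))).comp_toEnd c).trans
        (congrArg (fun z => _ ≫ (und (corep W)).map z) (isVNat_eval_arrow S (t.map f))))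
  let φ : injCocone ξ hξ L ⟶ (Cocone.precompose δ.hom).obj
      ((und (corep W)).mapCocone (transposeCocone ξ hξ S)) :=
    { hom := (c.map (weightedColim F)).toEnd
      w := fun e => (isVNat_inj F (ξ e)).comp_toEnd c }
  have h4 : IsIso φ := IsColimit.hom_isIso h3 ((IsColimit.precomposeHomEquiv δ _).symm h2) φ
  exact inferInstanceAs (IsIso ((Cocone.forget _).map φ))

/-- A `𝔻`-filtered colimit of representables is flat for the weights generated by `𝔻`, since all of
these commute with `𝔻`-filtered colimits. -/
theorem Doctrine.IsFilteredColimitOfRepresentables.isFlat {𝔻 : Doctrine.{w}}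
    (hV : 𝔻.IsLocallyPresentable V) (h : 𝔻.IsFilteredColimitOfRepresentables F) :
    IsFlat (𝔻.weights V) F := by
  obtain ⟨E, _, P, hE, hP, hκ⟩ := h
  obtain ⟨t, ⟨i⟩⟩ := exists_lift_reps P hP
  obtain ⟨s, hs, ⟨hs'⟩⟩ := hκ.exists_isColimit
  obtain rfl : F = ForgetEnrichment.to V s.pt := hs.symm
  obtain ⟨ξ, hξ, ⟨e⟩⟩ := exists_elementCocone ((Cocone.precompose i.hom).obj s)
  have h1 := ((IsColimit.precomposeHomEquiv i s).symm hs').ofIsoColimit e.symm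
  intro A _ W S L c Q θ m hW hc hθ hm
  have h2 := isIso_comparison_of_isColimit hE h1 (weights_le_commutingWeights hV hW) c hc
  have h3 := toEnd_eq_of_comparison hm
  have h4 := (WeightedCone.isLimit_iff_isIso_toEnd θ).1 hθ
  have h5 : IsIso (m ≫ θ.toEnd) := by
    rw [h3]
    exact h2
  exact IsIso.of_isIso_comp_right m θ.toEnd

end flat

/-! ### Flat functors are continuous -/

section continuous
variable {V : Type u} [Category.{w} V] [MonoidalCategory V] [SymmetricCategory V] [MonoidalClosed V]
  [HasLimits V] [HasColimits V]

/-- Limit cones in `V` are stable under isomorphism. -/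
lemma IsVNat.isLimit_iff {A : Type w} [EnrichedCategory V A] {W S S' : EnrichedFunctor V A V}
    {L L' : V} {n : ∀ a, S.obj a ⟶ S'.obj a} (h : IsVNat S S' n) (hn : ∀ a, IsIso (n a))
    (c : WeightedCone W S L) (c' : WeightedCone W S' L') (l : L ⟶ L') (_ : IsIso l)
    (hl : ∀ a, unc (c.app a) ≫ n a = l ▷ W.obj a ≫ unc (c'.app a)) :
    c.IsLimit ↔ c'.IsLimit := by
  have hinv := h.inv
  have hi : h.arrow ≫ hinv.arrow = 𝟙 _ := arrow_ext fun a => by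
    refine ((und (evalAt a)).map_comp _ _).trans ?_
    refine (congrArg₂ (· ≫ ·) (h.map_arrow a) (hinv.map_arrow a)).trans ?_
    exact (IsIso.hom_inv_id (n a)).trans ((und (evalAt a)).map_id (ForgetEnrichment.of V S)).symm
  have hi' : hinv.arrow ≫ h.arrow = 𝟙 _ := arrow_ext fun a => by
    refine ((und (evalAt a)).map_comp _ _).trans ?_
    refine (congrArg₂ (· ≫ ·) (hinv.map_arrow a) (h.map_arrow a)).trans ?_
    exact (IsIso.inv_hom_id (n a)).trans ((und (evalAt a)).map_id (ForgetEnrichment.of V S')).symm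
  let i : ForgetEnrichment.of V S ≅ ForgetEnrichment.of V S' := ⟨h.arrow, hinv.arrow, hi, hi'⟩
  let j := (und (corep W)).mapIso i
  have h1 : l ≫ c'.toEnd = c.toEnd ≫ j.hom := h.comp_toEnd_eq c c' l hl
  rw [WeightedCone.isLimit_iff_isIso_toEnd, WeightedCone.isLimit_iff_isIso_toEnd]
  constructor
  · intro _
    have h2 : c'.toEnd = CategoryTheory.inv l ≫ c.toEnd ≫ j.hom :=
      (IsIso.eq_inv_comp l).2 h1
    rw [h2]
    exact IsIso.comp_isIso' inferInstance (IsIso.comp_isIso' ‹_› (Iso.isIso_hom j))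
  · intro _
    have h2 : c.toEnd = l ≫ c'.toEnd ≫ j.inv := by
      refine Eq.trans ?_ (Category.assoc _ _ _)
      refine Eq.trans ?_ (congrArg (· ≫ j.inv) h1).symm
      refine Eq.trans ?_ (Category.assoc _ _ _).symm
      exact (Category.comp_id _).symm.trans (congrArg (c.toEnd ≫ ·) j.hom_inv_id.symm)
    rw [h2]
    exact IsIso.comp_isIso' inferInstance (IsIso.comp_isIso' ‹_› (Iso.isIso_inv j))

variable {T : Type w} [EnrichedCategory V T] (F : EnrichedFunctor V T V)

/-- For flat `F`, the `V`-functor `F * -` preserves pointwise limits with weight in `Φ`. -/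
lemma IsFlat.isLimit_map {F : EnrichedFunctor V T V} {Φ : WeightClass V} (hF : IsFlat Φ F)
    {A : Type w} [EnrichedCategory V A] {W : EnrichedFunctor V A V} (hW : Φ A W)
    {S : EnrichedFunctor V A (EnrichedFunctor V Tᵒᵖ V)} {L : EnrichedFunctor V Tᵒᵖ V}
    (c : WeightedCone W S L) (hc : ∀ b : Tᵒᵖ, (c.map (evalAt b)).IsLimit) :
    (c.map (weightedColim F)).IsLimit := by
  rw [WeightedCone.isLimit_iff_isIso_toEnd]
  refine hF A W S L c _ (WeightedCone.canonical W _) _ hW hc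
    (WeightedCone.canonical_isLimit W _) fun a => ?_
  rw [WeightedCone.unc_canonical_app, ← lunc_comp, WeightedCone.toEnd_π, lunc_lcur]

/-- The morphism of `Vᵒᵖ` that corresponds to a morphism of `V`, as an element of a hom-object. -/
def opName {C Z : V} (φ : C ⟶ Z) : 𝟙_ V ⟶ hom V (op Z) (op C) := name φ

/-- Composition with a leg of the colimit cone, computed in `V` instead of `Vᵒᵖ`. -/
lemma mulc_colimCone_app (R : EnrichedFunctor V Tᵒᵖ V) {Z : V} (φ : colimObj F R ⟶ Z) (b : T) :
    R.obj (op b) ◁ (λ_ _).inv ≫ unc (A := R.obj (op b)) (B := Z)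
      (mulc (K := Vᵒᵖ) (c := (rop R).obj b) (opName φ) ((colimCone F R).app b)) =
      unc (colimι F R b) ≫ φ := by
  have h1 : mulc (K := Vᵒᵖ) (c := (rop R).obj b) (opName φ) ((colimCone F R).app b) =
      (β_ _ _).hom ≫ mulc (colimι F R b) (name φ) :=
    mulc_op (K := V) _ _
  refine (congrArg (fun z => R.obj (op b) ◁ (λ_ _).inv ≫ unc z) h1).trans ?_
  refine Eq.trans ?_ (unc_mulc_name (colimι F R b) φ)
  rw [unc_comp, ← MonoidalCategory.whiskerLeft_comp_assoc]
  simp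

lemma colimι_hom_ext {R : EnrichedFunctor V Tᵒᵖ V} {Z : V} {φ ψ : colimObj F R ⟶ Z}
    (h : ∀ b, unc (colimι F R b) ≫ φ = unc (colimι F R b) ≫ ψ) : φ = ψ := by
  have h1 : opName φ = opName ψ := eq_of_mulc_colimCone F R (X := op Z) fun b => by
    have h2 := (mulc_colimCone_app F R φ b).trans ((h b).trans (mulc_colimCone_app F R ψ b).symm)
    exact unc_injective ((cancel_epi (R.obj (op b) ◁ (λ_ (F.obj b)).inv)).1 h2)
  exact (unname_name φ).symm.trans ((congrArg unname h1).trans (unname_name ψ))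

/-- The maps out of `F * R` that the universal property provides. -/
lemma exists_colimDesc (R : EnrichedFunctor V Tᵒᵖ V) {Z : V}
    {n : ∀ b, F.obj b ⟶ hom V (R.obj (op b)) Z} (hn : IsVNat F (homInto R Z) n) :
    ∃ φ : colimObj F R ⟶ Z, ∀ b, unc (colimι F R b) ≫ φ = unc (n b) := by
  refine ⟨(descEquiv F R Z).symm hn.arrow, fun b => ?_⟩
  set φ := (descEquiv F R Z).symm hn.arrow with hφ
  have h1 : descEquiv F R Z φ = hn.arrow := Equiv.apply_symm_apply _ _
  let ψ : 𝟙_ V ⟶ hom V (op Z) (op (colimObj F R)) := opName φ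
  let k : F.obj b ⟶ hom V (op (colimObj F R)) (op (R.obj (op b))) := (colimCone F R).app b
  have h2 : (ψ ≫ (colimCone F R).comparison (op Z)) ≫ natObj.π F (homInto R Z) b =
      lcur (mulc ψ k) := by
    refine (Category.assoc _ _ _).trans ?_
    refine (congrArg (ψ ≫ ·) (natObj.lift_π _ ((colimCone F R).isNat_push (op Z)) b)).trans ?_
    refine (comp_lcur ψ (mulc (𝟙 _) k)).trans ?_
    rw [← comp_mulc_left, Category.comp_id]
  have h3 : ForgetEnrichment.homTo V hn.arrow ≫ natObj.π F (homInto R Z) b = name (n b) :=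
    natObj.lift_π (F := F) (G := homInto R Z) (fun b => name (n b))
      ((isNat_name_iff (F := F) (G := homInto R Z) n).2 hn) b
  have h4 : lcur (mulc ψ k) = name (n b) := h2.symm.trans
    ((congrArg (fun z => ForgetEnrichment.homTo V z ≫ natObj.π F (homInto R Z) b) h1).trans h3)
  have h5 : mulc ψ k = (λ_ (F.obj b)).hom ≫ n b := by
    refine (lunc_lcur (mulc ψ k)).symm.trans ?_
    exact (congrArg lunc h4).trans (lunc_name (n b))
  refine (mulc_colimCone_app F R φ b).symm.trans ?_
  refine (congrArg (fun z => R.obj (op b) ◁ (λ_ _).inv ≫ unc z) h5).trans ?_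
  refine (congrArg (_ ≫ ·) (unc_comp (λ_ (F.obj b)).hom (n b))).trans ?_
  rw [← MonoidalCategory.whiskerLeft_comp_assoc]
  simp

/-- The Yoneda embedding `T ⟶ [Tᵒᵖ, V]`. -/
def yonedaV (V : Type u) [Category.{w} V] [MonoidalCategory V] [SymmetricCategory V]
    [MonoidalClosed V] [HasLimits V] [HasColimits V] (T : Type w) [EnrichedCategory V T] :
    EnrichedFunctor V T (EnrichedFunctor V Tᵒᵖ V) :=
  (opop T).comp V (reps V Tᵒᵖ)

lemma yonedaV_map_π (t t' b : T) :
    (yonedaV V T).map t t' ≫ natObj.π (corep (op t)) (corep (op t')) (op b) =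
      corepMap b t t' := by
  refine (congrArg (· ≫ natObj.π (corep (op t)) (corep (op t')) (op b))
    (Category.id_comp (yonedaMap (op t) (corep (op t'))))).trans ?_
  refine (yonedaMap_π (op t) (corep (op t')) (op b)).trans ?_
  exact (congrArg lcur (unc_cur _)).trans (lcur_eComp_op b t t')

/-- The Yoneda embedding preserves limits. -/
lemma isLimit_map_yonedaV {A : Type w} [EnrichedCategory V A] {W : EnrichedFunctor V A V}
    {S : EnrichedFunctor V A T} {L : T} {c : WeightedCone W S L} (hc : c.IsLimit) (b : Tᵒᵖ) :
    ((c.map (yonedaV V T)).map (evalAt b)).IsLimit := by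
  have h0 (t : T) (f : ∀ a, W.obj a ⟶ hom V t (S.obj a)) (a : A) :
      (f a ≫ (yonedaV V T).map t (S.obj a)) ≫ natObj.π _ _ b =
        f a ≫ corepMap b.unop t (S.obj a) :=
    (Category.assoc _ _ _).trans (congrArg (f a ≫ ·) (yonedaV_map_π t (S.obj a) b.unop))
  have h1 : IsVNat (S.comp V (corep b.unop)) ((S.comp V (yonedaV V T)).comp V (evalAt b))
      (fun a => 𝟙 (hom V b.unop (S.obj a))) := by
    intro a a'
    have h2 : ((S.comp V (yonedaV V T)).comp V (evalAt b)).map a a' =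
        (S.comp V (corep b.unop)).map a a' :=
      (Category.assoc _ _ _).trans
        (congrArg (S.map a a' ≫ ·) (yonedaV_map_π (S.obj a) (S.obj a') b.unop))
    refine (Category.comp_id _).trans ?_
    refine Eq.trans ?_ (congrArg (· ≫ _) (id_whiskerRight _ _)).symm
    exact (congrArg unc h2).symm.trans (Category.id_comp _).symm
  refine (h1.isLimit_iff (fun a => inferInstanceAs (IsIso (𝟙 _))) (c.map (corep b.unop)) _
    (𝟙 (hom V b.unop L)) (inferInstanceAs (IsIso (𝟙 (hom V b.unop L)))) fun a => ?_).1
    (c.isLimit_iff_corep.1 hc b.unop)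
  refine (Category.comp_id _).trans ?_
  refine Eq.trans ?_ (congrArg (· ≫ _) (id_whiskerRight _ _)).symm
  exact (congrArg unc (h0 L c.app a)).symm.trans (Category.id_comp _).symm

/-- The canonical map `F t ⟶ F * T(-, t)`, given by the coprojection at `t` and the identity
of `t`. -/
def toColim (t : T) : F.obj t ⟶ colimObj F ((yonedaV V T).obj t) :=
  (ρ_ _).inv ≫ F.obj t ◁ eId V t ≫ lunc (A := hom V t t) (colimι F ((yonedaV V T).obj t) t)

lemma lunc_braid_mulc {A B C X Y : V} (p : X ⟶ hom V A B) (q : Y ⟶ hom V B C) :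
    lunc ((β_ Y X).hom ≫ mulc p q) = (α_ _ _ _).hom ≫ Y ◁ lunc p ≫ lunc q := by
  rw [lunc_comp, lunc_mulc, ← comp_whiskerRight_assoc, SymmetricCategory.symmetry,
    id_whiskerRight, Category.id_comp]

lemma whisker_braid_mulc {A B C X Y Y' : V} (u : Y' ⟶ Y) (p : Y ⟶ hom V A B) (q : X ⟶ hom V B C) :
    X ◁ u ≫ (β_ X Y).hom ≫ mulc p q = (β_ X Y').hom ≫ mulc (u ≫ p) q := by
  rw [BraidedCategory.braiding_naturality_right_assoc, ← comp_mulc_left]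

lemma whisker_braid_mulc_id {A B C X Y : V} (q : X ⟶ hom V B C) (p : Y ⟶ hom V A B) :
    q ▷ Y ≫ (β_ (hom V B C) Y).hom ≫ mulc p (𝟙 (hom V B C)) = (β_ X Y).hom ≫ mulc p q := by
  rw [BraidedCategory.braiding_naturality_left_assoc, ← comp_mulc_right, Category.comp_id]

lemma lunc_yonedaV_obj_map (b b' t : T) :
    lunc (A := hom V b' t) (B := hom V b t) (((yonedaV V T).obj t).map (op b') (op b)) =
      eComp V b b' t := by
  have h : unc (A := hom V b' t) (B := hom V b t) (((yonedaV V T).obj t).map (op b') (op b)) =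
    (β_ _ _).hom ≫ eComp V b b' t := unc_cur _
  exact (congrArg ((β_ _ _).hom ≫ ·) h).trans (SymmetricCategory.symmetry_assoc _ _ _)

lemma eId_eComp (b t : T) : (ρ_ (hom V b t)).inv ≫ hom V b t ◁ eId V t ≫ eComp V b t t = 𝟙 _ :=
  e_comp_id V b t

/-- The map `F t ⟶ F * T(-, t)` is compatible with the coprojections
`F b ⊗ T(b, t) ⟶ F * T(-, t)`. -/
lemma map_toColim (b t : T) : unc (F.map b t) ≫ toColim F t =
    lunc (A := hom V b t) (colimι F ((yonedaV V T).obj t) b) := by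
  let p : hom V b t ⟶ hom V (hom V t t) (hom V b t) :=
    ((yonedaV V T).obj t).map (op t) (op b)
  let q : F.obj b ⟶ hom V (hom V b t) (colimObj F ((yonedaV V T).obj t)) :=
    colimι F ((yonedaV V T).obj t) b
  let q' : F.obj t ⟶ hom V (hom V t t) (colimObj F ((yonedaV V T).obj t)) :=
    colimι F ((yonedaV V T).obj t) t
  have h1 : (β_ _ _).hom ≫ mulc p q = unc (F.map b t) ≫ q' :=
    mulc_colimι F ((yonedaV V T).obj t) b t
  have h2 : lunc p = eComp V b t t := lunc_yonedaV_obj_map b t t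
  have h3 : unc (F.map b t) ▷ hom V t t ≫ lunc q' =
      (α_ _ _ _).hom ≫ F.obj b ◁ eComp V b t t ≫ lunc q := by
    rw [← lunc_comp, ← h1, lunc_braid_mulc, h2]
  change unc (F.map b t) ≫ (ρ_ _).inv ≫ F.obj t ◁ eId V t ≫ lunc q' = lunc q
  rw [rightUnitor_inv_naturality_assoc, ← whisker_exchange_assoc, h3,
    associator_naturality_right_assoc, ← MonoidalCategory.whiskerLeft_comp_assoc]
  rw [← MonoidalCategory.whiskerLeft_rightUnitor_inv_assoc,
    ← MonoidalCategory.whiskerLeft_comp_assoc, eId_eComp, MonoidalCategory.whiskerLeft_id,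
    Category.id_comp]

lemma isVNat_toColim :
    IsVNat F ((yonedaV V T).comp V (weightedColim F)) (toColim F) := by
  intro t t'
  refine (map_toColim F t t').trans ?_
  let p : F.obj t ⟶ hom V (hom V t t) (colimObj F ((yonedaV V T).obj t)) :=
    colimι F ((yonedaV V T).obj t) t
  let p' : F.obj t ⟶ hom V (hom V t t') (colimObj F ((yonedaV V T).obj t')) :=
    colimι F ((yonedaV V T).obj t') t
  let m : hom V t t' ⟶ hom V (colimObj F ((yonedaV V T).obj t))
      (colimObj F ((yonedaV V T).obj t')) :=
    (yonedaV V T).map t t' ≫ (weightedColim F).map _ _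
  have h1 : mulc p m = (β_ _ _).hom ≫ mulc (corepMap t t t') p' := by
    have h2 : mulc p ((weightedColim F).map ((yonedaV V T).obj t) ((yonedaV V T).obj t')) =
        (β_ _ _).hom ≫ mulc (natObj.π ((yonedaV V T).obj t) ((yonedaV V T).obj t') (op t)) p' :=
      isNat_colimι F t ((yonedaV V T).obj t) ((yonedaV V T).obj t')
    refine (comp_mulc_right _ _ _).trans ((congrArg (_ ◁ _ ≫ ·) h2).trans ?_)
    refine (whisker_braid_mulc _ _ _).trans ?_
    exact congrArg (fun z => (β_ _ _).hom ≫ mulc z p') (yonedaV_map_π t t' t)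
  have h2 : (β_ _ _).hom ▷ hom V t t ≫ (α_ _ _ _).hom ≫ hom V t t' ◁ lunc p ≫ lunc m =
      (α_ _ _ _).hom ≫ F.obj t ◁ lunc (corepMap t t t') ≫ lunc p' := by
    rw [← lunc_mulc, h1, lunc_braid_mulc]
  have h3 : (ρ_ (hom V t t')).inv ≫ hom V t t' ◁ eId V t ≫ lunc (corepMap t t t') = 𝟙 _ := by
    have h4 : unc (corepMap t t t') = eComp V t t t' := unc_cur _
    rw [lunc, h4, BraidedCategory.braiding_naturality_right_assoc]
    simp
  have h5 := congrArg (fun z => (ρ_ _).inv ≫ (F.obj t ⊗ hom V t t') ◁ eId V t ≫ z) h2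
  have h6 {X : V} (g : F.obj t ⟶ X) {Z : V} (k : hom V t t' ⟶ hom V X Z) :
      g ▷ hom V t t' ≫ unc k = (β_ _ _).hom ≫ _ ◁ g ≫ lunc k := by
    rw [lunc, BraidedCategory.braiding_naturality_right_assoc,
      SymmetricCategory.symmetry_assoc]
  change lunc p' = ((ρ_ _).inv ≫ F.obj t ◁ eId V t ≫ lunc p) ▷ hom V t t' ≫ unc m
  rw [h6]
  beta_reduce at h5
  rw [whisker_exchange_assoc, ← rightUnitor_inv_naturality_assoc,
    associator_naturality_right_assoc, associator_naturality_right_assoc,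
    ← MonoidalCategory.whiskerLeft_rightUnitor_inv_assoc,
    ← MonoidalCategory.whiskerLeft_rightUnitor_inv_assoc,
    ← MonoidalCategory.whiskerLeft_comp_assoc, ← MonoidalCategory.whiskerLeft_comp_assoc,
    ← MonoidalCategory.whiskerLeft_comp_assoc, ← MonoidalCategory.whiskerLeft_comp_assoc,
    Category.assoc, Category.assoc, h3, MonoidalCategory.whiskerLeft_id, Category.id_comp] at h5
  exact h5.symm

/-- A family that is compatible with the actions of `F` and `R` is `V`-natural as a family of maps
`F b ⟶ [R b, Z]`. -/
lemma isVNat_homInto {R : EnrichedFunctor V Tᵒᵖ V} {Z : V}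
    {n : ∀ b, F.obj b ⟶ hom V (R.obj (op b)) Z}
    (h : ∀ b b', (β_ _ _).hom ≫ mulc (R.map (op b') (op b)) (n b) = unc (F.map b b') ≫ n b') :
    IsVNat F (homInto R Z) n := by
  intro b b'
  let r : hom V b b' ⟶ hom V (op (R.obj (op b))) (op (R.obj (op b'))) := R.map (op b') (op b)
  have h1 : unc ((homInto R Z).map b b') =
      (β_ _ _).hom ≫ mulc (R.map (op b') (op b)) (𝟙 (hom V (R.obj (op b)) Z)) :=
    (unc_comp_corepMap (op Z) (op (R.obj (op b))) (op (R.obj (op b'))) r).trans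
      (mulc_op (K := V) (𝟙 (hom V (op Z) (op (R.obj (op b))))) r)
  refine (h b b').symm.trans ?_
  refine Eq.trans ?_ (congrArg (n b ▷ hom V b b' ≫ ·) h1).symm
  exact (whisker_braid_mulc_id (n b) (R.map (op b') (op b))).symm

/-- The co-Yoneda lemma: `F * T(-, t)` is `F t`. -/
lemma isIso_toColim (t : T) : IsIso (toColim F t) := by
  let R : EnrichedFunctor V Tᵒᵖ V := (yonedaV V T).obj t
  have hn : IsVNat F (homInto R (F.obj t))
      (fun b : T => lcur (A := hom V b t) (unc (F.map b t))) := by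
    refine isVNat_homInto F fun b b' => ?_
    let r : hom V b b' ⟶ hom V (hom V b' t) (hom V b t) := R.map (op b') (op b)
    have h1 : lunc r = eComp V b b' t := lunc_yonedaV_obj_map b b' t
    have h2 : unc (F.map b b') ▷ hom V b' t ≫ unc (F.map b' t) =
        (α_ _ _ _).hom ≫ F.obj b ◁ eComp V b b' t ≫ unc (F.map b t) :=
      (isLNat_unc_map b F b' t).trans
        (congrArg (fun z => (α_ _ _ _).hom ≫ F.obj b ◁ z ≫ unc (F.map b t)) (unc_cur _))
    have h3 : (β_ _ _).hom ≫ mulc r (lcur (unc (F.map b t))) =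
        unc (F.map b b') ≫ lcur (unc (F.map b' t)) := by
      apply lunc_injective
      rw [lunc_braid_mulc, lunc_lcur, comp_lcur, lunc_lcur, h1, h2]
    exact h3
  obtain ⟨φ, hφ⟩ := exists_colimDesc F R hn
  let q (b : T) : F.obj b ⟶ hom V (hom V b t) (colimObj F R) := colimι F R b
  have h1 (b : T) : lunc (q b) ≫ φ = unc (F.map b t) := by
    have h2 : unc (q b) ≫ φ = unc (lcur (unc (F.map b t))) := hφ b
    rw [lunc, Category.assoc, h2, unc_lcur, SymmetricCategory.symmetry_assoc]
  have h3 (b : T) : unc (F.map b t) ≫ toColim F t = lunc (q b) := map_toColim F b t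
  refine ⟨φ, ?_, colimι_hom_ext F fun b => ?_⟩
  · have h4 : toColim F t = (ρ_ _).inv ≫ F.obj t ◁ eId V t ≫ lunc (q t) := rfl
    rw [h4, Category.assoc, Category.assoc, h1, ← unc_comp, F.map_id, unc_eId, Iso.inv_hom_id]
  · have h4 : unc (q b) ≫ φ ≫ toColim F t = unc (q b) := by
      rw [← cancel_epi (β_ _ _).hom]
      have h5 : (β_ _ _).hom ≫ unc (q b) = lunc (q b) := rfl
      rw [h5, reassoc_of% h5, reassoc_of% (h1 b), h3]
    exact h4.trans (Category.comp_id _).symm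

/-- A flat functor is continuous: up to the isomorphism `F t ≅ F * T(-, t)` it is the composite of
the Yoneda embedding and `F * -`. -/
theorem IsFlat.isContinuous {F : EnrichedFunctor V T V} {Φ : WeightClass V} (hF : IsFlat Φ F)
    (hT : IsComplete Φ T) :
    IsContinuous Φ F := by
  refine ⟨hT, fun A _ W S L c hW hc => ?_⟩
  have h1 := hF.isLimit_map hW (c.map (yonedaV V T)) (isLimit_map_yonedaV hc)
  have h2 : IsVNat (S.comp V F) ((S.comp V (yonedaV V T)).comp V (weightedColim F))
      (fun a => toColim F (S.obj a)) := fun a b =>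
    (IsVNat.precomp S (isVNat_toColim F) a b).trans
      (congrArg (fun z => toColim F (S.obj a) ▷ hom V a b ≫ unc z) (Category.assoc _ _ _).symm)
  refine (h2.isLimit_iff (fun a => isIso_toColim F (S.obj a)) (c.map F)
    ((c.map (yonedaV V T)).map (weightedColim F)) (toColim F L) (isIso_toColim F L)
    fun a => ?_).2 h1
  have h3 := (isVNat_toColim F) L (S.obj a)
  refine (congrArg (· ≫ toColim F (S.obj a)) (unc_comp (c.app a) (F.map L (S.obj a)))).trans ?_
  refine (Category.assoc _ _ _).trans ((congrArg (F.obj L ◁ c.app a ≫ ·) h3).trans ?_)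
  refine (whisker_exchange_assoc _ _ _).trans (congrArg (toColim F L ▷ W.obj a ≫ ·) ?_)
  exact (unc_comp _ _).symm.trans (congrArg unc (Category.assoc _ _ _).symm)

end continuous

/-! ### Pointwise colimits are conical colimits -/

section pointwiseColimits
variable {V : Type u} [Category.{w} V] [MonoidalCategory V] [SymmetricCategory V] [MonoidalClosed V]
  [HasLimits V] [HasColimits V]
variable {T : Type w} [EnrichedCategory V T]

lemma lunc_name_mulc {A B C Y : V} (f : A ⟶ B) (g : Y ⟶ hom V B C) :
    lunc ((λ_ Y).inv ≫ mulc (name f) g) = Y ◁ f ≫ lunc g := by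
  rw [lunc_comp, lunc_mulc, lunc_name]
  simp

/-- The action of `[T, V](-, H)` on an element of `[T, V](G, G')`, composed with the projection of
the end at `s`. -/
lemma lunc_comp_corepMap_op_π {G G' : EnrichedFunctor V T V} (φ : 𝟙_ V ⟶ hom V G G')
    (H : EnrichedFunctor V T V) (s : T) {Y : V} (z : Y ⟶ hom V G' H) :
    lunc ((z ≫ (unname (φ ≫ corepMap (K := (EnrichedFunctor V T V)ᵒᵖ) (op H) (op G') (op G)) :
        hom V G' H ⟶ hom V G H)) ≫ natObj.π G H s) =
      Y ◁ unname (φ ≫ natObj.π G G' s) ≫ lunc (z ≫ natObj.π G' H s) := by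
  have h1 : (unname (φ ≫ corepMap (K := (EnrichedFunctor V T V)ᵒᵖ) (op H) (op G') (op G)) :
        hom V G' H ⟶ hom V G H) = (λ_ _).inv ≫ mulc φ (𝟙 (hom V G' H)) := by
    refine (unname_comp_corepMap (K := (EnrichedFunctor V T V)ᵒᵖ) (op H) (op G') (op G) φ).trans ?_
    refine (congrArg ((ρ_ _).inv ≫ ·) (mulc_op (K := EnrichedFunctor V T V)
      (𝟙 (hom V (op H) (op G'))) φ)).trans ?_
    refine (Category.assoc _ _ _).symm.trans (congrArg (· ≫ mulc φ (𝟙 (hom V G' H))) ?_)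
    exact rightUnitor_inv_braiding (C := V) (hom V G' H)
  have h2 : (z ≫ (λ_ _).inv ≫ mulc φ (𝟙 (hom V G' H))) ≫ natObj.π G H s =
      (λ_ _).inv ≫ mulc (φ ≫ natObj.π G G' s) (z ≫ natObj.π G' H s) := by
    rw [leftUnitor_inv_naturality_assoc, ← comp_mulc_right, Category.comp_id, Category.assoc,
      mulc_π]
  refine (congrArg (fun x => lunc ((z ≫ x) ≫ natObj.π G H s)) h1).trans ?_
  refine (congrArg lunc h2).trans ?_
  rw [← lunc_name_mulc, name_unname]

variable {E : Type w} [SmallCategory E] {P : E ⥤ ForgetEnrichment V (EnrichedFunctor V T V)}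

/-- The value at `e` of a diagram of `V`-functors. -/
abbrev diagObj (P : E ⥤ ForgetEnrichment V (EnrichedFunctor V T V)) (e : E) :
    EnrichedFunctor V T V :=
  ForgetEnrichment.to V (P.obj e)

/-- The component at `s` of the leg at `e` of a cocone in `[T, V]`. -/
def legAt (c : Cocone P) (e : E) (s : T) :
    (diagObj P e).obj s ⟶ (ForgetEnrichment.to V c.pt).obj s :=
  (und (evalAt s)).map (c.ι.app e)

lemma isVNat_legAt (c : Cocone P) (e : E) :
    IsVNat (diagObj P e) (ForgetEnrichment.to V c.pt) (legAt c e) :=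
  isVNat_map (c.ι.app e)

lemma lcur_injective {Y A B : V} {t t' : Y ⊗ A ⟶ B} (h : lcur t = lcur t') : t = t' := by
  rw [← lunc_lcur t, h, lunc_lcur]

/-- Maps out of `Y ⊗ F s`, for a pointwise colimit `F`, are determined on the legs. -/
lemma tensor_legAt_hom_ext {c : Cocone P} {s : T}
    (h : IsColimit ((und (evalAt s)).mapCocone c)) {Y Z : V}
    {f g : Y ⊗ (ForgetEnrichment.to V c.pt).obj s ⟶ Z}
    (hfg : ∀ e, Y ◁ legAt c e s ≫ f = Y ◁ legAt c e s ≫ g) : f = g := by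
  apply cur_injective
  refine h.hom_ext fun e => ?_
  refine (cur_comp (legAt c e s) f).symm.trans (Eq.trans ?_ (cur_comp (legAt c e s) g))
  rw [hfg e]

/-- As `Y ⊗ -` preserves colimits, maps out of `Y ⊗ F s` can be defined on the legs. -/
lemma exists_tensor_desc {c : Cocone P} {s : T}
    (h : IsColimit ((und (evalAt s)).mapCocone c)) {Y Z : V}
    (τ : ∀ e, Y ⊗ (diagObj P e).obj s ⟶ Z)
    (hτ : ∀ {e e' : E} (f : e ⟶ e'), Y ◁ (und (evalAt s)).map (P.map f) ≫ τ e' = τ e) :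
    ∃ f : Y ⊗ (ForgetEnrichment.to V c.pt).obj s ⟶ Z, ∀ e, Y ◁ legAt c e s ≫ f = τ e := by
  let d : Cocone (P ⋙ und (evalAt s)) :=
    { pt := hom V Y Z
      ι :=
        { app := fun e => cur (τ e)
          naturality := fun e e' f => by
            refine Eq.trans ?_ (Category.comp_id _).symm
            refine (cur_comp ((und (evalAt s)).map (P.map f)) (τ e')).symm.trans ?_
            exact congrArg cur (hτ f) } }
  let k : (ForgetEnrichment.to V c.pt).obj s ⟶ hom V Y Z := h.desc d
  have hk (e : E) : legAt c e s ≫ k = cur (τ e) := h.fac d e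
  exact ⟨unc k, fun e => by rw [← unc_comp, hk, unc_cur]⟩

/-- A colimit in `[T, V]` that is computed pointwise is a conical colimit: the end `[T, V](-, H)`
sends it to a limit, because generalized elements `Y ⟶ [T, V](F, H)` are families of maps
`Y ⊗ F s ⟶ H s`, which can be glued from the legs. -/
theorem isConicalColimit_of_pointwise (c : Cocone P)
    (h : ∀ s, Nonempty (IsColimit ((und (evalAt s)).mapCocone c))) :
    IsConicalColimit P (ForgetEnrichment.to V c.pt) := by
  let I := forgetEnrichmentOppositeEquivalence.inverse V (EnrichedFunctor V T V)
  refine ⟨ofCone (I.mapCone c.op), (WeightedCone.isLimit_iff_corep _).2 fun X =>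
    (isLimit_map_iff _ _).2 ?_⟩
  obtain ⟨H⟩ := X
  let F : EnrichedFunctor V T V := ForgetEnrichment.to V c.pt
  let D := (P.op ⋙ I) ⋙ und (corep (op H))
  let leg (e : E) : natObj F H ⟶ natObj (diagObj P e) H :=
    unname (ForgetEnrichment.homTo V (c.ι.app e) ≫ corepMap (K := (EnrichedFunctor V T V)ᵒᵖ)
      (op H) (op F) (op (diagObj P e)))
  have key (r : Cone D) : ∃! l : r.pt ⟶ natObj F H, ∀ e, l ≫ leg e.unop = r.π.app e := by
    let ρ (e : E) : r.pt ⟶ natObj (diagObj P e) H := r.π.app (op e)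
    let τ (e : E) (s : T) : r.pt ⊗ (diagObj P e).obj s ⟶ H.obj s :=
      lunc (ρ e ≫ natObj.π (diagObj P e) H s)
    have hτ (s : T) {e e' : E} (f : e ⟶ e') :
        r.pt ◁ (und (evalAt s)).map (P.map f) ≫ τ e' s = τ e s := by
      refine (lunc_comp_corepMap_op_π (ForgetEnrichment.homTo V (P.map f)) H s
        (ρ e')).symm.trans ?_
      exact congrArg (fun z => lunc (z ≫ natObj.π (diagObj P e) H s)) (r.w f.op)
    have hnat (e : E) : IsLNat (diagObj P e) H (τ e) :=
      (isNat_iff_isLNat _).1 ((natObj.isNat (diagObj P e) H).precomp (ρ e))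
    choose t ht using fun s => exists_tensor_desc (h s).some (fun e => τ e s) (hτ s)
    have hleg (l : r.pt ⟶ natObj F H) (e : E) (s : T) :
        lunc ((l ≫ leg e) ≫ natObj.π (diagObj P e) H s) =
          r.pt ◁ legAt c e s ≫ lunc (l ≫ natObj.π F H s) :=
      lunc_comp_corepMap_op_π (ForgetEnrichment.homTo V (c.ι.app e)) H s l
    have htnat : IsLNat F H t := by
      intro s s'
      -- Currying the hom-object `T(s, s')` away makes the equation one of maps out of `Y ⊗ F s`.
      apply lcur_injective
      refine tensor_legAt_hom_ext (h s).some fun e => ?_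
      rw [comp_lcur, comp_lcur]
      refine congrArg lcur ?_
      rw [← comp_whiskerRight_assoc, ht, hnat e s s', associator_naturality_middle_assoc,
        ← MonoidalCategory.whiskerLeft_comp_assoc]
      have h1 := isVNat_legAt c e s s'
      refine Eq.trans ?_ (congrArg (fun z => (α_ _ _ _).hom ≫ r.pt ◁ z ≫ t s') h1)
      rw [MonoidalCategory.whiskerLeft_comp_assoc, ht]
    refine ⟨natObj.lift (fun s => lcur (t s)) ((isNat_lcur_iff t).2 htnat), fun e => ?_,
      fun l hl => ?_⟩
    · refine natObj.hom_ext (f := natObj.lift _ ((isNat_lcur_iff t).2 htnat) ≫ leg e.unop)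
        (g := ρ e.unop) fun s => lunc_injective ?_
      refine (hleg _ e.unop s).trans ?_
      rw [natObj.lift_π, lunc_lcur, ht]
    · apply natObj.hom_ext
      intro s
      rw [natObj.lift_π]
      apply lunc_injective
      refine tensor_legAt_hom_ext (h s).some fun e => ?_
      rw [lunc_lcur, ht]
      refine (hleg l e s).symm.trans ?_
      exact congrArg (fun z => lunc (z ≫ natObj.π (diagObj P e) H s)) (hl (op e))
  choose l hl hu using key
  exact ⟨{ lift := l, fac := hl, uniq := fun r m hm => hu r m hm }⟩

end pointwiseColimits

/-! ### Continuous functors are filtered colimits of representables -/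

section complete
variable {V : Type u} [Category.{w} V] [MonoidalCategory V] [SymmetricCategory V] [MonoidalClosed V]
  [HasLimits V] [HasColimits V] {𝔻 : Doctrine.{w}}

lemma Doctrine.BasicWeight.weights {A : Type w} [EnrichedCategory V A] {W : EnrichedFunctor V A V}
    (h : 𝔻.BasicWeight V A W) : 𝔻.weights V A W := fun _ _ hle => hle _ _ h

variable {K : Type u₂} [EnrichedCategory V K]

lemma IsComplete.hasLimitsOfShape (hK : IsComplete (𝔻.weights V) K) (i : 𝔻.ι) :
    HasLimitsOfShape (𝔻.J i) (ForgetEnrichment V K) := by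
  refine ⟨fun S => ?_⟩
  obtain ⟨L, κ, hκ⟩ := hK _ _ (freeLift S) (Doctrine.BasicWeight.conical i).weights
  exact ⟨⟨⟨_, (isLimit_coneOf hκ).some⟩⟩⟩

lemma IsContinuous.preservesLimitsOfShape {F : EnrichedFunctor V K V}
    (hF : IsContinuous (𝔻.weights V) F) (i : 𝔻.ι) : PreservesLimitsOfShape (𝔻.J i) (und F) := by
  refine ⟨fun {S} => ?_⟩
  have hW : 𝔻.weights V _ (conicalWeight (𝔻.J i)) := (Doctrine.BasicWeight.conical i).weights
  obtain ⟨L, κ, hκ⟩ := hF.1 _ _ (freeLift S) hW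
  exact preservesLimit_of_preserves_limit_cone (isLimit_coneOf hκ).some
    ((isLimit_map_iff κ F).1 (hF.2 _ _ _ _ κ hW hκ)).some

/-- The constant `V`-functor on the unit `V`-category. -/
def constUnit (s : K) : EnrichedFunctor V UnitCat.{w} K where
  obj _ := s
  map _ _ := eId V s
  map_id _ := Category.id_comp _
  map_comp _ _ _ := (eId_mulc (eId V s)).symm

/-- The universal property of a `G`-power `p` of `s` that is preserved by `F`, on elements. -/
lemma IsContinuous.exists_power {F : EnrichedFunctor V K V} (hF : IsContinuous (𝔻.weights V) F)
    {G : V} (hG : 𝔻.IsEnrichedPresentable G) (s : K) :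
    ∃ (p : K) (k : G ⟶ hom V p s),
      (∀ (x : K) (g : G ⟶ hom V x s), ∃! f : 𝟙_ V ⟶ hom V x p, (λ_ G).inv ≫ mulc f k = g) ∧
      ∀ g : G ⟶ F.obj s, ∃! x : 𝟙_ V ⟶ F.obj p,
        (λ_ G).inv ≫ x ▷ G ≫ unc (k ≫ F.map p s) = g := by
  have hW : 𝔻.weights V _ (powerWeight G) := (Doctrine.BasicWeight.power G hG).weights
  obtain ⟨p, κ, hκ⟩ := hF.1 _ _ (constUnit s) hW
  let k : G ⟶ hom V p s := κ.app UnitCat.star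
  have hnat (N : EnrichedFunctor V UnitCat.{w} V) (t : ∀ a : UnitCat.{w}, 𝟙_ V ⊗ G ⟶ N.obj a) :
      IsLNat (powerWeight G) N t := (isNat_lcur_iff t).1 (isNat_powerWeight G N _)
  refine ⟨p, k, fun x g => ?_, fun g => ?_⟩
  · refine (existsUnique_congr fun f => ?_).1 ((κ.isLimit_iff_mulc.1 hκ) x (𝟙_ V)
      (fun _ => (λ_ G).hom ≫ g) (hnat ((constUnit s).comp V (corep x)) _))
    rw [Iso.inv_comp_eq]
    exact ⟨fun h => h UnitCat.star, fun h => by rintro ⟨⟩; exact h⟩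
  · refine (existsUnique_congr fun f => ?_).1
      (((κ.map F).isLimit_iff_unc.1 (hF.2 _ _ _ _ κ hW hκ)) (𝟙_ V)
      (fun _ => (λ_ G).hom ≫ g) (hnat ((constUnit s).comp V F) _))
    rw [Iso.inv_comp_eq]
    exact ⟨fun h => h UnitCat.star, fun h => by rintro ⟨⟩; exact h⟩

end complete

section elements
variable {V : Type u} [Category.{w} V] [MonoidalCategory V] [SymmetricCategory V] [MonoidalClosed V]
  [HasLimits V] [HasColimits V] {𝔻 : Doctrine.{w}}
variable {T : Type w} [EnrichedCategory V T] (F : EnrichedFunctor V T V)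

/-- The set-valued functor `t ↦ V(𝟙, F t)`. -/
abbrev points : ForgetEnrichment V T ⥤ Type w := und F ⋙ coyoneda.obj (op (𝟙_ V))

/-- The category of elements has `𝔻`-limits, so in its opposite every category of cocones has an
initial object; soundness applies. -/
lemma isFiltered_elements (h𝔻 : 𝔻.IsSound) {F : EnrichedFunctor V T V}
    (hF : IsContinuous (𝔻.weights V) F) : 𝔻.IsFiltered (points F).Elementsᵒᵖ := by
  refine h𝔻 _ fun i S => ?_
  have := hF.1.hasLimitsOfShape i
  have := hF.preservesLimitsOfShape i
  have : PreservesLimitsOfShape (𝔻.J i) (points F) := inferInstance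
  have : HasLimitsOfShape (𝔻.J i) (points F).Elements := inferInstance
  have : HasLimitsOfShape (𝔻.J i)ᵒᵖᵒᵖ (points F).Elements :=
    hasLimitsOfShape_of_equivalence (opOpEquivalence (𝔻.J i)).symm
  have : HasColimitsOfShape (𝔻.J i)ᵒᵖ (points F).Elementsᵒᵖ :=
    hasColimitsOfShape_op_of_hasLimitsOfShape
  exact isConnected_of_isInitial _ (Cocone.isColimitEquivIsInitial _ (colimit.isColimit S))

/-- The projection from the category of elements of `F`. -/
def elementsDiagram : (points F).Elementsᵒᵖ ⥤ ForgetEnrichment V Tᵒᵖ :=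
  (CategoryOfElements.π (points F)).op ⋙ forgetEnrichmentOppositeEquivalence.inverse V T

/-- The canonical cocone with vertex `F`, under the representables indexed by the elements of
`F`. -/
def elementsCocone : Cocone (elementsDiagram F ⋙ (reps V T).forget) :=
  elementCocone (F := F) (t := elementsDiagram F) (fun e => e.unop.2) (fun f => f.unop.2)

/-- The component at `s` of the map `T(b, -) ⟶ F` given by an element `x` of `F b`. -/
lemma eval_yonedaArrow {b : T} (x : 𝟙_ V ⟶ F.obj b) (s : T) :
    (und (evalAt s)).map (yonedaArrow b F x) = (λ_ _).inv ≫ x ▷ hom V b s ≫ unc (F.map b s) := by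
  have h1 : (x ≫ yonedaMap b F) ≫ natObj.π (corep b) F s =
      lcur (x ▷ hom V b s ≫ unc (F.map b s)) := by
    rw [Category.assoc, yonedaMap_π]
    exact comp_lcur x (unc (F.map b s))
  refine (congrArg unname h1).trans ((congrArg ((ρ_ _).inv ≫ ·) (unc_lcur _)).trans ?_)
  exact rightUnitor_inv_braiding_assoc _ _

/-- The transition maps `T(t e, s) ⟶ T(t e', s)` are given by composition. -/
lemma elementsCocone_transition {e e' : (points F).Elementsᵒᵖ} (f : e ⟶ e') (s : T) {G : V}
    (k : G ⟶ hom V (obB (elementsDiagram F) e) s) :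
    k ≫ (und (evalAt s)).map ((elementsDiagram F ⋙ (reps V T).forget).map f) =
      (λ_ G).inv ≫ mulc (mapB (elementsDiagram F) f) k := by
  let m : 𝟙_ V ⟶ hom V (obB (elementsDiagram F) e') (obB (elementsDiagram F) e) :=
    mapB (elementsDiagram F) f
  have h1 := eval_yonedaArrow (corep (obB (elementsDiagram F) e')) m s
  refine (congrArg (k ≫ ·) h1).trans ?_
  have h2 : unc ((corep (obB (elementsDiagram F) e')).map (obB (elementsDiagram F) e) s) =
    eComp V _ _ _ := unc_cur _
  refine (congrArg (fun z => k ≫ (λ_ _).inv ≫ m ▷ _ ≫ z) h2).trans ?_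
  rw [leftUnitor_inv_naturality_assoc, mulc, MonoidalCategory.tensorHom_def', Category.assoc]
  rfl

lemma unc_element_mulc {A B C Y : V} (f : 𝟙_ V ⟶ hom V A B) (g : Y ⟶ hom V B C) :
    unc ((λ_ Y).inv ≫ mulc f g) = unname f ▷ Y ≫ unc g := by
  rw [unc_comp, unc_mulc, unname]
  simp

/-- The values of the canonical cocone are colimits: this is tested on the generators `G`, for which
the `G`-power of `s` gives the element through which a map `G ⟶ F s` factors universally. -/
theorem isColimit_eval_elementsCocone (hV : 𝔻.IsTensorLocallyPresentable V)
    {F : EnrichedFunctor V T V} (hF : IsContinuous (𝔻.weights V) F) (s : T) :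
    Nonempty (IsColimit ((und (evalAt s)).mapCocone (elementsCocone F))) := by
  obtain ⟨ι, G, hG, hr⟩ := hV.1.exists_generators
  refine hr _ _ _ fun a => ?_
  obtain ⟨p, k, hp, hx⟩ := hF.exists_power (hV.isEnrichedPresentable (hG a)) s
  let t := elementsDiagram F
  let leg (e) : hom V (obB t e) s ⟶ F.obj s :=
    (λ_ _).inv ≫ (show 𝟙_ V ⟶ F.obj (obB t e) from e.unop.2) ▷ _ ≫ unc (F.map (obB t e) s)
  have hleg (e) : (und (evalAt s)).map ((elementsCocone F).ι.app e) = leg e :=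
    eval_yonedaArrow F (b := obB t e) e.unop.2 s
  choose x hxe hxu using hx
  -- A map `g : G a ⟶ F s` is the element `x g` of `F` at the power `p`, and it factors through the
  -- leg at this element by the counit `k : G a ⟶ T(p, s)`.
  let el (g : G a ⟶ F.obj s) : (points F).Elementsᵒᵖ := op ⟨ForgetEnrichment.of V p, x g⟩
  have hcomp {b : T} (y : 𝟙_ V ⟶ F.obj b) (h : G a ⟶ hom V b s) :
      h ≫ (λ_ _).inv ≫ y ▷ hom V b s ≫ unc (F.map b s) =
        (λ_ (G a)).inv ≫ y ▷ G a ≫ unc (h ≫ F.map b s) := by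
    rw [leftUnitor_inv_naturality_assoc, whisker_exchange_assoc, unc_comp]
  have hel (g : G a ⟶ F.obj s) : k ≫ leg (el g) = g := (hcomp (x g) k).trans (hxe g)
  -- Each factorization `h` of `g` through a leg is linked to the one above by a morphism of
  -- elements, so the desired map is forced and well defined.
  have hmor (e : (points F).Elementsᵒᵖ) (h : G a ⟶ hom V (obB t e) s) :
      ∃ f : el (h ≫ leg e) ⟶ e, (λ_ (G a)).inv ≫ mulc (mapB t f) k = h := by
    obtain ⟨f, hf, -⟩ := hp (obB t e) h
    let y : 𝟙_ V ⟶ F.obj (obB t e) := e.unop.2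
    have h1 : y ≫ unname (f ≫ F.map (obB t e) p) = x (h ≫ leg e) := by
      refine hxu _ _ ?_
      have h2 : h ≫ F.map (obB t e) s =
          (λ_ _).inv ≫ mulc (f ≫ F.map (obB t e) p) (k ≫ F.map p s) := by
        rw [← mulc_map, ← Category.assoc, hf]
      beta_reduce
      rw [comp_whiskerRight_assoc, ← unc_element_mulc, ← h2]
      exact (hcomp y h).symm
    exact ⟨Quiver.Hom.op (X := e.unop) (Y := (el (h ≫ leg e)).unop)
      ⟨ForgetEnrichment.homOf V f, h1⟩, hf⟩
  let N := (elementsDiagram F ⋙ (reps V T).forget) ⋙ und (evalAt s) ⋙ coyoneda.obj (op (G a))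
  have key (c : Cocone N) : ∃! d : (G a ⟶ F.obj s) → c.pt,
      ∀ e (h : G a ⟶ hom V (obB t e) s), d (h ≫ leg e) = c.ι.app e h := by
    refine ⟨fun g => c.ι.app (el g) k, fun e h => ?_, fun d hd => funext fun g => ?_⟩
    · obtain ⟨f, hf⟩ := hmor e h
      have h1 := ConcreteCategory.congr_hom (c.w f) k
      refine h1.symm.trans (congrArg (c.ι.app e) ?_)
      exact (elementsCocone_transition F f s k).trans hf
    · exact (congrArg d (hel g)).symm.trans (hd (el g) k)
  choose d hd hu using key
  exact ⟨{ desc := fun c => TypeCat.ofHom (d c)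
           fac := fun c e => by
            ext h
            exact (congrArg (fun z => d c (h ≫ z)) (hleg e)).trans (hd c e h)
           uniq := fun c m hm => by
            refine ConcreteCategory.hom_ext _ _ fun g =>
              congrFun (hu c (fun g => m g) fun e h => ?_) g
            refine Eq.trans ?_ (ConcreteCategory.congr_hom (hm e) h)
            exact congrArg (fun z => m (h ≫ z)) (hleg e).symm }⟩

/-- A continuous `V`-functor is the colimit of the representables indexed by its elements. -/
theorem IsContinuous.isFilteredColimitOfRepresentables (h𝔻 : 𝔻.IsSound)
    (hV : 𝔻.IsTensorLocallyPresentable V) {F : EnrichedFunctor V T V}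
    (hF : IsContinuous (𝔻.weights V) F) : 𝔻.IsFilteredColimitOfRepresentables F :=
  ⟨_, inferInstance, elementsDiagram F ⋙ (reps V T).forget, isFiltered_elements h𝔻 hF,
    fun e => ⟨obB (elementsDiagram F) e, ⟨Iso.refl _⟩⟩,
    isConicalColimit_of_pointwise (elementsCocone F) (isColimit_eval_elementsCocone hV hF)⟩

end elements

/-! ### Colimits weighted by a flat weight -/

section weightedColim
variable {V : Type u} [Category.{w} V] [MonoidalCategory V] [SymmetricCategory V] [MonoidalClosed V]
  [HasLimits V] [HasColimits V]

/-- Limits in `[Bᵒᵖ, V]` are pointwise, so flatness makes `G * -` preserve them. -/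
theorem IsFlat.isContinuous_weightedColim {Φ : WeightClass V} {B : Type w} [EnrichedCategory V B]
    {G : EnrichedFunctor V B V} (hG : IsFlat Φ G) : IsContinuous Φ (weightedColim G) := by
  refine ⟨fun A _ W S _ => ?_, fun A _ W S L c hW hc => ?_⟩
  · obtain ⟨L, c, hc⟩ := WeightedCone.exists_pointwise_limit W S
    exact ⟨L, c, c.isLimit_of_pointwise hc⟩
  · obtain ⟨L', c', hc'⟩ := WeightedCone.exists_pointwise_limit W S
    exact WeightedCone.IsLimit.map_of_map hc (c'.isLimit_of_pointwise hc') _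
      (hG.isLimit_map hW c' hc')

end weightedColim

end EnrichedTheory
end

theorem mainTheorem9 {V : Type u} [Category.{w} V] [MonoidalCategory V] [SymmetricCategory V]
    [MonoidalClosed V] [HasLimits V] [HasColimits V] (𝔻 : EnrichedTheory.Doctrine.{w})
    (h𝔻 : 𝔻.IsSound) (hV : 𝔻.IsTensorLocallyPresentable V) :
    (∀ (T : Type w) [EnrichedCategory V T], EnrichedTheory.IsComplete (𝔻.weights V) T →
      ∀ F : EnrichedFunctor V T V,
        List.TFAE [𝔻.IsFilteredColimitOfRepresentables F,
          EnrichedTheory.IsFlat (𝔻.weights V) F,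
          EnrichedTheory.IsContinuous (𝔻.weights V) F]) ∧
    EnrichedTheory.AxiomA (𝔻.weights V) := by
  refine ⟨fun T _ hT F => ?_, fun A _ F _ hF => ?_⟩
  · tfae_have 1 → 2 := fun h => h.isFlat hV.1
    tfae_have 2 → 3 := fun h => h.isContinuous hT
    tfae_have 3 → 1 := fun h => h.isFilteredColimitOfRepresentables h𝔻 hV
    tfae_finish
  · exact ((hF.isFilteredColimitOfRepresentables h𝔻 hV).isFlat hV.1).isContinuous_weightedColim
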